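/- **Theorem (Abstract Strichartz estimates II, the non-endpoint case).** Let $\mathcal H$ be a complex Hilbert space and let $H_0$, $H$ be self-adjoint operators on $\mathcal H$. Let $Y$, $Z$ be densely defined closed (not necessarily bounded) operators on $\mathcal H$ such that $H=H_0+Y^*Z$ in the sense that $$D(H_0)\cup D(H)\subset D(Y)\cap D(Z),\qquad \langle Hf,g\rangle=\langle f,H_0g\rangle+\langle Zf,Yg\rangle\quad (f\in D(H),\ g\in D(H_0)).$$ Let $\mathcal B$ be a complex Banach space such that $(\mathcal H,\mathcal B)$ is a Banach couple, i.e. $\mathcal H$ and $\mathcal B$ are continuously and linearly embedded in a common Hausdorff topological vector space. Let $b:\mathbb R\to\mathbb C$ be a bounded Borel function, and let $b(H)$ and $e^{-itH}$ be defined by the spectral theorem. A densely defined closed operator $B$ on $\mathcal H$ is called $H$-smooth with bound $a$ if $$\sup_{z\in\mathbb C\setminus\mathbb R}\big|\big\langle \big((H-z)^{-1}-(H-\bar z)^{-1}\big)B^*f,\,B^*f\big\rangle\big|\le \tfrac{a^2}{2}\|f\|^2\qquad (f\in D(B^*)),$$ and similarly for $H_0$. The operator $Zb(H)$ is taken on its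 natural domain $\{\psi : b(H)\psi\in D(Z)\}$. Fix $T>0$, write $\langle F,G\rangle_T=\int_{-T}^{T}\langle F(t),G(t)\rangle\,dt$ and $L^q_T\mathcal B=L^q([-T,T];\mathcal B)$. Let $p>2$ be real, $p'=p/(p-1)$, and let $s_1,s_2,s_3>0$ be such that * (S1$'$) $|\langle e^{-itH_0}\psi,G\rangle_T|\le s_1\|\psi\|\,\|G\|_{L^{p'}_T\mathcal B}$ for all $\psi\in\mathcal H$ and all simple functions $G:[-T,T]\to D(H_0)\cap\mathcal B$; * (S2$'$) $Y$ is $H_0$-smooth with bound $s_2$; * (S3$'$) $Zb(H)$ is $H$-smooth with bound $s_3$. Then, for all $\psi\in\mathcal H$ and all simple functions $G:[-T,T]\to D(H_0)\cap\mathcal B$, $$\big|\langle e^{-itH}b(H)\psi,G\rangle_T\big|\le\Big(s_1\sup_{x\in\mathbb R}|b(x)|+2C_p\,s_1s_2s_3\Big)\|\psi\|\,\|G\|_{L^{p'}_T\mathcal B},\qquad C_p=2^{2/p}\big(1-2^{1/p-1/2}\big)^{-1}.$$ -/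

import Mathlib

namespace SpectralCalc

variable {𝓗 : Type*} [NormedAddCommGroup 𝓗] [InnerProductSpace ℂ 𝓗] [CompleteSpace 𝓗]

/-- A projection-valued measure on the Borel sets of `ℝ`: the values are orthogonal projections,
`E (A ∩ B) = E A E B`, `E ℝ = 1`, and `E` is countably additive in the strong operator topology. -/
structure PVM (𝓗 : Type*) [NormedAddCommGroup 𝓗] [InnerProductSpace ℂ 𝓗] [CompleteSpace 𝓗] where
  proj : Set ℝ → 𝓗 →L[ℂ] 𝓗
  selfAdjoint : ∀ A, MeasurableSet A → IsSelfAdjoint (proj A)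
  inter : ∀ A B, MeasurableSet A → MeasurableSet B → proj (A ∩ B) = proj A ∘L proj B
  univ : proj Set.univ = ContinuousLinearMap.id ℂ 𝓗
  iUnion : ∀ A : ℕ → Set ℝ, (∀ n, MeasurableSet (A n)) → Pairwise (Function.onFun Disjoint A) →
    ∀ ψ : 𝓗, HasSum (fun n => proj (A n) ψ) (proj (⋃ n, A n) ψ)

theorem PVM.inner_proj (E : PVM 𝓗) (ψ : 𝓗) {A : Set ℝ} (hA : MeasurableSet A) :
    inner ℂ ψ (E.proj A ψ) = ((‖E.proj A ψ‖ ^ 2 : ℝ) : ℂ) := by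
  have h1 : E.proj A ψ = E.proj A (E.proj A ψ) := by
    have := E.inter A A hA hA
    rw [Set.inter_self] at this
    exact congrArg (fun T => T ψ) this
  have h2 := (E.selfAdjoint A hA).isSymmetric ψ (E.proj A ψ)
  simp only [ContinuousLinearMap.coe_coe] at h2
  rw [h1, ← h2, ← h1, inner_self_eq_norm_sq_to_K]
  norm_num

theorem PVM.proj_empty (E : PVM 𝓗) (ψ : 𝓗) : E.proj ∅ ψ = 0 := by
  have h := E.iUnion (fun _ => ∅) (fun _ => MeasurableSet.empty)
    (fun _ _ _ => disjoint_bot_left) ψ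
  exact tendsto_nhds_unique tendsto_const_nhds h.summable.tendsto_atTop_zero

/-- The scalar spectral measure `A ↦ ⟨ψ, E(A) ψ⟩ = ‖E(A) ψ‖²`. -/
noncomputable def PVM.scalar (E : PVM 𝓗) (ψ : 𝓗) : MeasureTheory.Measure ℝ :=
  MeasureTheory.Measure.ofMeasurable (fun A _ => ENNReal.ofReal (‖E.proj A ψ‖ ^ 2))
    (by simp [E.proj_empty ψ])
    (by
      intro A hA hd
      have h := (E.iUnion A hA hd ψ).mapL (innerSL ℂ ψ)
      simp only [innerSL_apply_apply, E.inner_proj ψ (hA _),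
        E.inner_proj ψ (MeasurableSet.iUnion hA)] at h
      have h' := Complex.hasSum_ofReal.mp h
      rw [← h'.tsum_eq]
      exact ENNReal.ofReal_tsum_of_nonneg (fun n => by positivity) h'.summable)

/-- `E` is the spectral measure of the operator `H`, that is `H = ∫ x dE(x)`: the domain of `H`
consists of those `ψ` for which `∫ x² d⟨ψ, E(x) ψ⟩ < ∞`, and `⟨ψ, H ψ⟩ = ∫ x d⟨ψ, E(x) ψ⟩` there. -/
def PVM.IsSpectralMeasureOf (E : PVM 𝓗) (H : 𝓗 →ₗ.[ℂ] 𝓗) : Prop :=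
  (∀ ψ : 𝓗, ψ ∈ H.domain ↔ ∫⁻ x, ENNReal.ofReal (x ^ 2) ∂(E.scalar ψ) < ⊤) ∧
  ∀ ψ : H.domain, inner ℂ (ψ : 𝓗) (H ψ) = ((∫ x, x ∂(E.scalar (ψ : 𝓗)) : ℝ) : ℂ)

open Classical in
/-- The operator `∫ b dE` for a bounded Borel function `b`: the bounded operator `S` whose quadratic
form is `⟨ψ, S ψ⟩ = ∫ b d⟨ψ, E ψ⟩` (a bounded operator on a complex Hilbert space is determined by
its quadratic form). -/
noncomputable def PVM.integral (E : PVM 𝓗) (b : ℝ → ℂ) : 𝓗 →L[ℂ] 𝓗 :=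
  if h : ∃ S : 𝓗 →L[ℂ] 𝓗, ∀ ψ : 𝓗, inner ℂ ψ (S ψ) = ∫ x, b x ∂(E.scalar ψ) then h.choose else 0

open Classical in
/-- `b(H)` for a self-adjoint operator `H` and a bounded Borel function `b`: the integral of `b`
against the (unique) spectral measure of `H`. -/
noncomputable def borelCalc (H : 𝓗 →ₗ.[ℂ] 𝓗) (b : ℝ → ℂ) : 𝓗 →L[ℂ] 𝓗 :=
  if h : ∃ E : PVM 𝓗, E.IsSpectralMeasureOf H then h.choose.integral b else 0

/-- The unitary group `e^{-itH}`. -/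
noncomputable def evol (H : 𝓗 →ₗ.[ℂ] 𝓗) (t : ℝ) : 𝓗 →L[ℂ] 𝓗 :=
  borelCalc H (fun x => Complex.exp (-(Complex.I * t * x)))

open Classical in
/-- The resolvent `R_H(z) = (H - z)⁻¹`: `resolvent H z x` is the solution `u ∈ D(H)` of
`H u - z u = x` (which exists and is unique if `H` is self-adjoint and `z` is not real). -/
noncomputable def resolvent (H : 𝓗 →ₗ.[ℂ] 𝓗) (z : ℂ) (x : 𝓗) : 𝓗 :=
  if h : ∃ u : H.domain, H u - z • (u : 𝓗) = x then (h.choose : 𝓗) else 0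

/-- The densely defined closed operator `B` is `H`-smooth with bound `a`:
`|⟨(R_H(z) - R_H(z̄)) B* f, B* f⟩| ≤ (a²/2) ‖f‖²` for all non-real `z` and all `f ∈ D(B*)`. -/
def IsSmoothWithBound (H B : 𝓗 →ₗ.[ℂ] 𝓗) (a : ℝ) : Prop :=
  Dense (B.domain : Set 𝓗) ∧ B.IsClosed ∧
  ∀ z : ℂ, z.im ≠ 0 → ∀ f : B.adjoint.domain,
    ‖inner ℂ (resolvent H z (B.adjoint f) - resolvent H (starRingEnd ℂ z) (B.adjoint f))
      (B.adjoint f)‖ ≤ a ^ 2 / 2 * ‖(f : 𝓗)‖ ^ 2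

/-- The product `Z S` of an unbounded operator `Z` and a bounded operator `S`, on its natural
domain `{ψ | S ψ ∈ D(Z)}`. -/
def mulBounded (Z : 𝓗 →ₗ.[ℂ] 𝓗) (S : 𝓗 →L[ℂ] 𝓗) : 𝓗 →ₗ.[ℂ] 𝓗 where
  domain := Z.domain.comap (S : 𝓗 →ₗ[ℂ] 𝓗)
  toFun := Z.toFun ∘ₗ (S : 𝓗 →ₗ[ℂ] 𝓗).submoduleComap Z.domain

/-- `H = H₀ + Y* Z` in the weak sense: `D(H₀) ∪ D(H) ⊆ D(Y) ∩ D(Z)` and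
`⟨H f, g⟩ = ⟨f, H₀ g⟩ + ⟨Z f, Y g⟩` for `f ∈ D(H)` and `g ∈ D(H₀)`. -/
def IsFactoredPerturbation (H₀ H Y Z : 𝓗 →ₗ.[ℂ] 𝓗) : Prop :=
  ∃ (h₀Y : H₀.domain ≤ Y.domain) (_ : H₀.domain ≤ Z.domain)
    (_ : H.domain ≤ Y.domain) (hZ : H.domain ≤ Z.domain),
    ∀ (f : H.domain) (g : H₀.domain),
      inner ℂ (H f) (g : 𝓗) = inner ℂ (f : 𝓗) (H₀ g)
        + inner ℂ (Z ⟨f, hZ f.2⟩) (Y ⟨g, h₀Y g.2⟩)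

/-- The intersection `D ∩ 𝓑` for a subspace `D` of `𝓗`, where `𝓗` and `𝓑` are embedded in a common
space `V` by `i` and `j`. An element is recorded as the pair of its representatives in `𝓗` and
in `𝓑`. -/
def interSpace {𝓑 V : Type*} [NormedAddCommGroup 𝓑] [NormedSpace ℂ 𝓑]
    [AddCommGroup V] [Module ℂ V] [TopologicalSpace V]
    (i : 𝓗 →L[ℂ] V) (j : 𝓑 →L[ℂ] V) (D : Submodule ℂ 𝓗) : Set (𝓗 × 𝓑) :=
  {q | q.1 ∈ D ∧ i q.1 = j q.2}

/-- The constant `C_p = 2^{2/p} (1 - 2^{1/p - 1/2})⁻¹`. -/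
noncomputable def christKiselevConst (p : ℝ) : ℝ :=
  (2 : ℝ) ^ (2 / p) * (1 - (2 : ℝ) ^ (1 / p - 1 / 2))⁻¹

/-- The pairing `⟨F, G⟩_T = ∫_{-T}^{T} ⟨F(t), G(t)⟩ dt` with a function `G` valued in `D ∩ 𝓑`. -/
noncomputable def pairing {𝓑 : Type*} {S : Set (𝓗 × 𝓑)} (T : ℝ) (F : ℝ → 𝓗)
    (G : MeasureTheory.SimpleFunc ℝ S) : ℂ :=
  ∫ t in (-T)..T, inner ℂ (F t) (G t).1.1

/-- The norm of `G` in `L^q([-T,T]; 𝓑)`, for a simple function `G` valued in `D ∩ 𝓑`. -/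
noncomputable def timeNorm {𝓑 : Type*} [NormedAddCommGroup 𝓑] {S : Set (𝓗 × 𝓑)} (T q : ℝ)
    (G : MeasureTheory.SimpleFunc ℝ S) : ℝ :=
  (∫ t in (-T)..T, ‖(G t).1.2‖ ^ q) ^ (1 / q)

end SpectralCalc

/-! ### Abstract functional calculi and their extension to L² -/

open MeasureTheory Filter Topology
open scoped ENNReal

namespace SpectralCalc

/-! The heart is a Duhamel formula combined with a Christ–Kiselev argument. By density take ψ = u in
D(H), and put f = b(H)u, F(s) = Z e^{-isH} f, c(t) = e^{itH₀} e^{-itH} f. The factorization of H -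
H₀ gives ⟨c(m) - c(a), g⟩ = i ∫_a^m ⟨F(s), Y e^{-isH₀} g⟩ ds for g in D(H₀). Smoothness of Y and
Cauchy–Schwarz then yield ‖c(m) - c(a)‖ ≤ √2 s₂ (∫_a^m ‖F‖²)^{1/2} (`norm_interaction_sub_le`),
while smoothness of Z b(H) bounds the L² norm of F on [-T, T] by √2 s₃ ‖u‖.

Write e^{-itH} f = e^{-itH₀} c(-T) + e^{-itH₀} (c(t) - c(-T)). The first term is a free evolution of
a vector of norm at most sup|b| ‖u‖. For the second, let K(a, b) be the pairing over [a, b] of G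
with e^{-itH₀} (c(t) - c(a)). Then K(a, b) = K(a, m) + K(m, b) plus the pairing over [m, b] of G
with the free evolution of the fixed vector c(m) - c(a), to which the free estimate applies.
Choosing m to halve ∫‖G‖^q, q = p', turns a bound for K with constant A into one with constant
2^{1/2-1/q} A + D. As q < 2 this is a contraction, and iterating gives D (1 - 2^{1/2-1/q})⁻¹
(`norm_le_of_christKiselev`).

The smoothing estimate ∫_{-T}^T ‖B e^{-itH} u‖² dt ≤ 2a² ‖u‖² (`integral_smooth_le`) is derived from
the resolvent condition, which by duality says ‖B v‖² ≤ a²/(4|Im z|) ‖(H - z)v‖². The Fourier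
transform of e^{-βt²} B e^{-itH} u at ξ is B k_ξ(H) u with a Gaussian k_ξ; the inequality is applied
with z adapted to ξ and β, integrated in ξ, and Plancherel is used.

All functions of H come from the spectral theorem, proved here from the continuous functional
calculus of the normal operator (H + i)⁻¹. One abstract device, the L² closure `HasVal` of a
functional calculus, serves both that proof and the calculus of H. -/

theorem le_of_forall_le_add_add {a b : ℝ≥0∞} (h : ∀ ε : ℝ≥0∞, ε ≠ 0 → a ≤ b + (ε + ε)) :
    a ≤ b := by
  refine ENNReal.le_of_forall_pos_le_add fun ε hε _ => ?_
  have := h ((ε : ℝ≥0∞) / 2) (by simpa using hε.ne')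
  rwa [ENNReal.add_halves] at this

theorem lintegral_enorm_sq {X : Type*} [MeasurableSpace X] {F : Type*} [NormedAddCommGroup F]
    (ν : Measure X) (f : X → F) :
    ∫⁻ x, ‖f x‖ₑ ^ 2 ∂ν = eLpNorm f 2 ν ^ 2 := by
  have := eLpNorm_nnreal_pow_eq_lintegral (μ := ν) (f := f) (p := 2) two_ne_zero
  simp only [NNReal.coe_ofNat, ENNReal.coe_ofNat] at this
  rw [← ENNReal.rpow_ofNat, this]
  simp

theorem eLpNorm_two_withDensity {X : Type*} [MeasurableSpace X] {ν : Measure X} {f g : X → ℂ}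
    (hf : Measurable f) (hg : AEMeasurable g ν) :
    eLpNorm f 2 (ν.withDensity fun x => ‖g x‖ₑ ^ 2) = eLpNorm (f * g) 2 ν := by
  have : eLpNorm f 2 (ν.withDensity fun x => ‖g x‖ₑ ^ 2) ^ 2 = eLpNorm (f * g) 2 ν ^ 2 := by
    rw [← lintegral_enorm_sq, ← lintegral_enorm_sq,
      lintegral_withDensity_eq_lintegral_mul₀ (by fun_prop) (by fun_prop)]
    refine lintegral_congr fun x => ?_
    simp only [Pi.mul_apply, enorm_mul, mul_pow]
    ring
  exact (ENNReal.pow_right_strictMono two_ne_zero).injective this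

theorem measure_eq_eLpNorm_indicator_sq {X : Type*} [MeasurableSpace X] (ν : Measure X) {s : Set X}
    (hs : MeasurableSet s) : ν s = eLpNorm (s.indicator (1 : X → ℂ)) 2 ν ^ 2 := by
  rw [← lintegral_enorm_sq]
  have : (fun x => ‖s.indicator (1 : X → ℂ) x‖ₑ ^ 2) = s.indicator 1 := by
    funext x
    by_cases hx : x ∈ s <;> simp [hx]
  rw [this, lintegral_indicator_one hs]

variable {𝓗 : Type*} [NormedAddCommGroup 𝓗] [InnerProductSpace ℂ 𝓗] [CompleteSpace 𝓗]

/-- A `*`-representation `op` of an algebra of bounded measurable functions, together with the scalar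
measures that represent its quadratic forms; the algebra is dense in `L²` of every finite measure. -/
structure FunctionalCalculus (X 𝒜 𝓗 : Type*) [MeasurableSpace X] [Ring 𝒜] [StarRing 𝒜] [Algebra ℂ 𝒜]
    [NormedAddCommGroup 𝓗] [InnerProductSpace ℂ 𝓗] [CompleteSpace 𝓗] where
  ev : 𝒜 →⋆ₐ[ℂ] (X → ℂ)
  op : 𝒜 →⋆ₐ[ℂ] (𝓗 →L[ℂ] 𝓗)
  μ : 𝓗 → Measure X
  finite : ∀ ψ, IsFiniteMeasure (μ ψ)
  measurable_ev : ∀ a, Measurable (ev a)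
  bounded_ev : ∀ a, ∃ C : ℝ, ∀ x, ‖ev a x‖ ≤ C
  inner_op : ∀ a ψ, inner ℂ ψ (op a ψ) = ∫ x, ev a x ∂μ ψ
  dense : ∀ (ν : Measure X) [IsFiniteMeasure ν] (f : X → ℂ), MemLp f 2 ν →
    ∀ ε : ℝ≥0∞, ε ≠ 0 → ∃ a, eLpNorm (ev a - f) 2 ν ≤ ε

namespace FunctionalCalculus

variable {X 𝒜 : Type*} [MeasurableSpace X] [Ring 𝒜] [StarRing 𝒜] [Algebra ℂ 𝒜]
  (C : FunctionalCalculus X 𝒜 𝓗)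

instance (ψ : 𝓗) : IsFiniteMeasure (C.μ ψ) := C.finite ψ

theorem memLp_ev (a : 𝒜) (ν : Measure X) [IsFiniteMeasure ν] : MemLp (C.ev a) 2 ν := by
  obtain ⟨K, hK⟩ := C.bounded_ev a
  exact MemLp.of_bound (C.measurable_ev a).aestronglyMeasurable K (ae_of_all _ hK)

/-- Expand ‖op a ψ‖² as ⟨ψ, op (a* a) ψ⟩. This isometry lets a ↦ op a ψ extend from the dense
algebra to all of L²(μ_ψ); `HasVal` is the graph of the extension, so unbounded functions are
allowed. -/
theorem enorm_op (a : 𝒜) (ψ : 𝓗) : ‖C.op a ψ‖ₑ = eLpNorm (C.ev a) 2 (C.μ ψ) := by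
  have h1 : inner ℂ (C.op a ψ) (C.op a ψ) = ∫ x, ((‖C.ev a x‖ ^ 2 : ℝ) : ℂ) ∂C.μ ψ := by
    have h2 : inner ℂ (C.op a ψ) (C.op a ψ) = inner ℂ ψ (C.op (star a * a) ψ) := by
      rw [map_mul, map_star, ContinuousLinearMap.star_eq_adjoint, mul_apply_eq_comp,
        ContinuousLinearMap.adjoint_inner_right]
    rw [h2, C.inner_op]
    congr 1
    funext x
    simp only [map_mul, map_star, Pi.mul_apply, Pi.star_apply]
    rw [RCLike.star_def, RCLike.conj_mul]
    simp
  rw [integral_complex_ofReal, inner_self_eq_norm_sq_to_K] at h1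
  have h3 : ‖C.op a ψ‖ ^ 2 = ∫ x, ‖C.ev a x‖ ^ 2 ∂C.μ ψ := by
    apply Complex.ofReal_injective
    rw [← h1]
    simp
  have h4 : ‖C.op a ψ‖ₑ ^ 2 = eLpNorm (C.ev a) 2 (C.μ ψ) ^ 2 := by
    rw [← lintegral_enorm_sq, ← ofReal_norm, ← ENNReal.ofReal_pow (norm_nonneg _), h3,
      ofReal_integral_eq_lintegral_ofReal (C.memLp_ev a _).integrable_norm_pow'
        (ae_of_all _ fun x => by positivity)]
    refine lintegral_congr fun x => ?_
    rw [ENNReal.ofReal_pow (norm_nonneg _), ofReal_norm]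
  exact (ENNReal.pow_right_strictMono two_ne_zero).injective h4

/-- `C.HasVal f ψ χ` says that `ψ` lies in the domain of `f`, and that `f` takes `ψ` to `χ`. -/
structure HasVal (f : X → ℂ) (ψ χ : 𝓗) : Prop where
  memLp : MemLp f 2 (C.μ ψ)
  enorm_op_sub_le : ∀ a, ‖C.op a ψ - χ‖ₑ ≤ eLpNorm (C.ev a - f) 2 (C.μ ψ)

variable {C} {f g : X → ℂ} {ψ φ χ ω : 𝓗}

theorem hasVal_ev (a : 𝒜) (ψ : 𝓗) : C.HasVal (C.ev a) ψ (C.op a ψ) := by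
  refine ⟨C.memLp_ev a _, fun b => ?_⟩
  rw [← map_sub, ← C.enorm_op, map_sub, sub_apply]

theorem hasVal_one (ψ : 𝓗) : C.HasVal 1 ψ ψ := by
  simpa using C.hasVal_ev 1 ψ

theorem HasVal.exists_approx (h : C.HasVal f ψ χ) {ε : ℝ≥0∞} (hε : ε ≠ 0) :
    ∃ a, eLpNorm (C.ev a - f) 2 (C.μ ψ) ≤ ε ∧ ‖C.op a ψ - χ‖ₑ ≤ ε := by
  obtain ⟨a, ha⟩ := C.dense (C.μ ψ) f h.memLp ε hε
  exact ⟨a, ha, (h.enorm_op_sub_le a).trans ha⟩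

theorem HasVal.unique (h : C.HasVal f ψ χ) (h' : C.HasVal f ψ ω) : χ = ω := by
  rw [← sub_eq_zero, ← enorm_eq_zero]
  refine le_antisymm (le_of_forall_le_add_add fun ε hε => ?_) bot_le
  obtain ⟨a, ha, ha'⟩ := h.exists_approx hε
  have := (h'.enorm_op_sub_le a).trans ha
  rw [zero_add, ← sub_sub_sub_cancel_left ω χ (C.op a ψ)]
  exact enorm_sub_le.trans (add_le_add this ha')

theorem HasVal.congr (h : C.HasVal f ψ χ) (hfg : f =ᵐ[C.μ ψ] g) : C.HasVal g ψ χ := by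
  refine ⟨(memLp_congr_ae hfg).mp h.memLp, fun a => (h.enorm_op_sub_le a).trans_eq ?_⟩
  exact eLpNorm_congr_ae ((EventuallyEq.refl _ _).sub hfg)

/-- The graph of an isometry is closed, so limits of known values are values. -/
theorem HasVal.of_forall_exists (hf : MemLp f 2 (C.μ ψ))
    (h : ∀ ε : ℝ≥0∞, ε ≠ 0 → ∃ g ω, C.HasVal g ψ ω ∧ eLpNorm (g - f) 2 (C.μ ψ) ≤ ε ∧ ‖ω - χ‖ₑ ≤ ε) :
    C.HasVal f ψ χ := by
  refine ⟨hf, fun a => le_of_forall_le_add_add fun ε hε => ?_⟩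
  obtain ⟨g, ω, hg, h1, h2⟩ := h ε hε
  calc ‖C.op a ψ - χ‖ₑ = ‖(C.op a ψ - ω) + (ω - χ)‖ₑ := by rw [sub_add_sub_cancel]
    _ ≤ ‖C.op a ψ - ω‖ₑ + ‖ω - χ‖ₑ := enorm_add_le _ _
    _ ≤ eLpNorm (C.ev a - g) 2 (C.μ ψ) + ε := add_le_add (hg.enorm_op_sub_le a) h2
    _ = eLpNorm ((C.ev a - f) - (g - f)) 2 (C.μ ψ) + ε := by rw [sub_sub_sub_cancel_right]
    _ ≤ eLpNorm (C.ev a - f) 2 (C.μ ψ) + eLpNorm (g - f) 2 (C.μ ψ) + ε := by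
        gcongr
        exact eLpNorm_sub_le ((C.memLp_ev a _).sub hf).1 (hg.memLp.sub hf).1 one_le_two
    _ ≤ eLpNorm (C.ev a - f) 2 (C.μ ψ) + (ε + ε) := by
        rw [add_assoc]
        gcongr

theorem HasVal.of_approx (hf : MemLp f 2 (C.μ ψ))
    (h : ∀ ε : ℝ≥0∞, ε ≠ 0 → ∃ a, eLpNorm (C.ev a - f) 2 (C.μ ψ) ≤ ε ∧ ‖C.op a ψ - χ‖ₑ ≤ ε) :
    C.HasVal f ψ χ :=
  .of_forall_exists hf fun ε hε => by
    obtain ⟨a, h1, h2⟩ := h ε hε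
    exact ⟨_, _, C.hasVal_ev a ψ, h1, h2⟩

theorem exists_hasVal (hf : MemLp f 2 (C.μ ψ)) : ∃ χ, C.HasVal f ψ χ := by
  -- The extra factor 1/2 makes the errors at n and n + 1 add up to at most 1/2^n, the rate used for
  -- the Cauchy property.
  have h2 : ∀ n : ℕ, ((1 : ℝ≥0∞) / 2 / 2 ^ n) ≠ 0 := fun n => by simp [ENNReal.div_eq_inv_mul]
  choose a ha using fun n : ℕ => C.dense (C.μ ψ) f hf _ (h2 n)
  have hd : ∀ b c, edist (C.op b ψ) (C.op c ψ)
      ≤ eLpNorm (C.ev b - f) 2 (C.μ ψ) + eLpNorm (C.ev c - f) 2 (C.μ ψ) := fun b c => by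
    rw [edist_eq_enorm_sub, ← sub_apply, ← map_sub, C.enorm_op, map_sub,
      ← sub_sub_sub_cancel_right _ _ f]
    exact eLpNorm_sub_le ((C.memLp_ev _ _).sub hf).1 ((C.memLp_ev _ _).sub hf).1 one_le_two
  have hc : CauchySeq fun n => C.op (a n) ψ := by
    refine cauchySeq_of_edist_le_geometric_two 1 ENNReal.one_ne_top fun n => (hd _ _).trans ?_
    refine (add_le_add (ha n) (ha (n + 1))).trans ?_
    have : (1 : ℝ≥0∞) / 2 / 2 ^ (n + 1) ≤ 1 / 2 / 2 ^ n :=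
      ENNReal.div_le_div_left (pow_le_pow_right₀ one_le_two n.le_succ) _
    refine (add_le_add_right this _).trans_eq ?_
    rw [ENNReal.div_add_div_same, ENNReal.add_halves]
  obtain ⟨χ, hχ⟩ := cauchySeq_tendsto_of_complete hc
  refine ⟨χ, hf, fun b => ?_⟩
  have h0 : Tendsto (fun n : ℕ => (1 : ℝ≥0∞) / 2 / 2 ^ n) atTop (𝓝 0) := by
    have := ENNReal.Tendsto.const_mul (a := (1 : ℝ≥0∞) / 2)
      (ENNReal.tendsto_pow_atTop_nhds_zero_of_lt_one (r := 2⁻¹) (by simp)) (Or.inr (by simp))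
    simpa [ENNReal.div_eq_inv_mul, mul_comm, ENNReal.inv_pow] using this
  have h1 : Tendsto (fun n => eLpNorm (C.ev b - f) 2 (C.μ ψ) + (1 : ℝ≥0∞) / 2 / 2 ^ n) atTop
      (𝓝 (eLpNorm (C.ev b - f) 2 (C.μ ψ))) := by
    simpa using h0.const_add (eLpNorm (C.ev b - f) 2 (C.μ ψ))
  refine le_of_tendsto_of_tendsto' (hχ.const_sub (C.op b ψ)).enorm h1 fun n => ?_
  rw [← edist_eq_enorm_sub]
  exact (hd _ _).trans (add_le_add_right (ha n) _)

theorem HasVal.enorm_eq (h : C.HasVal f ψ χ) : ‖χ‖ₑ = eLpNorm f 2 (C.μ ψ) := by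
  apply le_antisymm
  · simpa [eLpNorm_neg] using h.enorm_op_sub_le 0
  · refine le_of_forall_le_add_add fun ε hε => ?_
    obtain ⟨a, h1, h2⟩ := h.exists_approx hε
    calc eLpNorm f 2 (C.μ ψ) = eLpNorm (C.ev a - (C.ev a - f)) 2 (C.μ ψ) := by rw [sub_sub_cancel]
      _ ≤ eLpNorm (C.ev a) 2 (C.μ ψ) + ε := (eLpNorm_sub_le (C.memLp_ev a _).1
          ((C.memLp_ev a _).sub h.memLp).1 one_le_two).trans (add_le_add_right h1 _)
      _ = ‖(C.op a ψ - χ) + χ‖ₑ + ε := by rw [← C.enorm_op, sub_add_cancel]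
      _ ≤ ‖C.op a ψ - χ‖ₑ + ‖χ‖ₑ + ε := by gcongr; exact enorm_add_le _ _
      _ ≤ ‖χ‖ₑ + (ε + ε) := by rw [add_comm _ ‖χ‖ₑ, add_assoc]; gcongr

theorem HasVal.add (h : C.HasVal f ψ χ) (h' : C.HasVal g ψ ω) : C.HasVal (f + g) ψ (χ + ω) := by
  refine .of_approx (h.memLp.add h'.memLp) fun ε hε => ?_
  have hε2 : ε / 2 ≠ 0 := by simpa using hε
  obtain ⟨a, h1, h2⟩ := h.exists_approx hε2
  obtain ⟨b, h3, h4⟩ := h'.exists_approx hε2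
  refine ⟨a + b, ?_, ?_⟩
  · rw [map_add, add_sub_add_comm]
    refine (eLpNorm_add_le ((C.memLp_ev _ _).sub h.memLp).1 ((C.memLp_ev _ _).sub h'.memLp).1
      one_le_two).trans ?_
    exact (add_le_add h1 h3).trans_eq (ENNReal.add_halves ε)
  · rw [map_add, add_apply, add_sub_add_comm]
    exact (enorm_add_le _ _).trans ((add_le_add h2 h4).trans_eq (ENNReal.add_halves ε))

theorem HasVal.const_smul (c : ℂ) (h : C.HasVal f ψ χ) : C.HasVal (c • f) ψ (c • χ) := by
  refine .of_approx (h.memLp.const_smul c) fun ε hε => ?_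
  obtain ⟨a, h1, h2⟩ := h.exists_approx (ε := ε / ‖c‖ₑ) (by simpa using hε)
  have hle : ‖c‖ₑ * (ε / ‖c‖ₑ) ≤ ε := ENNReal.mul_div_le
  refine ⟨c • a, ?_, ?_⟩
  · rw [map_smul, ← smul_sub, eLpNorm_const_smul]
    exact (mul_le_mul_right h1 _).trans hle
  · rw [map_smul, smul_apply, ← smul_sub, enorm_smul]
    exact (mul_le_mul_right h2 _).trans hle

theorem HasVal.sub (h : C.HasVal f ψ χ) (h' : C.HasVal g ψ ω) : C.HasVal (f - g) ψ (χ - ω) := by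
  simpa [sub_eq_add_neg] using h.add (h'.const_smul (-1))

theorem memLp_two_add_measure {ν ν' : Measure X} {h : X → ℂ} (h1 : MemLp h 2 ν) (h2 : MemLp h 2 ν') :
    MemLp h 2 (ν + ν') := by
  refine ⟨AEStronglyMeasurable.add_measure h1.1 h2.1, ?_⟩
  have : eLpNorm h 2 (ν + ν') ^ 2 < ⊤ := by
    rw [← lintegral_enorm_sq, lintegral_add_measure, lintegral_enorm_sq, lintegral_enorm_sq]
    exact ENNReal.add_lt_top.mpr ⟨ENNReal.pow_lt_top h1.2, ENNReal.pow_lt_top h2.2⟩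
  exact lt_of_not_ge fun hh => by simp [top_le_iff.mp hh] at this

/-- Three different spectral measures occur. Approximating f in L² of their sum gives one element of
the algebra that is good for all three vectors, and `op` is linear. -/
theorem HasVal.add_vec (h : C.HasVal f ψ χ) (h' : C.HasVal f φ ω)
    (hf : MemLp f 2 (C.μ (ψ + φ))) : C.HasVal f (ψ + φ) (χ + ω) := by
  refine .of_approx hf fun ε hε => ?_
  obtain ⟨a, ha⟩ := C.dense (C.μ (ψ + φ) + (C.μ ψ + C.μ φ)) f
    (memLp_two_add_measure hf (memLp_two_add_measure h.memLp h'.memLp)) (ε / 2) (by simpa using hε)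
  have key : ∀ ν : Measure X, ν ≤ C.μ (ψ + φ) + (C.μ ψ + C.μ φ) →
      eLpNorm (C.ev a - f) 2 ν ≤ ε / 2 := fun ν hν => (eLpNorm_mono_measure _ hν).trans ha
  refine ⟨a, (key _ (Measure.le_add_right le_rfl)).trans ENNReal.half_le_self, ?_⟩
  rw [map_add, add_sub_add_comm]
  refine (enorm_add_le _ _).trans ((add_le_add ?_ ?_).trans_eq (ENNReal.add_halves ε))
  · exact (h.enorm_op_sub_le a).trans (key _ (Measure.le_add_left (Measure.le_add_right le_rfl)))
  · exact (h'.enorm_op_sub_le a).trans (key _ (Measure.le_add_left (Measure.le_add_left le_rfl)))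

theorem HasVal.smul_vec (c : ℂ) (h : C.HasVal f ψ χ) (hf : MemLp f 2 (C.μ (c • ψ))) :
    C.HasVal f (c • ψ) (c • χ) := by
  refine .of_approx hf fun ε hε => ?_
  obtain ⟨a, ha⟩ := C.dense (C.μ (c • ψ) + C.μ ψ) f (memLp_two_add_measure hf h.memLp)
    (min ε (ε / ‖c‖ₑ)) (by simpa using hε)
  have key : ∀ ν : Measure X, ν ≤ C.μ (c • ψ) + C.μ ψ →
      eLpNorm (C.ev a - f) 2 ν ≤ min ε (ε / ‖c‖ₑ) := fun ν hν => (eLpNorm_mono_measure _ hν).trans ha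
  refine ⟨a, (key _ (Measure.le_add_right le_rfl)).trans (min_le_left _ _), ?_⟩
  rw [map_smul, ← smul_sub, enorm_smul]
  have := (h.enorm_op_sub_le a).trans (key _ (Measure.le_add_left le_rfl))
  exact (mul_le_mul_right (this.trans (min_le_right _ _)) _).trans ENNReal.mul_div_le

theorem HasVal.inner_eq_integral (h : C.HasVal f ψ χ) : inner ℂ ψ χ = ∫ x, f x ∂C.μ ψ := by
  have hK : ‖ψ‖ₑ + C.μ ψ Set.univ ^ (1 / 2 : ℝ) ≠ ⊤ :=
    ENNReal.add_ne_top.mpr ⟨enorm_ne_top,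
      ENNReal.rpow_ne_top_of_nonneg (by norm_num) (measure_ne_top _ _)⟩
  set K := ‖ψ‖ₑ + C.μ ψ Set.univ ^ (1 / 2 : ℝ) with hKdef
  rw [← sub_eq_zero, ← enorm_eq_zero]
  refine le_antisymm (ENNReal.le_of_forall_pos_le_add fun ε hε _ => ?_) bot_le
  obtain ⟨a, h1, h2⟩ := h.exists_approx (ε := ε / K)
    (by simp [ENNReal.div_eq_zero_iff, hε.ne', hK])
  have hfi : Integrable f (C.μ ψ) := h.memLp.integrable one_le_two
  have hai : Integrable (C.ev a) (C.μ ψ) := (C.memLp_ev a _).integrable one_le_two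
  have e1 : inner ℂ ψ χ - ∫ x, f x ∂C.μ ψ
      = (∫ x, (C.ev a - f) x ∂C.μ ψ) - inner ℂ ψ (C.op a ψ - χ) := by
    simp only [Pi.sub_apply]
    rw [integral_sub hai hfi, inner_sub_right, C.inner_op]
    ring
  rw [e1, zero_add]
  refine enorm_sub_le.trans ?_
  have b1 : ‖∫ x, (C.ev a - f) x ∂C.μ ψ‖ₑ ≤ ε / K * C.μ ψ Set.univ ^ (1 / 2 : ℝ) := by
    refine (enorm_integral_le_lintegral_enorm _).trans ?_
    rw [← eLpNorm_one_eq_lintegral_enorm]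
    refine (eLpNorm_le_eLpNorm_mul_rpow_measure_univ one_le_two (hai.1.sub hfi.1)).trans ?_
    have : (1 / (1 : ℝ≥0∞).toReal - 1 / (2 : ℝ≥0∞).toReal) = 1 / 2 := by norm_num
    rw [this]
    gcongr
  have b2 : ‖inner ℂ ψ (C.op a ψ - χ)‖ₑ ≤ ε / K * ‖ψ‖ₑ := by
    rw [mul_comm]
    refine le_trans ?_ (mul_le_mul_right h2 _)
    rw [← ofReal_norm, ← ofReal_norm, ← ofReal_norm,
      ← ENNReal.ofReal_mul (norm_nonneg _)]
    exact ENNReal.ofReal_le_ofReal (norm_inner_le_norm _ _)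
  refine (add_le_add b1 b2).trans ?_
  rw [← mul_add, add_comm, ← hKdef, mul_comm]
  exact ENNReal.mul_div_le

theorem HasVal.inner_adjoint (hψ : C.HasVal (star f) φ χ) (hφ : C.HasVal f ψ ω) :
    inner ℂ χ ψ = inner ℂ φ ω := by
  rw [← sub_eq_zero, ← enorm_eq_zero]
  have hK : ‖ψ‖ₑ + ‖φ‖ₑ ≠ ⊤ := ENNReal.add_ne_top.mpr ⟨enorm_ne_top, enorm_ne_top⟩
  refine le_antisymm (ENNReal.le_of_forall_pos_le_add fun ε hε _ => ?_) bot_le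
  have hf : MemLp f 2 (C.μ φ) := by simpa using hψ.memLp.star
  obtain ⟨a, ha⟩ := C.dense (C.μ φ + C.μ ψ) f (memLp_two_add_measure hf hφ.memLp)
    (ε / (‖ψ‖ₑ + ‖φ‖ₑ)) (by simp [ENNReal.div_eq_zero_iff, hε.ne', hK])
  have h1 : ‖C.op (star a) φ - χ‖ₑ ≤ ε / (‖ψ‖ₑ + ‖φ‖ₑ) := by
    refine (hψ.enorm_op_sub_le _).trans ?_
    have : eLpNorm (C.ev (star a) - star f) 2 (C.μ φ) = eLpNorm (C.ev a - f) 2 (C.μ φ) := by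
      refine eLpNorm_congr_norm_ae (ae_of_all _ fun x => ?_)
      rw [map_star, ← star_sub, Pi.star_apply, norm_star]
    rw [this]
    exact (eLpNorm_mono_measure _ (Measure.le_add_right le_rfl)).trans ha
  have h2 : ‖C.op a ψ - ω‖ₑ ≤ ε / (‖ψ‖ₑ + ‖φ‖ₑ) :=
    (hφ.enorm_op_sub_le _).trans ((eLpNorm_mono_measure _ (Measure.le_add_left le_rfl)).trans ha)
  have e1 : inner ℂ χ ψ - inner ℂ φ ω
      = inner ℂ φ (C.op a ψ - ω) - inner ℂ (C.op (star a) φ - χ) ψ := by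
    rw [inner_sub_left, inner_sub_right, map_star, ContinuousLinearMap.star_eq_adjoint,
      ContinuousLinearMap.adjoint_inner_left]
    ring
  have hcs : ∀ u v : 𝓗, ‖inner ℂ u v‖ₑ ≤ ‖u‖ₑ * ‖v‖ₑ := fun u v => by
    rw [← ofReal_norm, ← ofReal_norm, ← ofReal_norm,
      ← ENNReal.ofReal_mul (norm_nonneg _)]
    exact ENNReal.ofReal_le_ofReal (norm_inner_le_norm _ _)
  rw [e1, zero_add]
  refine enorm_sub_le.trans ((add_le_add (hcs _ _) (hcs _ _)).trans ?_)
  calc _ ≤ ‖φ‖ₑ * (ε / (‖ψ‖ₑ + ‖φ‖ₑ)) + ε / (‖ψ‖ₑ + ‖φ‖ₑ) * ‖ψ‖ₑ := by gcongr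
    _ = (‖ψ‖ₑ + ‖φ‖ₑ) * (ε / (‖ψ‖ₑ + ‖φ‖ₑ)) := by ring
    _ ≤ ε := ENNReal.mul_div_le

theorem HasVal.ev_mul (h : C.HasVal g ψ χ) (a : 𝒜) : C.HasVal (C.ev a * g) ψ (C.op a χ) := by
  obtain ⟨K, hK⟩ := C.bounded_ev a
  have hbd : ∀ u : X → ℂ, eLpNorm (C.ev a * u) 2 (C.μ ψ) ≤ ‖K‖ₑ * eLpNorm u 2 (C.μ ψ) := fun u => by
    rw [← eLpNorm_const_smul]
    refine eLpNorm_mono fun x => ?_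
    simp only [Pi.mul_apply, Pi.smul_apply, norm_mul, norm_smul]
    gcongr
    exact (hK x).trans (le_abs_self K)
  have hmem : MemLp (C.ev a * g) 2 (C.μ ψ) :=
    ⟨(C.measurable_ev a).aestronglyMeasurable.mul h.memLp.1,
      (hbd g).trans_lt (ENNReal.mul_lt_top enorm_lt_top h.memLp.2)⟩
  refine .of_approx hmem fun ε hε => ?_
  have hL : ‖K‖ₑ + ‖C.op a‖ₑ ≠ ⊤ := ENNReal.add_ne_top.mpr ⟨enorm_ne_top, enorm_ne_top⟩
  obtain ⟨b, h1, h2⟩ := h.exists_approx (ε := ε / (‖K‖ₑ + ‖C.op a‖ₑ)) (by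
    simp only [ne_eq, ENNReal.div_eq_zero_iff, hL, hε, or_self, not_false_eq_true])
  refine ⟨a * b, ?_, ?_⟩
  · rw [map_mul, ← mul_sub]
    refine (hbd _).trans ((mul_le_mul' le_self_add h1).trans ENNReal.mul_div_le)
  · rw [map_mul, mul_apply_eq_comp, ← map_sub]
    refine ((C.op a).le_opENorm _).trans ?_
    exact (mul_le_mul' le_add_self h2).trans ENNReal.mul_div_le

/-- Both measures give every element a of the algebra the same L² norm, because op a χ is the value
of a·g at ψ. Density of the algebra in L² of the sum of the two measures carries this equality to
indicators, hence to the measures. -/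
theorem HasVal.measure_eq (h : C.HasVal g ψ χ) :
    C.μ χ = (C.μ ψ).withDensity fun x => ‖g x‖ₑ ^ 2 := by
  set ν := (C.μ ψ).withDensity fun x => ‖g x‖ₑ ^ 2 with hν
  have hfin : IsFiniteMeasure ν := by
    refine isFiniteMeasure_withDensity ?_
    rw [lintegral_enorm_sq]
    exact (ENNReal.pow_lt_top h.memLp.2).ne
  have ha : ∀ a, eLpNorm (C.ev a) 2 (C.μ χ) = eLpNorm (C.ev a) 2 ν := fun a => by
    rw [hν, eLpNorm_two_withDensity (C.measurable_ev a) h.memLp.1.aemeasurable,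
      ← (h.ev_mul a).enorm_eq, C.enorm_op]
  have key : ∀ ν₁ ν₂ : Measure X, IsFiniteMeasure ν₁ → IsFiniteMeasure ν₂ →
      (∀ a, eLpNorm (C.ev a) 2 ν₁ = eLpNorm (C.ev a) 2 ν₂) → ∀ f : X → ℂ, MemLp f 2 (ν₁ + ν₂) →
      eLpNorm f 2 ν₁ ≤ eLpNorm f 2 ν₂ := by
    intro ν₁ ν₂ _ _ h12 f hf
    refine le_of_forall_le_add_add fun ε hε => ?_
    obtain ⟨a, ha⟩ := C.dense (ν₁ + ν₂) f hf ε hε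
    have m1 := hf.mono_measure (Measure.le_add_right (le_refl ν₁) : ν₁ ≤ ν₁ + ν₂)
    have m2 := hf.mono_measure (Measure.le_add_left (le_refl ν₂) : ν₂ ≤ ν₁ + ν₂)
    have a1 := (eLpNorm_mono_measure (C.ev a - f)
      (Measure.le_add_right (le_refl ν₁) : ν₁ ≤ ν₁ + ν₂)).trans ha
    have a2 := (eLpNorm_mono_measure (C.ev a - f)
      (Measure.le_add_left (le_refl ν₂) : ν₂ ≤ ν₁ + ν₂)).trans ha
    calc eLpNorm f 2 ν₁ = eLpNorm (C.ev a - (C.ev a - f)) 2 ν₁ := by rw [sub_sub_cancel]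
      _ ≤ eLpNorm (C.ev a) 2 ν₁ + ε := (eLpNorm_sub_le (C.memLp_ev a _).1
          ((C.memLp_ev a _).sub m1).1 one_le_two).trans (add_le_add_right a1 _)
      _ = eLpNorm (C.ev a - f + f) 2 ν₂ + ε := by rw [h12, sub_add_cancel]
      _ ≤ eLpNorm (C.ev a - f) 2 ν₂ + eLpNorm f 2 ν₂ + ε := by
          gcongr
          exact eLpNorm_add_le ((C.memLp_ev a _).sub m2).1 m2.1 one_le_two
      _ ≤ eLpNorm f 2 ν₂ + (ε + ε) := by rw [add_comm _ (eLpNorm f 2 ν₂), add_assoc]; gcongr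
  ext s hs
  have hm : ∀ ν' : Measure X, IsFiniteMeasure ν' → MemLp (s.indicator (1 : X → ℂ)) 2 ν' :=
    fun ν' _ => memLp_indicator_const 2 hs (1 : ℂ) (Or.inr (measure_ne_top _ _))
  rw [measure_eq_eLpNorm_indicator_sq _ hs, measure_eq_eLpNorm_indicator_sq _ hs]
  congr 1
  exact le_antisymm (key _ _ inferInstance hfin ha _ (hm _ inferInstance))
    (key _ _ hfin inferInstance (fun a => (ha a).symm) _ (hm _ inferInstance))

theorem HasVal.eLpNorm_eq (h : C.HasVal g ψ χ) (hf : Measurable f) :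
    eLpNorm f 2 (C.μ χ) = eLpNorm (f * g) 2 (C.μ ψ) := by
  rw [h.measure_eq, eLpNorm_two_withDensity hf h.memLp.1.aemeasurable]

theorem HasVal.memLp_iff (h : C.HasVal g ψ χ) (hf : Measurable f) :
    MemLp f 2 (C.μ χ) ↔ MemLp (f * g) 2 (C.μ ψ) := by
  refine ⟨fun hm => ⟨hf.aestronglyMeasurable.mul h.memLp.1, ?_⟩,
    fun hm => ⟨hf.aestronglyMeasurable, ?_⟩⟩
  · rw [← h.eLpNorm_eq hf]; exact hm.2
  · rw [h.eLpNorm_eq hf]; exact hm.2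

/-- By `measure_eq` the L²(μ_χ) norm of f is the L²(μ_ψ) norm of f·g, so approximating f at χ
approximates f·g at ψ. -/
theorem HasVal.comp (hg : C.HasVal g ψ χ) (hf : C.HasVal f χ ω) (hfm : Measurable f) :
    C.HasVal (f * g) ψ ω := by
  refine .of_forall_exists ((hg.memLp_iff hfm).mp hf.memLp) fun ε hε => ?_
  obtain ⟨a, h1, h2⟩ := hf.exists_approx hε
  refine ⟨_, _, hg.ev_mul a, ?_, h2⟩
  rw [← sub_mul, ← hg.eLpNorm_eq ((C.measurable_ev a).sub hfm)]
  exact h1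

/-- Cancellation of an inner factor. This is how inverses such as resolvents, and commutation
relations, are identified. -/
theorem HasVal.of_mul (hg : C.HasVal g ψ χ) (hfg : C.HasVal (f * g) ψ ω) (hfm : Measurable f) :
    C.HasVal f χ ω := by
  obtain ⟨ω', h⟩ := C.exists_hasVal ((hg.memLp_iff hfm).mpr hfg.memLp)
  rwa [hfg.unique (hg.comp h hfm)]

variable (C) in
theorem measure_univ_eq (ψ : 𝓗) : C.μ ψ Set.univ = ‖ψ‖ₑ ^ 2 := by
  rw [measure_eq_eLpNorm_indicator_sq _ MeasurableSet.univ, Set.indicator_univ,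
    (hasVal_one (C := C) ψ).enorm_eq]

theorem HasVal.norm_le {K : ℝ} (hK : ∀ᵐ x ∂C.μ ψ, ‖f x‖ ≤ K) (hK0 : 0 ≤ K) (h : C.HasVal f ψ χ) :
    ‖χ‖ ≤ K * ‖ψ‖ := by
  have h1 : eLpNorm f 2 (C.μ ψ) ≤ ENNReal.ofReal K * eLpNorm (1 : X → ℂ) 2 (C.μ ψ) := by
    refine eLpNorm_le_mul_eLpNorm_of_ae_le_mul ?_ 2
    filter_upwards [hK] with x hx
    simpa using hx
  rw [← h.enorm_eq, ← (hasVal_one ψ).enorm_eq, ← ofReal_norm, ← ofReal_norm,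
    ← ENNReal.ofReal_mul hK0] at h1
  exact (ENNReal.ofReal_le_ofReal_iff (by positivity)).mp h1

variable (C) in
theorem exists_clm (hf : Measurable f) {K : ℝ} (hK : ∀ x, ‖f x‖ ≤ K) :
    ∃ S : 𝓗 →L[ℂ] 𝓗, ∀ ψ, C.HasVal f ψ (S ψ) := by
  have hm : ∀ ψ, MemLp f 2 (C.μ ψ) := fun ψ =>
    MemLp.of_bound hf.aestronglyMeasurable K (ae_of_all _ hK)
  choose S hS using fun ψ => C.exists_hasVal (hm ψ)
  refine ⟨LinearMap.mkContinuous
    { toFun := S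
      map_add' := fun ψ φ => (hS _).unique ((hS ψ).add_vec (hS φ) (hm _))
      map_smul' := fun c ψ => (hS _).unique ((hS ψ).smul_vec c (hm _)) } (max K 0) fun ψ => ?_, hS⟩
  exact (hS ψ).norm_le (ae_of_all _ fun x => (hK x).trans (le_max_left _ _)) (le_max_right _ _)

end FunctionalCalculus

end SpectralCalc

/-! ### Integration against a projection-valued measure -/

open MeasureTheory Filter Topology
open scoped ENNReal

namespace SpectralCalc

variable {𝓗 : Type*} [NormedAddCommGroup 𝓗] [InnerProductSpace ℂ 𝓗] [CompleteSpace 𝓗]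

namespace PVM

variable (E : PVM 𝓗)

theorem scalar_apply (ψ : 𝓗) {A : Set ℝ} (hA : MeasurableSet A) :
    E.scalar ψ A = ENNReal.ofReal (‖E.proj A ψ‖ ^ 2) :=
  Measure.ofMeasurable_apply A hA

theorem scalar_univ (ψ : 𝓗) : E.scalar ψ Set.univ = ENNReal.ofReal (‖ψ‖ ^ 2) := by
  rw [E.scalar_apply ψ MeasurableSet.univ, E.univ]
  simp

instance (ψ : 𝓗) : IsFiniteMeasure (E.scalar ψ) :=
  ⟨by rw [E.scalar_univ]; exact ENNReal.ofReal_lt_top⟩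

theorem proj_union {A B : Set ℝ} (hA : MeasurableSet A) (hB : MeasurableSet B) (h : Disjoint A B) :
    E.proj (A ∪ B) = E.proj A + E.proj B := by
  ext ψ
  have h1 := E.iUnion (fun n => if n = 0 then A else if n = 1 then B else ∅)
    (fun n => by split_ifs <;> simp [hA, hB])
    (fun m n hmn => by
      dsimp only [Function.onFun]
      split_ifs <;> first | (exfalso; omega) | exact h | exact h.symm | simp) ψ
  have h2 : (⋃ n : ℕ, (if n = 0 then A else if n = 1 then B else ∅)) = A ∪ B := by
    ext x
    simp only [Set.mem_iUnion, Set.mem_union]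
    constructor
    · rintro ⟨n, hn⟩
      split_ifs at hn
      · exact Or.inl hn
      · exact Or.inr hn
      · exact hn.elim
    · rintro (hx | hx)
      · exact ⟨0, by simpa using hx⟩
      · exact ⟨1, by simpa using hx⟩
  rw [h2] at h1
  have h3 := hasSum_sum_of_ne_finset_zero (L := SummationFilter.unconditional ℕ)
    (f := fun n : ℕ => E.proj (if n = 0 then A else if n = 1 then B else ∅) ψ)
    (s := {0, 1}) (fun n hn => by
      have : n ≠ 0 ∧ n ≠ 1 := by simpa using hn
      simp [this, E.proj_empty])
  rw [h1.unique h3]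
  simp

theorem proj_biUnion {ι : Type*} (s : Finset ι) (A : ι → Set ℝ) (hA : ∀ i, MeasurableSet (A i))
    (h : Pairwise (Function.onFun Disjoint A)) : E.proj (⋃ i ∈ s, A i) = ∑ i ∈ s, E.proj (A i) := by
  classical
  induction s using Finset.induction_on with
  | empty => ext ψ; simp [E.proj_empty]
  | insert a s ha ih =>
    rw [Finset.set_biUnion_insert, Finset.sum_insert ha, ← ih]
    refine E.proj_union (hA a) (Finset.measurableSet_biUnion _ fun i _ => hA i) ?_
    rw [Set.disjoint_iUnion₂_right]
    exact fun i hi => h (fun hai => ha (hai ▸ hi))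

/-- The integral of a simple function against a projection-valued measure. -/
noncomputable def simpleIntegral (f : SimpleFunc ℝ ℂ) : 𝓗 →L[ℂ] 𝓗 :=
  ∑ c ∈ f.range, c • E.proj (f ⁻¹' {c})

/-- The sum may be taken over any finer partition. Two simple functions can therefore be compared on
their common refinement `SimpleFunc.pair`, which gives additivity and multiplicativity. -/
theorem simpleIntegral_map {β : Type*} (h : SimpleFunc ℝ β) (g : β → ℂ) :
    E.simpleIntegral (h.map g) = ∑ y ∈ h.range, g y • E.proj (h ⁻¹' {y}) := by
  classical
  rw [simpleIntegral, ← Finset.sum_fiberwise_of_maps_to (s := h.range) (t := (h.map g).range) (g := g)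
    (fun y hy => by rw [SimpleFunc.range_map]; exact Finset.mem_image_of_mem _ hy)]
  refine Finset.sum_congr rfl fun c _ => ?_
  have h1 : (h.map g) ⁻¹' {c} = ⋃ y ∈ h.range.filter (fun y => g y = c), h ⁻¹' {y} := by
    ext x
    simp
  rw [h1, E.proj_biUnion _ _ (fun y => h.measurableSet_fiber y)
    (fun y y' hy => Disjoint.preimage _ (Set.disjoint_singleton.mpr hy)), Finset.smul_sum]
  refine Finset.sum_congr rfl fun y hy => ?_
  rw [(Finset.mem_filter.mp hy).2]

theorem proj_comp_of_disjoint {A B : Set ℝ} (hA : MeasurableSet A) (hB : MeasurableSet B)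
    (h : Disjoint A B) : E.proj A ∘L E.proj B = 0 := by
  rw [← E.inter A B hA hB, h.inter_eq]
  ext ψ
  exact E.proj_empty ψ

theorem simpleIntegral_add (f g : SimpleFunc ℝ ℂ) :
    E.simpleIntegral (f + g) = E.simpleIntegral f + E.simpleIntegral g := by
  have h1 : f = (SimpleFunc.pair f g).map Prod.fst := by ext; simp
  have h2 : g = (SimpleFunc.pair f g).map Prod.snd := by ext; simp
  have h3 : f + g = (SimpleFunc.pair f g).map (fun p => p.1 + p.2) := by ext; simp
  have e1 : E.simpleIntegral f = _ := (congrArg E.simpleIntegral h1).trans (E.simpleIntegral_map _ _)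
  have e2 : E.simpleIntegral g = _ := (congrArg E.simpleIntegral h2).trans (E.simpleIntegral_map _ _)
  rw [e1, e2, h3, simpleIntegral_map, ← Finset.sum_add_distrib]
  simp [add_smul]

theorem simpleIntegral_mul (f g : SimpleFunc ℝ ℂ) :
    E.simpleIntegral (f * g) = E.simpleIntegral f * E.simpleIntegral g := by
  have h1 : f = (SimpleFunc.pair f g).map Prod.fst := by ext; simp
  have h2 : g = (SimpleFunc.pair f g).map Prod.snd := by ext; simp
  have h3 : f * g = (SimpleFunc.pair f g).map (fun p => p.1 * p.2) := by ext; simp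
  have e1 : E.simpleIntegral f = _ := (congrArg E.simpleIntegral h1).trans (E.simpleIntegral_map _ _)
  have e2 : E.simpleIntegral g = _ := (congrArg E.simpleIntegral h2).trans (E.simpleIntegral_map _ _)
  rw [e1, e2, h3, simpleIntegral_map, Finset.sum_mul]
  refine Finset.sum_congr rfl fun y hy => ?_
  rw [Finset.mul_sum, Finset.sum_eq_single_of_mem y hy]
  · rw [smul_mul_smul_comm, ContinuousLinearMap.mul_def, ← E.inter _ _ (SimpleFunc.measurableSet_fiber _ _)
      (SimpleFunc.measurableSet_fiber _ _), Set.inter_self]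
  · intro y' _ hyy'
    rw [smul_mul_smul_comm, ContinuousLinearMap.mul_def, E.proj_comp_of_disjoint
      (SimpleFunc.measurableSet_fiber _ _) (SimpleFunc.measurableSet_fiber _ _)
      (Disjoint.preimage _ (Set.disjoint_singleton.mpr hyy'.symm)), smul_zero]

theorem simpleIntegral_const (c : ℂ) :
    E.simpleIntegral (SimpleFunc.const ℝ c) = c • ContinuousLinearMap.id ℂ 𝓗 := by
  rw [simpleIntegral, SimpleFunc.range_const, Finset.sum_singleton]
  rw [SimpleFunc.coe_const, ← E.univ]
  exact congrArg (fun A => c • E.proj A) (Set.preimage_const_of_mem rfl)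

theorem simpleIntegral_star (f : SimpleFunc ℝ ℂ) :
    E.simpleIntegral (star f) = star (E.simpleIntegral f) := by
  have h : star f = f.map star := by ext; simp
  rw [h, simpleIntegral_map, simpleIntegral, star_sum]
  refine Finset.sum_congr rfl fun c _ => ?_
  rw [star_smul, (E.selfAdjoint _ (f.measurableSet_fiber c)).star_eq]

/-- Integration of simple functions against a projection-valued measure as a functional calculus. -/
noncomputable def calculus : FunctionalCalculus ℝ (SimpleFunc ℝ ℂ) 𝓗 where
  ev :=
    { toFun := fun f => ⇑f
      map_one' := rfl
      map_mul' := fun _ _ => rfl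
      map_zero' := rfl
      map_add' := fun _ _ => rfl
      commutes' := fun _ => rfl
      map_star' := fun _ => rfl }
  op :=
    { toFun := E.simpleIntegral
      map_one' := (E.simpleIntegral_const 1).trans (one_smul _ _)
      map_mul' := E.simpleIntegral_mul
      map_zero' := (E.simpleIntegral_const 0).trans (zero_smul _ _)
      map_add' := E.simpleIntegral_add
      commutes' := fun c => E.simpleIntegral_const c
      map_star' := E.simpleIntegral_star }
  μ := E.scalar
  finite := inferInstance
  measurable_ev := fun f => f.measurable
  bounded_ev := fun f => f.exists_forall_norm_le
  inner_op := fun f ψ => by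
    change inner ℂ ψ (E.simpleIntegral f ψ) = ∫ x, f x ∂E.scalar ψ
    rw [SimpleFunc.integral_eq_sum _ (SimpleFunc.integrable_of_isFiniteMeasure f), simpleIntegral,
      sum_apply, inner_sum]
    refine Finset.sum_congr rfl fun c _ => ?_
    rw [smul_apply, inner_smul_right, E.inner_proj ψ (f.measurableSet_fiber c),
      Measure.real, E.scalar_apply ψ (f.measurableSet_fiber c), ENNReal.toReal_ofReal (by positivity),
      Complex.real_smul, mul_comm]
  dense := fun ν _ f hf ε hε => by
    obtain ⟨g, hg, -⟩ := hf.exists_simpleFunc_eLpNorm_sub_lt (by simp) hε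
    exact ⟨g, by rw [eLpNorm_sub_comm]; exact hg.le⟩

/-- `PVM.integral` is known only through its quadratic form. Polarization identifies it with the
operator given by the L² closure of the calculus. -/
theorem hasVal_integral {b : ℝ → ℂ} (hb : Measurable b) {K : ℝ} (hK : ∀ x, ‖b x‖ ≤ K) (ψ : 𝓗) :
    E.calculus.HasVal b ψ (E.integral b ψ) := by
  obtain ⟨S, hS⟩ := E.calculus.exists_clm hb hK
  have hex : ∃ S : 𝓗 →L[ℂ] 𝓗, ∀ ψ : 𝓗, inner ℂ ψ (S ψ) = ∫ x, b x ∂(E.scalar ψ) :=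
    ⟨S, fun ψ => (hS ψ).inner_eq_integral⟩
  have h1 : E.integral b = hex.choose := dif_pos hex
  have h2 : ((E.integral b : 𝓗 →L[ℂ] 𝓗) : 𝓗 →ₗ[ℂ] 𝓗) = S := by
    rw [h1]
    refine (ext_inner_map _ _).mp fun ψ => ?_
    rw [← inner_conj_symm, ← inner_conj_symm _ ψ]
    exact congrArg _ ((hex.choose_spec ψ).trans (hS ψ).inner_eq_integral.symm)
  have h3 : E.integral b = S := ContinuousLinearMap.coe_injective h2
  rw [h3]
  exact hS ψ

end PVM

end SpectralCalc

/-! ### Resolvents of a self-adjoint operator -/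

open MeasureTheory Filter Topology
open scoped ENNReal

namespace SpectralCalc

variable {𝓗 : Type*} [NormedAddCommGroup 𝓗] [InnerProductSpace ℂ 𝓗] [CompleteSpace 𝓗]

section SelfAdjoint

variable {H : 𝓗 →ₗ.[ℂ] 𝓗}

theorem inner_symm_of_isSelfAdjoint (hH : IsSelfAdjoint H) (x y : H.domain) :
    inner ℂ (H x) (y : 𝓗) = inner ℂ (x : 𝓗) (H y) := by
  have h : H.adjoint = H := hH
  have h2 := LinearPMap.adjoint_isFormalAdjoint (T := H) hH.dense_domain
  rw [h] at h2
  exact h2 x y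

/-- ⟨u, Hu⟩ is real, so ⟨u, (H - z)u⟩ has imaginary part -Im z ‖u‖²; apply Cauchy–Schwarz. -/
theorem abs_im_mul_norm_le (hH : IsSelfAdjoint H) (z : ℂ) (u : H.domain) :
    |z.im| * ‖(u : 𝓗)‖ ≤ ‖H u - z • (u : 𝓗)‖ := by
  have h1 : (inner ℂ (u : 𝓗) (H u)).im = 0 := by
    rw [← Complex.conj_eq_iff_im, inner_conj_symm]
    exact inner_symm_of_isSelfAdjoint hH u u
  have h2 : (inner ℂ (u : 𝓗) (H u - z • (u : 𝓗))).im = - z.im * ‖(u : 𝓗)‖ ^ 2 := by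
    rw [inner_sub_right, inner_smul_right, inner_self_eq_norm_sq_to_K, Complex.sub_im, h1]
    simp only [Complex.coe_algebraMap, zero_sub, neg_mul]
    rw [← Complex.ofReal_pow, Complex.im_mul_ofReal]
  have h3 : |z.im| * ‖(u : 𝓗)‖ ^ 2 ≤ ‖(u : 𝓗)‖ * ‖H u - z • (u : 𝓗)‖ := by
    calc |z.im| * ‖(u : 𝓗)‖ ^ 2 = |(inner ℂ (u : 𝓗) (H u - z • (u : 𝓗))).im| := by
          rw [h2, abs_mul, abs_neg, abs_of_nonneg (sq_nonneg ‖(u : 𝓗)‖)]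
      _ ≤ ‖inner ℂ (u : 𝓗) (H u - z • (u : 𝓗))‖ := Complex.abs_im_le_norm _
      _ ≤ _ := norm_inner_le_norm _ _
  rcases (norm_nonneg (u : 𝓗)).eq_or_lt with h0 | h0
  · rw [← h0]; simp
  · refine le_of_mul_le_mul_left ?_ h0
    linarith [h3]

theorem mem_domain_of_inner (hH : IsSelfAdjoint H) {w v : 𝓗}
    (h : ∀ u : H.domain, inner ℂ v (u : 𝓗) = inner ℂ w (H u)) :
    ∃ hw : w ∈ H.domain, H ⟨w, hw⟩ = v := by
  have hadj : H.adjoint = H := hH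
  have hw : w ∈ H.adjoint.domain := LinearPMap.mem_adjoint_domain_of_exists w ⟨v, h⟩
  have h1 : H.adjoint ⟨w, hw⟩ = v := LinearPMap.adjoint_apply_eq hH.dense_domain ⟨w, hw⟩ h
  have key : ∀ T : 𝓗 →ₗ.[ℂ] 𝓗, T = H → ∀ hw : w ∈ T.domain, T ⟨w, hw⟩ = v →
      ∃ hw : w ∈ H.domain, H ⟨w, hw⟩ = v := by
    rintro T rfl hw h
    exact ⟨hw, h⟩
  exact key _ hadj hw h1

/-- The lower bound and closedness of H make the range of H - z closed. A vector w orthogonal to it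
satisfies Hw = z̄ w, so w = 0 by the lower bound at z̄. -/
theorem surjective_sub_smul (hH : IsSelfAdjoint H) {z : ℂ} (hz : z.im ≠ 0) (y : 𝓗) :
    ∃ u : H.domain, H u - z • (u : 𝓗) = y := by
  set L : H.domain →ₗ[ℂ] 𝓗 := H.toFun - z • H.domain.subtype with hL
  have hLu : ∀ u, L u = H u - z • (u : 𝓗) := fun u => rfl
  have hz' : 0 < |z.im| := abs_pos.mpr hz
  have hclosed : IsClosed (LinearMap.range L : Set 𝓗) := by
    refine IsSeqClosed.isClosed fun v y hv hy => ?_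
    choose u hu using hv
    have hc : CauchySeq fun n => (u n : 𝓗) := by
      have hvc := hy.cauchySeq
      rw [Metric.cauchySeq_iff'] at hvc ⊢
      intro ε hε
      obtain ⟨N, hN⟩ := hvc (|z.im| * ε) (by positivity)
      refine ⟨N, fun n hn => ?_⟩
      have h1 := abs_im_mul_norm_le hH z (u n - u N)
      rw [← hLu, map_sub, hu, hu, ← dist_eq_norm] at h1
      rw [dist_eq_norm]
      exact lt_of_mul_lt_mul_left (h1.trans_lt (hN n hn)) hz'.le
    obtain ⟨w, hw⟩ := cauchySeq_tendsto_of_complete hc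
    have hHu : Tendsto (fun n => H (u n)) atTop (𝓝 (y + z • w)) := by
      have : (fun n => H (u n)) = fun n => v n + z • (u n : 𝓗) := by
        funext n
        rw [← hu n, hLu, sub_add_cancel]
      rw [this]
      exact hy.add (hw.const_smul z)
    have hmem : (w, y + z • w) ∈ H.graph :=
      (hH.isClosed : IsClosed (H.graph : Set (𝓗 × 𝓗))).mem_of_tendsto (hw.prodMk_nhds hHu)
        (Eventually.of_forall fun n => (LinearPMap.mem_graph_iff H).mpr ⟨u n, rfl, rfl⟩)
    obtain ⟨w', h1, h2⟩ := (LinearPMap.mem_graph_iff H).mp hmem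
    refine ⟨w', ?_⟩
    dsimp only at h1 h2
    rw [hLu, h1, h2, add_sub_cancel_right]
  have horth : (LinearMap.range L)ᗮ = ⊥ := by
    rw [Submodule.eq_bot_iff]
    intro w hw
    have h1 : ∀ u : H.domain, inner ℂ (starRingEnd ℂ z • w) (u : 𝓗) = inner ℂ w (H u) := by
      intro u
      have := (Submodule.mem_orthogonal' _ _).mp hw (L u) ⟨u, rfl⟩
      rw [hLu, inner_sub_right, inner_smul_right, sub_eq_zero] at this
      rw [this, inner_smul_left, Complex.conj_conj]
    obtain ⟨hwD, h2⟩ := mem_domain_of_inner hH h1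
    have h3 := abs_im_mul_norm_le hH (starRingEnd ℂ z) ⟨w, hwD⟩
    rw [h2, sub_self, norm_zero, Complex.conj_im, abs_neg] at h3
    exact norm_le_zero_iff.mp (nonpos_of_mul_nonpos_right h3 hz')
  have htop : LinearMap.range L = ⊤ := by
    rw [← hclosed.submodule_topologicalClosure_eq, Submodule.topologicalClosure_eq_top_iff]
    exact horth
  exact LinearMap.range_eq_top.mp htop y

theorem sub_smul_injective (hH : IsSelfAdjoint H) {z : ℂ} (hz : z.im ≠ 0) {u v : H.domain}
    (h : H u - z • (u : 𝓗) = H v - z • (v : 𝓗)) : u = v := by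
  have h1 := abs_im_mul_norm_le hH z (u - v)
  have h2 : H (u - v) - z • ((u - v : H.domain) : 𝓗) = 0 := by
    rw [LinearPMap.map_sub, Submodule.coe_sub, smul_sub, sub_sub_sub_comm, h, sub_self]
  rw [h2, norm_zero] at h1
  have h3 := norm_le_zero_iff.mp (nonpos_of_mul_nonpos_right h1 (abs_pos.mpr hz))
  exact sub_eq_zero.mp (Subtype.ext h3)

theorem exists_resolvent (hH : IsSelfAdjoint H) {z : ℂ} (hz : z.im ≠ 0) :
    ∃ R : 𝓗 →L[ℂ] 𝓗, (∀ y, ∃ h : R y ∈ H.domain, H ⟨R y, h⟩ - z • R y = y) ∧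
      ∀ u : H.domain, R (H u - z • (u : 𝓗)) = u := by
  choose r hr using surjective_sub_smul hH hz
  have hr' : ∀ u : H.domain, r (H u - z • (u : 𝓗)) = u := fun u => sub_smul_injective hH hz (hr _)
  have hadd : ∀ x y, r (x + y) = r x + r y := fun x y => by
    refine sub_smul_injective hH hz ?_
    rw [hr, LinearPMap.map_add, Submodule.coe_add, smul_add, add_sub_add_comm, hr, hr]
  have hsmul : ∀ (c : ℂ) x, r (c • x) = c • r x := fun c x => by
    refine sub_smul_injective hH hz ?_
    rw [hr, LinearPMap.map_smul, Submodule.coe_smul, smul_comm z, ← smul_sub, hr]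
  refine ⟨LinearMap.mkContinuous
    { toFun := fun y => (r y : 𝓗)
      map_add' := fun x y => by rw [hadd]; rfl
      map_smul' := fun c x => by rw [hsmul]; rfl } |z.im|⁻¹ fun y => ?_,
    fun y => ⟨(r y).2, hr y⟩, fun u => congrArg Subtype.val (hr' u)⟩
  have h1 := abs_im_mul_norm_le hH z (r y)
  rw [hr] at h1
  rw [inv_mul_eq_div, le_div_iff₀ (abs_pos.mpr hz), mul_comm]
  exact h1

end SelfAdjoint

/-! ### Continuous calculus of a bounded normal operator and its Riesz measures -/

section ContinuousCalculus

theorem inner_cfcHom_ofReal {R : 𝓗 →L[ℂ] 𝓗} (hR : IsStarNormal R) (f : C(spectrum ℂ R, ℝ)) (ψ : 𝓗) :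
    inner ℂ ψ (cfcHom hR ((⟨Complex.ofReal, Complex.continuous_ofReal⟩ : C(ℝ, ℂ)).comp f) ψ)
      = ((inner ℂ ψ (cfcHom hR
        ((⟨Complex.ofReal, Complex.continuous_ofReal⟩ : C(ℝ, ℂ)).comp f) ψ)).re : ℂ) := by
  set F := (⟨Complex.ofReal, Complex.continuous_ofReal⟩ : C(ℝ, ℂ)).comp f
  have hF : star F = F := by ext; simp [F]
  have h1 : (cfcHom hR F).adjoint = cfcHom hR F := by
    rw [← ContinuousLinearMap.star_eq_adjoint, ← map_star, hF]
  symm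
  rw [← Complex.conj_eq_iff_re, inner_conj_symm]
  conv_rhs => rw [← h1, ContinuousLinearMap.adjoint_inner_right]

/-- The positive functional `f ↦ ⟨ψ, f(R) ψ⟩`. -/
noncomputable def scalarFunctional {R : 𝓗 →L[ℂ] 𝓗} (hR : IsStarNormal R) (ψ : 𝓗) :
    CompactlySupportedContinuousMap (spectrum ℂ R) ℝ →ₚ[ℝ] ℝ :=
  PositiveLinearMap.mk₀
    { toFun := fun f => (inner ℂ ψ (cfcHom hR
        ((⟨Complex.ofReal, Complex.continuous_ofReal⟩ : C(ℝ, ℂ)).comp f.toContinuousMap) ψ)).re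
      map_add' := fun f g => by
        rw [← Complex.add_re, ← inner_add_right, ← add_apply, ← map_add]
        congr 5
        ext
        simp
      map_smul' := fun c f => by
        have : ((⟨Complex.ofReal, Complex.continuous_ofReal⟩ : C(ℝ, ℂ)).comp
            (c • f).toContinuousMap) = (c : ℂ) •
            ((⟨Complex.ofReal, Complex.continuous_ofReal⟩ : C(ℝ, ℂ)).comp f.toContinuousMap) := by
          ext
          simp
        rw [this, map_smul, smul_apply, inner_smul_right, Complex.re_ofReal_mul]
        rfl }
    (fun f hf => by
      -- Positivity: f = |√f|², so ⟨ψ, f(R)ψ⟩ = ‖√f(R)ψ‖².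
      have : ((⟨Complex.ofReal, Complex.continuous_ofReal⟩ : C(ℝ, ℂ)).comp f.toContinuousMap)
          = star ((⟨Complex.ofReal, Complex.continuous_ofReal⟩ : C(ℝ, ℂ)).comp
              ((⟨Real.sqrt, Real.continuous_sqrt⟩ : C(ℝ, ℝ)).comp f.toContinuousMap))
            * ((⟨Complex.ofReal, Complex.continuous_ofReal⟩ : C(ℝ, ℂ)).comp
              ((⟨Real.sqrt, Real.continuous_sqrt⟩ : C(ℝ, ℝ)).comp f.toContinuousMap)) := by
        ext x
        have hx : 0 ≤ f.toContinuousMap x := hf x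
        simp only [ContinuousMap.comp_apply, ContinuousMap.coe_mk, ContinuousMap.mul_apply,
          ContinuousMap.star_apply, RCLike.star_def, Complex.conj_ofReal]
        rw [← Complex.ofReal_mul, Real.mul_self_sqrt hx]
      change 0 ≤ (inner ℂ ψ (cfcHom hR
        ((⟨Complex.ofReal, Complex.continuous_ofReal⟩ : C(ℝ, ℂ)).comp f.toContinuousMap) ψ)).re
      rw [this, map_mul, map_star, ContinuousLinearMap.star_eq_adjoint, mul_apply_eq_comp,
        ContinuousLinearMap.adjoint_inner_right, inner_self_eq_norm_sq_to_K]
      simp only [Complex.coe_algebraMap, ← Complex.ofReal_pow, Complex.ofReal_re]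
      positivity)

/-- The continuous functional calculus of a bounded normal operator, with its spectral measures. -/
noncomputable def normalCalculus {R : 𝓗 →L[ℂ] 𝓗} (hR : IsStarNormal R) :
    FunctionalCalculus (spectrum ℂ R) C(spectrum ℂ R, ℂ) 𝓗 where
  ev :=
    { toFun := fun f => ⇑f
      map_one' := rfl
      map_mul' := fun _ _ => rfl
      map_zero' := rfl
      map_add' := fun _ _ => rfl
      commutes' := fun _ => rfl
      map_star' := fun _ => rfl }
  op := cfcHom hR
  μ := fun ψ => RealRMK.rieszMeasure (scalarFunctional hR ψ)
  finite := fun ψ => inferInstance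
  measurable_ev := fun f => f.continuous.measurable
  bounded_ev := fun f => ⟨‖f‖, f.norm_coe_le_norm⟩
  inner_op := fun f ψ => by
    change inner ℂ ψ (cfcHom hR f ψ) = ∫ x, f x ∂(RealRMK.rieszMeasure (scalarFunctional hR ψ))
    set fr : C(spectrum ℂ R, ℝ) := (⟨Complex.re, Complex.continuous_re⟩ : C(ℂ, ℝ)).comp f
    set fi : C(spectrum ℂ R, ℝ) := (⟨Complex.im, Complex.continuous_im⟩ : C(ℂ, ℝ)).comp f
    have hf : f = (⟨Complex.ofReal, Complex.continuous_ofReal⟩ : C(ℝ, ℂ)).comp fr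
        + Complex.I • (⟨Complex.ofReal, Complex.continuous_ofReal⟩ : C(ℝ, ℂ)).comp fi := by
      ext x
      simp [fr, fi, mul_comm Complex.I, Complex.re_add_im]
    have hreal : ∀ g : C(spectrum ℂ R, ℝ), inner ℂ ψ (cfcHom hR
        ((⟨Complex.ofReal, Complex.continuous_ofReal⟩ : C(ℝ, ℂ)).comp g) ψ)
        = ((∫ x, g x ∂(RealRMK.rieszMeasure (scalarFunctional hR ψ)) : ℝ) : ℂ) := fun g => by
      rw [inner_cfcHom_ofReal]
      exact congrArg _ (RealRMK.integral_rieszMeasure (scalarFunctional hR ψ)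
        (CompactlySupportedContinuousMap.continuousMapEquiv g)).symm
    have hint : Integrable (fun x => f x) (RealRMK.rieszMeasure (scalarFunctional hR ψ)) :=
      Integrable.of_bound f.continuous.aestronglyMeasurable ‖f‖ (ae_of_all _ f.norm_coe_le_norm)
    conv_lhs => rw [hf]
    rw [map_add, map_smul, add_apply, smul_apply, inner_add_right, inner_smul_right, hreal, hreal,
      ← integral_re_add_im hint, mul_comm]
    rfl
  dense := fun ν _ f hf ε hε => by
    obtain ⟨g, hg, -⟩ := hf.exists_boundedContinuous_eLpNorm_sub_le (by simp) hε
    exact ⟨g.toContinuousMap, by rw [eLpNorm_sub_comm]; exact hg⟩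

end ContinuousCalculus
end SpectralCalc

/-! ### From a functional calculus to a projection-valued measure -/

open MeasureTheory Filter Topology
open scoped ENNReal

namespace SpectralCalc

variable {𝓗 : Type*} [NormedAddCommGroup 𝓗] [InnerProductSpace ℂ 𝓗] [CompleteSpace 𝓗]

namespace FunctionalCalculus

variable {X 𝒜 : Type*} [MeasurableSpace X] [Ring 𝒜] [StarRing 𝒜] [Algebra ℂ 𝒜]
  (C : FunctionalCalculus X 𝒜 𝓗)

theorem exists_proj (s : Set X) (hs : MeasurableSet s) :
    ∃ S : 𝓗 →L[ℂ] 𝓗, ∀ ψ, C.HasVal (s.indicator 1) ψ (S ψ) :=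
  C.exists_clm (K := 1) (measurable_one.indicator hs) fun x =>
    (norm_indicator_le_norm_self _ _).trans (by simp)

open Classical in
/-- The spectral projection of a measurable set. -/
noncomputable def proj (s : Set X) : 𝓗 →L[ℂ] 𝓗 :=
  if hs : MeasurableSet s then (C.exists_proj s hs).choose else 0

variable {C}

theorem hasVal_proj {s : Set X} (hs : MeasurableSet s) (ψ : 𝓗) :
    C.HasVal (s.indicator 1) ψ (C.proj s ψ) := by
  rw [proj, dif_pos hs]
  exact (C.exists_proj s hs).choose_spec ψ

theorem enorm_proj_sq {s : Set X} (hs : MeasurableSet s) (ψ : 𝓗) :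
    ‖C.proj s ψ‖ₑ ^ 2 = C.μ ψ s := by
  rw [(hasVal_proj hs ψ).enorm_eq, measure_eq_eLpNorm_indicator_sq _ hs]

theorem HasVal.sum {ι : Type*} {s : Finset ι} {f : ι → X → ℂ} {ψ : 𝓗} {χ : ι → 𝓗}
    (h : ∀ i ∈ s, C.HasVal (f i) ψ (χ i)) : C.HasVal (∑ i ∈ s, f i) ψ (∑ i ∈ s, χ i) := by
  classical
  induction s using Finset.induction_on with
  | empty => simpa using C.hasVal_ev 0 ψ
  | insert a s ha ih =>
    rw [Finset.sum_insert ha, Finset.sum_insert ha]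
    exact (h a (Finset.mem_insert_self a s)).add
      (ih fun i hi => h i (Finset.mem_insert_of_mem hi))

/-- The difference from a partial sum is the projection on the union of the remaining sets; its
squared norm is the tail of the convergent series ∑ μ_ψ(A_n). -/
theorem hasSum_proj {A : ℕ → Set X} (hA : ∀ n, MeasurableSet (A n))
    (hd : Pairwise (Function.onFun Disjoint A)) (ψ : 𝓗) :
    HasSum (fun n => C.proj (A n) ψ) (C.proj (⋃ n, A n) ψ) := by
  have h1 : ∀ s : Finset ℕ, ‖(∑ n ∈ s, C.proj (A n) ψ) - C.proj (⋃ n, A n) ψ‖ₑ ^ 2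
      = ∑' n : {n // n ∉ s}, C.μ ψ (A n) := fun s => by
    have hm : MeasurableSet (⋃ n : {n // n ∉ s}, A n) := MeasurableSet.iUnion fun n => hA n
    have e1 : (⋃ n, A n).indicator (1 : X → ℂ) - ∑ n ∈ s, (A n).indicator (1 : X → ℂ)
        = (⋃ n : {n // n ∉ s}, A n).indicator 1 := by
      funext x
      rw [Pi.sub_apply, Finset.sum_apply]
      by_cases hx : x ∈ ⋃ n, A n
      · obtain ⟨m, hm⟩ := Set.mem_iUnion.mp hx
        have hne : ∀ n, n ≠ m → x ∉ A n := fun n hn hxn =>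
          Set.disjoint_left.mp (hd hn) hxn hm
        rw [Set.indicator_of_mem hx]
        by_cases hms : m ∈ s
        · rw [Finset.sum_eq_single_of_mem m hms fun n _ hn => Set.indicator_of_notMem (hne n hn) _,
            Set.indicator_of_mem hm, Set.indicator_of_notMem, sub_self]
          rintro hx'
          obtain ⟨⟨n, hn⟩, hxn⟩ := Set.mem_iUnion.mp hx'
          exact hne n (fun h => hn (h ▸ hms)) hxn
        · rw [Finset.sum_eq_zero fun n hn => Set.indicator_of_notMem
            (hne n fun h => hms (h ▸ hn)) _, sub_zero, Set.indicator_of_mem]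
          exact Set.mem_iUnion.mpr ⟨⟨m, hms⟩, hm⟩
      · have hne : ∀ n, x ∉ A n := fun n hn => hx (Set.mem_iUnion.mpr ⟨n, hn⟩)
        rw [Set.indicator_of_notMem hx, Finset.sum_eq_zero fun n _ =>
          Set.indicator_of_notMem (hne n) _, sub_zero, Set.indicator_of_notMem]
        rintro hx'
        obtain ⟨n, hxn⟩ := Set.mem_iUnion.mp hx'
        exact hne n hxn
    have e2 := (hasVal_proj (C := C) (MeasurableSet.iUnion hA) ψ).sub
      (HasVal.sum (s := s) fun n _ => hasVal_proj (C := C) (hA n) ψ)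
    rw [e1] at e2
    rw [enorm_sub_rev, e2.enorm_eq, ← measure_eq_eLpNorm_indicator_sq _ hm,
      measure_iUnion (f := fun n : {n // n ∉ s} => A n)
        (fun m n hmn => hd fun h => hmn (Subtype.ext h)) fun n => hA n]
  have h2 : Tendsto (fun s : Finset ℕ => ‖(∑ n ∈ s, C.proj (A n) ψ) - C.proj (⋃ n, A n) ψ‖ₑ ^ 2)
      atTop (𝓝 0) := by
    simp_rw [h1]
    refine ENNReal.tendsto_tsum_compl_atTop_zero (f := fun n => C.μ ψ (A n)) ?_
    rw [← measure_iUnion hd hA]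
    exact measure_ne_top _ _
  change Tendsto _ _ _
  rw [tendsto_iff_edist_tendsto_0]
  have h3 := (ENNReal.continuous_rpow_const (y := 1 / 2)).tendsto 0 |>.comp h2
  have h4 : (0 : ℝ≥0∞) ^ (1 / 2 : ℝ) = 0 := by simp
  rw [h4] at h3
  refine h3.congr fun s => ?_
  rw [Function.comp_apply, edist_eq_enorm_sub, ← ENNReal.rpow_natCast, ← ENNReal.rpow_mul]
  norm_num

variable (C)

/-- The projection-valued measure on `ℝ` obtained by transport along a measurable function. -/
noncomputable def pvm {c : X → ℝ} (hc : Measurable c) : PVM 𝓗 where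
  proj := fun A => C.proj (c ⁻¹' A)
  selfAdjoint := fun A hA => by
    rw [ContinuousLinearMap.isSelfAdjoint_iff_isSymmetric]
    intro φ ψ
    refine HasVal.inner_adjoint (C := C) (f := (c ⁻¹' A).indicator 1) ?_ (hasVal_proj (hc hA) ψ)
    have : star ((c ⁻¹' A).indicator (1 : X → ℂ)) = (c ⁻¹' A).indicator 1 := by
      funext x
      by_cases hx : x ∈ c ⁻¹' A <;> simp [hx]
    rw [this]
    exact hasVal_proj (hc hA) φ
  inter := fun A B hA hB => by
    ext ψ
    refine (hasVal_proj (C := C) (hc (hA.inter hB)) ψ).unique ?_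
    have h := (hasVal_proj (C := C) (hc hB) ψ).comp (hasVal_proj (C := C) (hc hA) _)
      (measurable_one.indicator (hc hA))
    rwa [← Set.inter_indicator_one] at h
  univ := by
    ext ψ
    refine (hasVal_proj (C := C) (hc MeasurableSet.univ) ψ).unique ?_
    rw [Set.preimage_univ, Set.indicator_univ]
    exact hasVal_one ψ
  iUnion := fun A hA hd ψ => by
    rw [Set.preimage_iUnion]
    exact hasSum_proj (fun n => hc (hA n)) (fun m n h => (hd h).preimage c) ψ

theorem scalar_pvm {c : X → ℝ} (hc : Measurable c) (ψ : 𝓗) :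
    (C.pvm hc).scalar ψ = (C.μ ψ).map c := by
  ext A hA
  rw [PVM.scalar_apply _ _ hA, Measure.map_apply hc hA, ← enorm_proj_sq (hc hA),
    ENNReal.ofReal_pow (norm_nonneg _), ofReal_norm]
  rfl

end FunctionalCalculus

/-! ### The spectral theorem and the calculus of H -/

section Spectral

open FunctionalCalculus

theorem memLp_two_iff_lintegral {X : Type*} [MeasurableSpace X] {ν : Measure X} {c : X → ℝ}
    (hc : Measurable c) :
    MemLp (fun x => (c x : ℂ)) 2 ν ↔ ∫⁻ x, ENNReal.ofReal (c x ^ 2) ∂ν < ⊤ := by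
  have h1 : ∫⁻ x, ENNReal.ofReal (c x ^ 2) ∂ν = eLpNorm (fun x => (c x : ℂ)) 2 ν ^ 2 := by
    rw [← lintegral_enorm_sq]
    refine lintegral_congr fun x => ?_
    rw [← ofReal_norm, ← ENNReal.ofReal_pow (norm_nonneg _), Complex.norm_real, Real.norm_eq_abs,
      sq_abs]
  rw [h1]
  constructor
  · exact fun h => ENNReal.pow_lt_top h.2
  · refine fun h => ⟨(Complex.measurable_ofReal.comp hc).aestronglyMeasurable, ?_⟩
    exact lt_of_not_ge fun hh => by simp [top_le_iff.mp hh] at h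

/-- The **spectral theorem** for unbounded self-adjoint operators. -/
theorem exists_pvm {H : 𝓗 →ₗ.[ℂ] 𝓗} (hH : IsSelfAdjoint H) :
    ∃ E : PVM 𝓗, E.IsSpectralMeasureOf H := by
  -- R = (H + i)⁻¹ and Q = (H - i)⁻¹ = R*. The two resolvent identities show that they commute, so R
  -- is normal.
  obtain ⟨R, hR, hR'⟩ := exists_resolvent hH (z := -Complex.I) (by simp)
  obtain ⟨Q, hQ, hQ'⟩ := exists_resolvent hH (z := Complex.I) (by simp)
  choose hRD hRe using hR
  choose hQD hQe using hQ
  have hadj : R.adjoint = Q := by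
    symm
    rw [ContinuousLinearMap.eq_adjoint_iff]
    intro x y
    have h1 := inner_symm_of_isSelfAdjoint hH ⟨Q x, hQD x⟩ ⟨R y, hRD y⟩
    have hy := hRe y
    have hx := hQe x
    nth_rw 1 [← hy]
    nth_rw 2 [← hx]
    rw [inner_sub_left, inner_sub_right, h1, inner_smul_left, inner_smul_right]
    simp
  have hRQ : ∀ y, R y - Q y = (-2 * Complex.I) • R (Q y) := fun y => by
    have h1 := hR' (⟨R y, hRD y⟩ - ⟨Q y, hQD y⟩)
    have h2 := hRe y
    have h3 := hQe y
    rw [LinearPMap.map_sub] at h1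
    have h4 : H ⟨R y, hRD y⟩ - H ⟨Q y, hQD y⟩ - -Complex.I • (R y - Q y)
        = (-2 * Complex.I) • Q y := by
      have e1 : H ⟨R y, hRD y⟩ = y + -Complex.I • R y := eq_add_of_sub_eq h2
      have e2 : H ⟨Q y, hQD y⟩ = y + Complex.I • Q y := eq_add_of_sub_eq h3
      rw [e1, e2]
      module
    rw [← map_smul, ← h4]
    exact h1.symm
  have hQR : ∀ y, R y - Q y = (-2 * Complex.I) • Q (R y) := fun y => by
    have h1 := hQ' (⟨R y, hRD y⟩ - ⟨Q y, hQD y⟩)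
    have h2 := hRe y
    have h3 := hQe y
    rw [LinearPMap.map_sub] at h1
    have h4 : H ⟨R y, hRD y⟩ - H ⟨Q y, hQD y⟩ - Complex.I • (R y - Q y)
        = (-2 * Complex.I) • R y := by
      have e1 : H ⟨R y, hRD y⟩ = y + -Complex.I • R y := eq_add_of_sub_eq h2
      have e2 : H ⟨Q y, hQD y⟩ = y + Complex.I • Q y := eq_add_of_sub_eq h3
      rw [e1, e2]
      module
    rw [← map_smul, ← h4]
    exact h1.symm
  have hnormal : IsStarNormal R := by
    refine ⟨?_⟩
    rw [ContinuousLinearMap.star_eq_adjoint, hadj]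
    ext y
    have h := (hQR y).symm.trans (hRQ y)
    exact smul_right_injective 𝓗 (r := -2 * Complex.I) (by simp) h
  set C := normalCalculus hnormal with hC
  set ι : C(spectrum ℂ R, ℂ) := ContinuousMap.restrict (spectrum ℂ R) (ContinuousMap.id ℂ) with hι
  have hop : C.op ι = R := cfcHom_id hnormal
  set r : spectrum ℂ R → ℂ := C.ev ι with hr
  have hrm : Measurable r := C.measurable_ev ι
  -- The resolvent identity R - R* = -2i R*R read on the spectrum: it places r on the circle where
  -- Im(1/r) = 1, together with 0.
  have hrel : ∀ ψ, ∀ᵐ x ∂C.μ ψ, r x - star (r x) + (2 * Complex.I) * (star (r x) * r x) = 0 := by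
    intro ψ
    have h1 : C.op (ι - star ι + (2 * Complex.I) • (star ι * ι)) = 0 := by
      rw [map_add, map_sub, map_smul, map_mul, map_star, hop, ContinuousLinearMap.star_eq_adjoint,
        hadj]
      ext y
      have := hQR y
      simp only [add_apply, sub_apply, smul_apply, mul_apply_eq_comp, this, zero_apply]
      module
    have h2 := C.enorm_op (ι - star ι + (2 * Complex.I) • (star ι * ι)) ψ
    rw [h1, zero_apply, enorm_zero, eq_comm,
      eLpNorm_eq_zero_iff (C.measurable_ev _).aestronglyMeasurable two_ne_zero] at h2
    filter_upwards [h2] with x hx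
    simpa [map_add, map_sub, map_smul, map_mul, map_star] using hx
  -- R annihilates the spectral subspace over r = 0, and R is injective.
  have hne : ∀ ψ, ∀ᵐ x ∂C.μ ψ, r x ≠ 0 := by
    intro ψ
    have hs : MeasurableSet {x | r x = 0} := hrm (measurableSet_singleton 0)
    have h1 := (hasVal_proj (C := C) hs ψ).ev_mul ι
    have h2 : C.ev ι * {x | r x = 0}.indicator 1 = C.ev 0 := by
      rw [map_zero]
      funext x
      by_cases hx : r x = 0
      · rw [Pi.mul_apply, ← hr, hx, zero_mul, Pi.zero_apply]
      · rw [Pi.mul_apply, Set.indicator_of_notMem (by exact hx), mul_zero, Pi.zero_apply]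
    rw [h2, hop] at h1
    have h3 := h1.unique (C.hasVal_ev 0 ψ)
    rw [map_zero, zero_apply] at h3
    have h4 := hRe (C.proj {x | r x = 0} ψ)
    have h5 : (⟨R (C.proj {x | r x = 0} ψ), hRD _⟩ : H.domain) = 0 := Subtype.ext h3
    rw [h5, h3, LinearPMap.map_zero, smul_zero, sub_zero] at h4
    have h6 := enorm_proj_sq (C := C) hs ψ
    rw [← h4, enorm_zero] at h6
    rw [ae_iff]
    simpa using h6.symm
  -- Since 1/r = c + i almost everywhere, H is c(R), and pushing the spectral projections of R
  -- forward along c gives those of H.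
  set c : spectrum ℂ R → ℝ := fun x => ((r x)⁻¹).re with hcdef
  have hc : Measurable c := Complex.measurable_re.comp hrm.inv
  have hcr : ∀ ψ, ∀ᵐ x ∂C.μ ψ, (r x)⁻¹ = c x + Complex.I := by
    intro ψ
    filter_upwards [hrel ψ, hne ψ] with x h1 h2
    have h3 : star (r x) ≠ 0 := star_ne_zero.mpr h2
    have h4 : star ((r x)⁻¹) - (r x)⁻¹ = - (2 * Complex.I) := by
      rw [star_inv₀, inv_sub_inv h3 h2]
      field_simp
      linear_combination h1
    have h5 := congrArg Complex.im h4
    simp only [RCLike.star_def, Complex.sub_im, Complex.conj_im, Complex.neg_im, Complex.mul_im,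
      Complex.re_ofNat, Complex.I_im, Complex.im_ofNat, Complex.I_re] at h5
    apply Complex.ext
    · simp [hcdef]
    · simp only [Complex.add_im, Complex.ofReal_im, Complex.I_im, zero_add]
      linarith
  have hinv : Measurable r⁻¹ := hrm.inv
  have hmem : ∀ ψ, ψ ∈ H.domain ↔ MemLp r⁻¹ 2 (C.μ ψ) := by
    intro ψ
    constructor
    · intro hψ
      have h1 := hR' ⟨ψ, hψ⟩
      have h2 := C.hasVal_ev ι (H ⟨ψ, hψ⟩ - -Complex.I • ψ)
      rw [hop, h1] at h2
      rw [h2.memLp_iff hinv]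
      refine (memLp_congr_ae ?_).mpr (hasVal_one _).memLp
      filter_upwards [hne _] with x hx
      exact inv_mul_cancel₀ hx
    · intro h
      obtain ⟨φ, hφ⟩ := C.exists_hasVal h
      have h1 := hφ.ev_mul ι
      rw [hop] at h1
      have h2 : R φ = ψ := h1.unique ((hasVal_one ψ).congr (by
        filter_upwards [hne ψ] with x hx
        exact (mul_inv_cancel₀ hx).symm))
      rw [← h2]
      exact hRD φ
  refine ⟨C.pvm hc, fun ψ => ?_, fun ψ => ?_⟩
  · rw [hmem, scalar_pvm, lintegral_map (by fun_prop) hc, ← memLp_two_iff_lintegral hc]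
    have hI : MemLp (fun _ => Complex.I : spectrum ℂ R → ℂ) 2 (C.μ ψ) := memLp_const _
    constructor
    · intro h
      refine (memLp_congr_ae ?_).mp (h.sub hI)
      filter_upwards [hcr ψ] with x hx
      simp [hx]
    · intro h
      refine (memLp_congr_ae ?_).mp (h.add hI)
      filter_upwards [hcr ψ] with x hx
      simp [hx]
  · have h1 := hR' ψ
    set φ := H ψ - -Complex.I • (ψ : 𝓗) with hφ
    have h2 := C.hasVal_ev ι φ
    rw [hop, h1] at h2
    have h3 : C.HasVal r⁻¹ (ψ : 𝓗) φ := by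
      refine h2.of_mul ((hasVal_one φ).congr ?_) hinv
      filter_upwards [hne φ] with x hx
      exact (inv_mul_cancel₀ hx).symm
    have h4 := h3.sub ((hasVal_one (C := C) (ψ : 𝓗)).const_smul Complex.I)
    have h5 : φ - Complex.I • (ψ : 𝓗) = H ψ := by rw [hφ]; module
    rw [h5] at h4
    have h6 := (h4.congr (g := fun x => (c x : ℂ)) (by
      filter_upwards [hcr (ψ : 𝓗)] with x hx
      simp [hx])).inner_eq_integral
    rw [h6, integral_complex_ofReal, scalar_pvm, integral_map hc.aemeasurable (by fun_prop)]

variable {H : 𝓗 →ₗ.[ℂ] 𝓗}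

/-- The functional calculus of a self-adjoint operator. -/
noncomputable def spectralCalculus (hH : IsSelfAdjoint H) :
    FunctionalCalculus ℝ (SimpleFunc ℝ ℂ) 𝓗 :=
  (exists_pvm hH).choose.calculus

/-- `borelCalc` and `spectralCalculus` select the same spectral measure, so its uniqueness plays no
role. -/
theorem hasVal_borelCalc (hH : IsSelfAdjoint H) {b : ℝ → ℂ} (hb : Measurable b) {K : ℝ}
    (hK : ∀ x, ‖b x‖ ≤ K) (ψ : 𝓗) : (spectralCalculus hH).HasVal b ψ (borelCalc H b ψ) := by
  rw [borelCalc, dif_pos (exists_pvm hH)]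
  exact PVM.hasVal_integral _ hb hK ψ

theorem mem_domain_iff_memLp (hH : IsSelfAdjoint H) (ψ : 𝓗) :
    ψ ∈ H.domain ↔ MemLp (fun x : ℝ => (x : ℂ)) 2 ((spectralCalculus hH).μ ψ) := by
  rw [(exists_pvm hH).choose_spec.1 ψ]
  exact (memLp_two_iff_lintegral measurable_id).symm

/-- Polarization for an unbounded operator: test the form at ψ + φ and at ψ + iφ. -/
theorem eq_zero_of_inner_self_eq_zero {𝓚 : Type*} [NormedAddCommGroup 𝓚] [InnerProductSpace ℂ 𝓚]
    {D : Submodule ℂ 𝓚} (hd : Dense (D : Set 𝓚)) (L : D →ₗ[ℂ] 𝓚)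
    (h : ∀ ψ : D, inner ℂ (ψ : 𝓚) (L ψ) = 0) : L = 0 := by
  ext ψ
  refine hd.eq_zero_of_inner_right ℂ fun φ hφ => ?_
  have h1 := h (ψ + ⟨φ, hφ⟩)
  have h2 := h (ψ + Complex.I • ⟨φ, hφ⟩)
  simp only [map_add, map_smul, Submodule.coe_add, Submodule.coe_smul, inner_add_left,
    inner_add_right, inner_smul_left, inner_smul_right, h, Complex.conj_I] at h1 h2
  have h3 : inner ℂ φ (L ψ) = -inner ℂ (ψ : 𝓚) (L ⟨φ, hφ⟩) := by
    have := h ⟨φ, hφ⟩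
    simp only at this
    rw [this] at h1
    linear_combination h1
  have h4 := h ⟨φ, hφ⟩
  simp only at h4
  rw [h4] at h2
  rw [h3] at h2
  have h5 : inner ℂ (ψ : 𝓚) (L ⟨φ, hφ⟩) = 0 := by
    have h6 : (2 * Complex.I) * inner ℂ (ψ : 𝓚) (L ⟨φ, hφ⟩) = 0 := by linear_combination h2
    simpa using h6
  rw [h3, h5, neg_zero]

/-- The definition of the spectral measure fixes only the domain and the quadratic form of H;
polarization on the dense domain recovers the vectors Hψ. -/
theorem hasVal_self (hH : IsSelfAdjoint H) (ψ : H.domain) :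
    (spectralCalculus hH).HasVal (fun x => (x : ℂ)) (ψ : 𝓗) (H ψ) := by
  set C := spectralCalculus hH
  have hm : ∀ ψ : H.domain, MemLp (fun x : ℝ => (x : ℂ)) 2 (C.μ (ψ : 𝓗)) := fun ψ =>
    (mem_domain_iff_memLp hH ψ).mp ψ.2
  choose χ hχ using fun ψ => C.exists_hasVal (hm ψ)
  let L : H.domain →ₗ[ℂ] 𝓗 :=
    { toFun := χ
      map_add' := fun ψ φ => (hχ _).unique ((hχ ψ).add_vec (hχ φ) (hm (ψ + φ)))
      map_smul' := fun c ψ => (hχ _).unique ((hχ ψ).smul_vec c (hm (c • ψ))) }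
  have h0 := eq_zero_of_inner_self_eq_zero hH.dense_domain (L - H.toFun) fun ψ => by
    change inner ℂ (ψ : 𝓗) (χ ψ - H ψ) = 0
    rw [inner_sub_right, (hχ ψ).inner_eq_integral, (exists_pvm hH).choose_spec.2 ψ,
      integral_complex_ofReal]
    exact sub_self _
  have h1 : χ ψ = H ψ := sub_eq_zero.mp (LinearMap.congr_fun h0 ψ)
  exact h1 ▸ hχ ψ

theorem apply_eq_of_hasVal (hH : IsSelfAdjoint H) {ψ χ : 𝓗}
    (h : (spectralCalculus hH).HasVal (fun x => (x : ℂ)) ψ χ) :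
    ∃ hψ : ψ ∈ H.domain, H ⟨ψ, hψ⟩ = χ :=
  have hψ := (mem_domain_iff_memLp hH ψ).mpr h.memLp
  ⟨hψ, (hasVal_self hH ⟨ψ, hψ⟩).unique h⟩

theorem ofReal_sub_ne_zero {z : ℂ} (hz : z.im ≠ 0) (x : ℝ) : (x : ℂ) - z ≠ 0 := fun h => by
  apply hz
  rw [← sub_eq_zero.mp h, Complex.ofReal_im]

theorem hasVal_resolvent (hH : IsSelfAdjoint H) {z : ℂ} (hz : z.im ≠ 0) (ψ : 𝓗) :
    (spectralCalculus hH).HasVal (fun x => ((x : ℂ) - z)⁻¹) ψ (resolvent H z ψ) := by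
  set C := spectralCalculus hH
  have hex : ∃ u : H.domain, H u - z • (u : 𝓗) = ψ := surjective_sub_smul hH hz ψ
  have h1 : resolvent H z ψ = hex.choose := dif_pos hex
  have h2 := hex.choose_spec
  rw [h1]
  set u := hex.choose
  have h3 := (hasVal_self hH u).sub ((hasVal_one (C := C) (u : 𝓗)).const_smul z)
  rw [h2] at h3
  refine h3.of_mul ?_ (by fun_prop)
  convert hasVal_one (C := C) (u : 𝓗) using 1
  funext x
  simpa using inv_mul_cancel₀ (ofReal_sub_ne_zero hz x)

end Spectral

end SpectralCalc

/-! ### Commutation and dominated convergence in the calculus -/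

open MeasureTheory Filter Topology
open scoped ENNReal

namespace SpectralCalc

variable {𝓗 : Type*} [NormedAddCommGroup 𝓗] [InnerProductSpace ℂ 𝓗] [CompleteSpace 𝓗]

namespace FunctionalCalculus

variable {X 𝒜 : Type*} [MeasurableSpace X] [Ring 𝒜] [StarRing 𝒜] [Algebra ℂ 𝒜]
  {C : FunctionalCalculus X 𝒜 𝓗} {f g : X → ℂ} {ψ χ ψ' χ' : 𝓗}

/-- With f(x) = x this shows that functions of H preserve D(H) and commute with H. -/
theorem HasVal.commute (h : C.HasVal f ψ χ) (hf : Measurable f) (hg : Measurable g)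
    (hψ : C.HasVal g ψ ψ') (hχ : C.HasVal g χ χ') : C.HasVal f ψ' χ' := by
  refine hψ.of_mul ?_ hf
  rw [mul_comm]
  exact h.comp hχ hg

theorem HasVal.tendsto {ι : Type*} {l : Filter ι} [l.IsCountablyGenerated] {F : ι → X → ℂ}
    {χs : ι → 𝓗} (h : C.HasVal f ψ χ) (hF : ∀ᶠ n in l, C.HasVal (F n) ψ (χs n)) {g : X → ℂ}
    (hg : MemLp g 2 (C.μ ψ)) (hbd : ∀ᶠ n in l, ∀ x, ‖F n x - f x‖ ≤ ‖g x‖)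
    (hlim : ∀ x, Tendsto (fun n => F n x) l (𝓝 (f x))) : Tendsto χs l (𝓝 χ) := by
  have h1 : Tendsto (fun n => ∫⁻ x, ‖F n x - f x‖ₑ ^ 2 ∂C.μ ψ) l (𝓝 (∫⁻ _, 0 ∂C.μ ψ)) := by
    refine tendsto_lintegral_filter_of_dominated_convergence' (fun x => ‖g x‖ₑ ^ 2) ?_ ?_ ?_ ?_
    · filter_upwards [hF] with n hn
      exact (hn.memLp.sub h.memLp).1.enorm.pow_const 2
    · filter_upwards [hbd] with n hn
      refine ae_of_all _ fun x => pow_le_pow_left' (enorm_le_iff_norm_le.mpr (hn x)) 2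
    · rw [lintegral_enorm_sq]
      exact (ENNReal.pow_lt_top hg.2).ne
    · refine ae_of_all _ fun x => ?_
      have h2 : Tendsto (fun n => ‖F n x - f x‖ₑ) l (𝓝 0) := by
        have := ((hlim x).sub_const (f x)).enorm
        rwa [sub_self, enorm_zero] at this
      have h3 := ENNReal.Tendsto.pow (n := 2) h2
      rwa [zero_pow two_ne_zero] at h3
  rw [lintegral_zero] at h1
  have h2 : Tendsto (fun n => ‖χs n - χ‖ₑ ^ 2) l (𝓝 0) := by
    refine h1.congr' ?_
    filter_upwards [hF] with n hn
    rw [(hn.sub h).enorm_eq, ← lintegral_enorm_sq]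
    rfl
  rw [tendsto_iff_edist_tendsto_0]
  have h3 := (ENNReal.continuous_rpow_const (y := 1 / 2)).tendsto 0 |>.comp h2
  have h4 : (0 : ℝ≥0∞) ^ (1 / 2 : ℝ) = 0 := by simp
  rw [h4] at h3
  refine h3.congr fun s => ?_
  rw [Function.comp_apply, edist_eq_enorm_sub, ← ENNReal.rpow_natCast, ← ENNReal.rpow_mul]
  norm_num

end FunctionalCalculus

/-! ### The unitary group -/

section Evolution

open FunctionalCalculus

variable {H : 𝓗 →ₗ.[ℂ] 𝓗}

theorem norm_exp_neg_I_mul (t x : ℝ) : ‖Complex.exp (-(Complex.I * t * x))‖ = 1 := by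
  have : -(Complex.I * t * x) = ((-(t * x) : ℝ) : ℂ) * Complex.I := by push_cast; ring
  rw [this, Complex.norm_exp_ofReal_mul_I]

theorem measurable_exp_neg_I_mul (t : ℝ) :
    Measurable fun x : ℝ => Complex.exp (-(Complex.I * t * x)) := by fun_prop

theorem hasVal_evol (hH : IsSelfAdjoint H) (t : ℝ) (ψ : 𝓗) :
    (spectralCalculus hH).HasVal (fun x => Complex.exp (-(Complex.I * t * x))) ψ (evol H t ψ) :=
  hasVal_borelCalc hH (measurable_exp_neg_I_mul t) (fun x => (norm_exp_neg_I_mul t x).le) ψ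

theorem norm_evol (hH : IsSelfAdjoint H) (t : ℝ) (ψ : 𝓗) : ‖evol H t ψ‖ = ‖ψ‖ := by
  have h1 : ‖evol H t ψ‖ₑ = ‖ψ‖ₑ := by
    rw [(hasVal_evol hH t ψ).enorm_eq, (hasVal_one (C := spectralCalculus hH) ψ).enorm_eq]
    refine eLpNorm_congr_norm_ae (ae_of_all _ fun x => ?_)
    rw [norm_exp_neg_I_mul]
    simp
  exact congrArg ENNReal.toReal h1 |>.trans rfl

theorem evol_zero (hH : IsSelfAdjoint H) (ψ : 𝓗) : evol H 0 ψ = ψ := by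
  refine (hasVal_evol hH 0 ψ).unique ?_
  convert hasVal_one (C := spectralCalculus hH) ψ using 1
  funext x
  simp

theorem evol_add (hH : IsSelfAdjoint H) (s t : ℝ) (ψ : 𝓗) :
    evol H (s + t) ψ = evol H s (evol H t ψ) := by
  refine (hasVal_evol hH _ ψ).unique ?_
  convert (hasVal_evol hH t ψ).comp (hasVal_evol hH s _) (measurable_exp_neg_I_mul s) using 1
  funext x
  rw [Pi.mul_apply, ← Complex.exp_add]
  push_cast
  ring_nf

theorem inner_evol (hH : IsSelfAdjoint H) (t : ℝ) (φ ψ : 𝓗) :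
    inner ℂ (evol H (-t) φ) ψ = inner ℂ φ (evol H t ψ) := by
  refine HasVal.inner_adjoint ?_ (hasVal_evol hH t ψ)
  convert hasVal_evol hH (-t) φ using 1
  funext x
  rw [Pi.star_apply, RCLike.star_def, ← Complex.exp_conj]
  simp

theorem evol_mem_domain (hH : IsSelfAdjoint H) (t : ℝ) (u : H.domain) :
    ∃ h : evol H t u ∈ H.domain, H ⟨evol H t u, h⟩ = evol H t (H u) :=
  apply_eq_of_hasVal hH ((hasVal_self hH u).commute Complex.measurable_ofReal
    (measurable_exp_neg_I_mul t) (hasVal_evol hH t _) (hasVal_evol hH t _))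

theorem borelCalc_mem_domain (hH : IsSelfAdjoint H) {b : ℝ → ℂ} (hb : Measurable b) {K : ℝ}
    (hK : ∀ x, ‖b x‖ ≤ K) (u : H.domain) :
    ∃ h : borelCalc H b u ∈ H.domain, H ⟨borelCalc H b u, h⟩ = borelCalc H b (H u) :=
  apply_eq_of_hasVal hH ((hasVal_self hH u).commute Complex.measurable_ofReal
    hb (hasVal_borelCalc hH hb hK _) (hasVal_borelCalc hH hb hK _))

theorem borelCalc_evol (hH : IsSelfAdjoint H) {b : ℝ → ℂ} (hb : Measurable b) {K : ℝ}
    (hK : ∀ x, ‖b x‖ ≤ K) (t : ℝ) (ψ : 𝓗) :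
    borelCalc H b (evol H t ψ) = evol H t (borelCalc H b ψ) :=
  (hasVal_borelCalc hH hb hK _).unique ((hasVal_borelCalc hH hb hK ψ).commute hb
    (measurable_exp_neg_I_mul t) (hasVal_evol hH t _) (hasVal_evol hH t _))

theorem norm_borelCalc_le (hH : IsSelfAdjoint H) {b : ℝ → ℂ} (hb : Measurable b) {K : ℝ}
    (hK : ∀ x, ‖b x‖ ≤ K) (ψ : 𝓗) : ‖borelCalc H b ψ‖ ≤ K * ‖ψ‖ :=
  (hasVal_borelCalc hH hb hK ψ).norm_le (ae_of_all _ hK) ((norm_nonneg _).trans (hK 0))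

theorem continuous_evol (hH : IsSelfAdjoint H) (ψ : 𝓗) : Continuous fun t => evol H t ψ := by
  rw [continuous_iff_continuousAt]
  intro t
  refine (hasVal_evol hH t ψ).tendsto (Eventually.of_forall fun s => hasVal_evol hH s ψ)
    (g := fun _ => 2) (memLp_const _) (Eventually.of_forall fun s x => ?_) fun x => ?_
  · refine (norm_sub_le _ _).trans ?_
    rw [norm_exp_neg_I_mul, norm_exp_neg_I_mul]
    norm_num
  · exact Continuous.tendsto (f := fun s : ℝ => Complex.exp (-(Complex.I * s * x))) (by fun_prop) t

theorem norm_exp_sub_exp_le (s t x : ℝ) :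
    ‖Complex.exp (-(Complex.I * (s + t : ℝ) * x)) - Complex.exp (-(Complex.I * s * x))‖
      ≤ |t| * |x| := by
  have h1 : Complex.exp (-(Complex.I * (s + t : ℝ) * x)) - Complex.exp (-(Complex.I * s * x))
      = Complex.exp (-(Complex.I * s * x)) * (Complex.exp (Complex.I * (-(t * x) : ℝ)) - 1) := by
    rw [mul_sub, ← Complex.exp_add, mul_one]
    push_cast
    ring_nf
  rw [h1, norm_mul, norm_exp_neg_I_mul, one_mul]
  refine (Real.norm_exp_I_mul_ofReal_sub_one_le (x := -(t * x))).trans_eq ?_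
  rw [Real.norm_eq_abs, abs_neg, abs_mul]

theorem hasDerivAt_evol (hH : IsSelfAdjoint H) (u : H.domain) (t : ℝ) :
    HasDerivAt (fun s => evol H s (u : 𝓗)) (-Complex.I • evol H t (H u)) t := by
  rw [hasDerivAt_iff_tendsto_slope_zero]
  set C := spectralCalculus hH
  -- The dominating function: the difference quotient of e^{-isx} and its limit are each at most
  -- |x|, which is square integrable because u lies in D(H).
  have hx : MemLp (fun x : ℝ => (2 : ℂ) * x) 2 (C.μ (u : 𝓗)) := (hasVal_self hH u).memLp.const_mul 2
  have h1 : C.HasVal (fun x => -Complex.I * (Complex.exp (-(Complex.I * t * x)) * x)) (u : 𝓗)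
      (-Complex.I • evol H t (H u)) :=
    ((hasVal_self hH u).comp (hasVal_evol hH t _) (measurable_exp_neg_I_mul t)).const_smul _
  refine h1.tendsto (F := fun (s : ℝ) (x : ℝ) => (s⁻¹ : ℂ) * (Complex.exp (-(Complex.I * (t + s : ℝ) * x))
    - Complex.exp (-(Complex.I * t * x)))) (Eventually.of_forall fun s => ?_) hx ?_ fun x => ?_
  · have := ((hasVal_evol hH (t + s) (u : 𝓗)).sub (hasVal_evol hH t (u : 𝓗))).const_smul (s⁻¹ : ℂ)
    rw [← Complex.ofReal_inv] at this
    convert this using 1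
    · funext x
      simp
    · exact (Complex.coe_smul _ _).symm
  · filter_upwards [self_mem_nhdsWithin] with s hs x
    have hs' : (s : ℝ) ≠ 0 := hs
    refine (norm_sub_le _ _).trans ?_
    have e1 : ‖(s⁻¹ : ℂ) * (Complex.exp (-(Complex.I * (t + s : ℝ) * x))
        - Complex.exp (-(Complex.I * t * x)))‖ ≤ |x| := by
      rw [norm_mul, norm_inv, Complex.norm_real, Real.norm_eq_abs]
      refine (mul_le_mul_of_nonneg_left (norm_exp_sub_exp_le t s x) (by positivity)).trans_eq ?_
      rw [inv_mul_cancel_left₀ (abs_ne_zero.mpr hs')]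
    have e2 : ‖-Complex.I * (Complex.exp (-(Complex.I * t * x)) * x)‖ = |x| := by
      rw [norm_mul, norm_neg, Complex.norm_I, one_mul, norm_mul, norm_exp_neg_I_mul, one_mul,
        Complex.norm_real, Real.norm_eq_abs]
    have e3 : ‖(2 : ℂ) * x‖ = 2 * |x| := by simp
    rw [e2, e3]
    linarith
  · have h2 : HasDerivAt (fun s : ℝ => Complex.exp (-(Complex.I * s * x)))
        (-Complex.I * (Complex.exp (-(Complex.I * t * x)) * x)) t := by
      have h3 : HasDerivAt (fun s : ℝ => -(Complex.I * (s : ℂ) * x)) (-(Complex.I * 1 * x)) t :=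
        (((Complex.ofRealCLM.hasDerivAt (x := t)).const_mul Complex.I).mul_const (x : ℂ)).neg
      convert h3.cexp using 1
      ring
    rw [hasDerivAt_iff_tendsto_slope_zero] at h2
    refine h2.congr fun s => ?_
    rw [Complex.real_smul, Complex.ofReal_inv]

end Evolution

/-! ### Density of the domain of the adjoint -/

section Adjoint

/-- Von Neumann's graph argument: a pair orthogonal to the graph of B has second component in D(B*).
If w is orthogonal to D(B*), then (0, w) lies in the double orthogonal complement of the closed
graph, hence in the graph, and w = B0 = 0. -/
theorem dense_adjoint_domain {B : 𝓗 →ₗ.[ℂ] 𝓗} (hc : B.IsClosed) :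
    Dense (B.adjoint.domain : Set 𝓗) := by
  rw [Submodule.dense_iff_topologicalClosure_eq_top, Submodule.topologicalClosure_eq_top_iff,
    Submodule.eq_bot_iff]
  intro w hw
  set G : Submodule ℂ (WithLp 2 (𝓗 × 𝓗)) :=
    B.graph.comap (WithLp.linearEquiv 2 ℂ (𝓗 × 𝓗)).toLinearMap with hG
  have hGc : IsClosed (G : Set (WithLp 2 (𝓗 × 𝓗))) :=
    IsClosed.preimage (WithLp.prod_continuous_ofLp 2 𝓗 𝓗) hc
  have hmem : WithLp.toLp 2 ((0 : 𝓗), w) ∈ Gᗮᗮ := by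
    rw [Submodule.mem_orthogonal]
    intro v hv
    have h1 : ∀ u : B.domain, inner ℂ (-v.ofLp.1) (u : 𝓗) = inner ℂ v.ofLp.2 (B u) := fun u => by
      have := (Submodule.mem_orthogonal' _ _).mp hv (WithLp.toLp 2 ((u : 𝓗), B u))
        (B.mem_graph u)
      rw [WithLp.prod_inner_apply] at this
      rw [inner_neg_left]
      linear_combination -this
    have h2 := LinearPMap.mem_adjoint_domain_of_exists v.ofLp.2 ⟨_, h1⟩
    have h3 := (Submodule.mem_orthogonal _ _).mp hw _ h2
    rw [WithLp.prod_inner_apply]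
    simpa using h3
  rw [Submodule.orthogonal_orthogonal_eq_closure, hGc.submodule_topologicalClosure_eq] at hmem
  exact B.graph_fst_eq_zero_snd hmem rfl

end Adjoint
end SpectralCalc

/-! ### Plancherel and the Gaussian-damped evolution -/

open MeasureTheory Filter Topology
open scoped ENNReal FourierTransform

namespace SpectralCalc

/-- **Plancherel's theorem** for a continuous integrable function with integrable Fourier
transform. -/
theorem integral_norm_sq_fourier_eq {F : Type*} [NormedAddCommGroup F] [InnerProductSpace ℂ F]
    [CompleteSpace F] {g : ℝ → F} (hc : Continuous g) (hg : Integrable g) (hg' : Integrable (𝓕 g)) :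
    ∫ ξ, ‖𝓕 g ξ‖ ^ 2 = ∫ t, ‖g t‖ ^ 2 := by
  have h1 : ∫ ξ, inner ℂ (𝓕 g ξ) (𝓕 g ξ) = ∫ t, inner ℂ (g t) (𝓕⁻ (𝓕 g) t) := by
    have := VectorFourier.integral_sesq_fourierIntegral_eq_neg_flip (μ := volume) (ν := volume)
      (innerSL ℂ : F →L⋆[ℂ] F →L[ℂ] ℂ) (L := innerₗ ℝ) Real.continuous_fourierChar continuous_inner
      hg hg'
    simp only [innerSL_apply_apply, flip_innerₗ] at this
    exact this
  rw [hc.fourierInv_fourier_eq hg hg'] at h1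
  apply Complex.ofReal_injective
  rw [← integral_complex_ofReal, ← integral_complex_ofReal]
  simpa [inner_self_eq_norm_sq_to_K] using h1

variable {𝓗 : Type*} [NormedAddCommGroup 𝓗] [InnerProductSpace ℂ 𝓗] [CompleteSpace 𝓗]
  {H : 𝓗 →ₗ.[ℂ] 𝓗}

open FunctionalCalculus

/-- The Fourier transform of the Gaussian `t ↦ exp (-β t²) exp (-i x t)`. -/
noncomputable def gaussianKernel (β ξ x : ℝ) : ℝ :=
  √(Real.pi / β) * Real.exp (-(2 * Real.pi * ξ + x) ^ 2 / (4 * β))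

theorem gaussianKernel_nonneg (β ξ x : ℝ) : 0 ≤ gaussianKernel β ξ x := by
  unfold gaussianKernel; positivity

theorem gaussianKernel_le {β : ℝ} (hβ : 0 < β) (ξ x : ℝ) :
    gaussianKernel β ξ x ≤ √(Real.pi / β) := by
  unfold gaussianKernel
  refine mul_le_of_le_one_right (Real.sqrt_nonneg _) (Real.exp_le_one_iff.mpr ?_)
  rw [neg_div]
  have : 0 ≤ (2 * Real.pi * ξ + x) ^ 2 / (4 * β) := by positivity
  linarith

theorem measurable_ofReal_gaussianKernel (β ξ : ℝ) :
    Measurable fun x : ℝ => (gaussianKernel β ξ x : ℂ) := by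
  unfold gaussianKernel
  fun_prop

theorem integral_gaussian_mul_exp {β : ℝ} (hβ : 0 < β) (ξ x : ℝ) :
    ∫ t : ℝ, Complex.exp ((-2 * Real.pi * t * ξ : ℝ) * Complex.I) *
      ((Real.exp (-β * t ^ 2) : ℂ) * Complex.exp (-(Complex.I * t * x)))
      = gaussianKernel β ξ x := by
  have h := fourierIntegral_gaussian (b := β) (by simpa using hβ) (-(2 * Real.pi * ξ + x) : ℝ)
  rw [gaussianKernel]
  push_cast at h ⊢
  have e1 : ((√(Real.pi / β) : ℝ) : ℂ) = ((Real.pi : ℂ) / β) ^ (1 / 2 : ℂ) := by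
    rw [Real.sqrt_eq_rpow, Complex.ofReal_cpow (by positivity)]
    push_cast
    rfl
  rw [e1, show -(2 * (Real.pi : ℂ) * ξ + x) ^ 2 = -(-(2 * (Real.pi : ℂ) * ξ + x)) ^ 2 by ring, ← h]
  refine integral_congr_ae (ae_of_all _ fun t => ?_)
  dsimp only
  rw [← Complex.exp_add, ← Complex.exp_add, ← Complex.exp_add]
  ring_nf

theorem integrable_gaussian_smul {F : Type*} [NormedAddCommGroup F] [NormedSpace ℝ F] {β : ℝ}
    (hβ : 0 < β) {g : ℝ → F} (hg : Continuous g) {K : ℝ} (hK : ∀ t, ‖g t‖ ≤ K) :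
    Integrable fun t => Real.exp (-β * t ^ 2) • g t :=
  (integrable_exp_neg_mul_sq hβ).smul_bdd K hg.aestronglyMeasurable (ae_of_all _ hK)

theorem integrable_gaussian_smul_evol (hH : IsSelfAdjoint H) {β : ℝ} (hβ : 0 < β) (φ : 𝓗) :
    Integrable fun t : ℝ => Real.exp (-β * t ^ 2) • evol H t φ :=
  integrable_gaussian_smul hβ (continuous_evol hH φ) fun t => (norm_evol hH t φ).le

theorem integrable_exp_smul {F : Type*} [NormedAddCommGroup F] [NormedSpace ℂ F] {g : ℝ → F}
    (hg : Integrable g) (ξ : ℝ) :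
    Integrable fun t : ℝ => Complex.exp ((-2 * Real.pi * t * ξ : ℝ) * Complex.I) • g t := by
  refine hg.bdd_smul 1 ?_ (ae_of_all _ fun t => ?_)
  · exact Continuous.aestronglyMeasurable (by fun_prop)
  · rw [Complex.norm_exp_ofReal_mul_I]

theorem integral_gaussianKernel {β : ℝ} (hβ : 0 < β) (ξ : ℝ) (ν : Measure ℝ) [IsFiniteMeasure ν] :
    ∫ x, (gaussianKernel β ξ x : ℂ) ∂ν
      = ∫ t : ℝ, Complex.exp ((-2 * Real.pi * t * ξ : ℝ) * Complex.I) *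
        ((Real.exp (-β * t ^ 2) : ℂ) * ∫ x : ℝ, Complex.exp (-(Complex.I * t * x)) ∂ν) := by
  simp_rw [← integral_gaussian_mul_exp hβ ξ]
  rw [integral_integral_swap]
  · refine integral_congr_ae (ae_of_all _ fun t => ?_)
    dsimp only
    rw [integral_const_mul, integral_const_mul]
  · have h1 : Integrable (fun p : ℝ × ℝ => (1 : ℝ) * Real.exp (-β * p.2 ^ 2)) (ν.prod volume) :=
      (integrable_const (1 : ℝ)).mul_prod (integrable_exp_neg_mul_sq hβ)
    refine h1.mono ?_ (ae_of_all _ fun p => ?_)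
    · exact Measurable.aestronglyMeasurable (by simp only [Function.uncurry_def]; fun_prop)
    · rw [Function.uncurry_def, norm_mul, norm_mul, Complex.norm_exp_ofReal_mul_I,
        norm_exp_neg_I_mul, one_mul, mul_one, one_mul, Complex.norm_real]

theorem inner_fourier_gaussian_smul_evol (hH : IsSelfAdjoint H) {β : ℝ} (hβ : 0 < β) (ξ : ℝ)
    (φ : 𝓗) : inner ℂ φ (𝓕 (fun t => Real.exp (-β * t ^ 2) • evol H t φ) ξ)
      = ∫ x, (gaussianKernel β ξ x : ℂ) ∂(spectralCalculus hH).μ φ := by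
  rw [Real.fourier_real_eq_integral_exp_smul, integral_gaussianKernel hβ,
    ← integral_inner (integrable_exp_smul (integrable_gaussian_smul_evol hH hβ φ) ξ)]
  refine integral_congr_ae (ae_of_all _ fun t => ?_)
  dsimp only
  rw [inner_smul_right, ← Complex.coe_smul, inner_smul_right,
    (hasVal_evol hH t φ).inner_eq_integral]

/-- By Fubini the two sides have equal quadratic forms, and both are linear in φ, so polarization
applies. -/
theorem fourier_gaussian_smul_evol (hH : IsSelfAdjoint H) {β : ℝ} (hβ : 0 < β) (ξ : ℝ) (φ : 𝓗) :
    (spectralCalculus hH).HasVal (fun x => (gaussianKernel β ξ x : ℂ)) φ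
      (𝓕 (fun t => Real.exp (-β * t ^ 2) • evol H t φ) ξ) := by
  obtain ⟨S, hS⟩ := (spectralCalculus hH).exists_clm (f := fun x => (gaussianKernel β ξ x : ℂ))
    (K := √(Real.pi / β))
    (measurable_ofReal_gaussianKernel β ξ)
    (fun x => by
      rw [Complex.norm_real, Real.norm_of_nonneg (gaussianKernel_nonneg _ _ _)]
      exact gaussianKernel_le hβ ξ x)
  let L : 𝓗 →ₗ[ℂ] 𝓗 :=
    { toFun := fun φ => 𝓕 (fun t => Real.exp (-β * t ^ 2) • evol H t φ) ξ
      map_add' := fun φ χ => by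
        simp_rw [Real.fourier_real_eq_integral_exp_smul, map_add, smul_add]
        exact integral_add (integrable_exp_smul (integrable_gaussian_smul_evol hH hβ φ) ξ)
          (integrable_exp_smul (integrable_gaussian_smul_evol hH hβ χ) ξ)
      map_smul' := fun c φ => by
        simp_rw [Real.fourier_real_eq_integral_exp_smul, map_smul, RingHom.id_apply]
        rw [← integral_smul]
        refine integral_congr_ae (ae_of_all _ fun t => ?_)
        dsimp only
        rw [smul_comm (Real.exp _) c, smul_comm _ c] }
  have hL : (S : 𝓗 →ₗ[ℂ] 𝓗) = L := by
    refine (ext_inner_map _ _).mp fun φ => ?_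
    rw [← inner_conj_symm, ← inner_conj_symm _ φ]
    exact congrArg _ ((hS φ).inner_eq_integral.trans
      (inner_fourier_gaussian_smul_evol hH hβ ξ φ).symm)
  have h2 := hS φ
  rwa [show S φ = L φ from LinearMap.congr_fun hL φ] at h2

end SpectralCalc

/-! ### Smoothness as a bound at each frequency -/

open MeasureTheory Filter Topology
open scoped ENNReal FourierTransform

namespace SpectralCalc

variable {𝓗 : Type*} [NormedAddCommGroup 𝓗] [InnerProductSpace ℂ 𝓗] [CompleteSpace 𝓗]
  {H B : 𝓗 →ₗ.[ℂ] 𝓗}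

open FunctionalCalculus

/-- By the closed graph theorem a closed operator defined on the domain of `H` is `H`-bounded. -/
theorem exists_bounded_factor (hH : IsSelfAdjoint H) (hB : B.IsClosed) (hD : H.domain ≤ B.domain) :
    ∃ M : 𝓗 →L[ℂ] 𝓗, ∀ u : H.domain, B ⟨u, hD u.2⟩ = M (H u - Complex.I • (u : 𝓗)) := by
  obtain ⟨R, hR, hR'⟩ := exists_resolvent hH (z := Complex.I) (by simp)
  choose hRD hRe using hR
  let L : 𝓗 →ₗ[ℂ] 𝓗 :=
    B.toFun ∘ₗ LinearMap.codRestrict B.domain (R : 𝓗 →ₗ[ℂ] 𝓗) fun y => hD (hRD y)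
  have hL : ∀ y, L y = B ⟨R y, hD (hRD y)⟩ := fun y => rfl
  refine ⟨ContinuousLinearMap.ofSeqClosedGraph (g := L) fun u x y hu hy => ?_, fun u => ?_⟩
  · have h1 : (R x, y) ∈ B.graph := by
      refine IsClosed.mem_of_tendsto (s := (B.graph : Set (𝓗 × 𝓗))) hB
        (((R.continuous.tendsto x).comp hu).prodMk_nhds hy) (Eventually.of_forall fun n => ?_)
      exact (LinearPMap.mem_graph_iff B).mpr ⟨⟨R (u n), hD (hRD _)⟩, rfl, rfl⟩
    obtain ⟨w, hw1, hw2⟩ := (LinearPMap.mem_graph_iff B).mp h1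
    dsimp only at hw1 hw2
    rw [hL, ← hw2]
    exact congrArg B (Subtype.ext hw1)
  · rw [ContinuousLinearMap.coeFn_ofSeqClosedGraph, hL]
    exact congrArg B (Subtype.ext (hR' u).symm)

/-- R(z) - R(z̄) = 2i Im z · R(z)R(z̄), and R(z)* = R(z̄). -/
theorem norm_resolvent_sq_le (hH : IsSelfAdjoint H) {z : ℂ} (hz : z.im ≠ 0) (y : 𝓗) :
    2 * |z.im| * ‖resolvent H (starRingEnd ℂ z) y‖ ^ 2
      = ‖inner ℂ (resolvent H z y - resolvent H (starRingEnd ℂ z) y) y‖ := by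
  set C := spectralCalculus hH
  have hz' : (starRingEnd ℂ z).im ≠ 0 := by simpa using hz
  have h1 := hasVal_resolvent hH hz y
  have h2 := hasVal_resolvent hH hz' y
  set v := resolvent H (starRingEnd ℂ z) y
  have h3 := hasVal_resolvent hH hz v
  have h4 := (h2.comp h3 (by fun_prop)).const_smul (2 * Complex.I * z.im)
  have h5 : resolvent H z y - v = (2 * Complex.I * z.im) • resolvent H z v := by
    refine (h1.sub h2).unique ?_
    convert h4 using 1
    funext x
    have n1 := ofReal_sub_ne_zero hz x
    have n2 := ofReal_sub_ne_zero hz' x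
    simp only [Pi.sub_apply, Pi.smul_apply, Pi.mul_apply, smul_eq_mul]
    have n3 : z - starRingEnd ℂ z = 2 * Complex.I * z.im := by
      rw [Complex.sub_conj]; push_cast; ring
    rw [← n3]
    field_simp
    ring
  have h6 : inner ℂ v v = inner ℂ y (resolvent H z v) := by
    refine HasVal.inner_adjoint (f := fun x : ℝ => ((x : ℂ) - z)⁻¹) ?_ h3
    convert h2 using 1
    funext x
    simp
  have h7 : ‖inner ℂ (resolvent H z v) y‖ = ‖v‖ ^ 2 := by
    rw [← inner_conj_symm, Complex.norm_conj, ← h6, inner_self_eq_norm_sq_to_K, norm_pow]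
    simp
  rw [h5, inner_smul_left, norm_mul, h7]
  simp

/-- Duality: for u = R(z)η and f in D(B*), ⟨f, Bu⟩ = ⟨R(z̄)B*f, η⟩, and smoothness bounds
‖R(z̄)B*f‖. Density of D(B*) allows f = Bu. -/
theorem norm_sq_le_of_isSmoothWithBound (hH : IsSelfAdjoint H) {a : ℝ}
    (hB : IsSmoothWithBound H B a) {z : ℂ} (hz : z.im ≠ 0) {η : 𝓗} {u : 𝓗} (hu : u ∈ B.domain)
    (hηu : (spectralCalculus hH).HasVal (fun x => ((x : ℂ) - z)⁻¹) η u) :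
    ‖B ⟨u, hu⟩‖ ^ 2 ≤ a ^ 2 / (4 * |z.im|) * ‖η‖ ^ 2 := by
  obtain ⟨hBd, hBc, hBs⟩ := hB
  have hzp : 0 < |z.im| := abs_pos.mpr hz
  set w := B ⟨u, hu⟩
  have h1 : ∀ f : 𝓗, f ∈ B.adjoint.domain →
      ‖inner ℂ f w‖ ^ 2 ≤ a ^ 2 / (4 * |z.im|) * ‖f‖ ^ 2 * ‖η‖ ^ 2 := by
    intro f hf
    set y := B.adjoint ⟨f, hf⟩ with hy
    have e1 : inner ℂ f w = inner ℂ y u :=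
      (LinearPMap.adjoint_isFormalAdjoint hBd ⟨f, hf⟩ ⟨u, hu⟩).symm
    have e2 : inner ℂ (resolvent H (starRingEnd ℂ z) y) η = inner ℂ y u := by
      refine HasVal.inner_adjoint ?_ hηu
      convert hasVal_resolvent hH (z := starRingEnd ℂ z) (by simpa using hz) y using 1
      funext x
      simp
    have e3 : 2 * |z.im| * ‖resolvent H (starRingEnd ℂ z) y‖ ^ 2 ≤ a ^ 2 / 2 * ‖f‖ ^ 2 :=
      (norm_resolvent_sq_le hH hz y).trans_le (hBs z hz ⟨f, hf⟩)
    have e4 : ‖resolvent H (starRingEnd ℂ z) y‖ ^ 2 ≤ a ^ 2 / (4 * |z.im|) * ‖f‖ ^ 2 := by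
      rw [div_mul_eq_mul_div, le_div_iff₀ (by positivity)]
      linarith
    rw [e1, ← e2]
    calc _ ≤ (‖resolvent H (starRingEnd ℂ z) y‖ * ‖η‖) ^ 2 := by
          gcongr
          exact norm_inner_le_norm _ _
      _ ≤ _ := by
          rw [mul_pow]
          gcongr
  have h2 : ‖inner ℂ w w‖ ^ 2 ≤ a ^ 2 / (4 * |z.im|) * ‖w‖ ^ 2 * ‖η‖ ^ 2 := by
    have hcl : IsClosed {f : 𝓗 | ‖inner ℂ f w‖ ^ 2 ≤ a ^ 2 / (4 * |z.im|) * ‖f‖ ^ 2 * ‖η‖ ^ 2} :=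
      isClosed_le (by fun_prop) (by fun_prop)
    exact hcl.closure_subset_iff.mpr h1 (dense_adjoint_domain hBc w)
  have h3 : ‖inner ℂ w w‖ = ‖w‖ ^ 2 := by
    rw [inner_self_eq_norm_sq_to_K]
    simp
  rw [h3] at h2
  rcases (sq_nonneg ‖w‖).eq_or_lt with h0 | h0
  · rw [← h0]
    positivity
  · refine le_of_mul_le_mul_left ?_ h0
    linarith

theorem fourier_gaussian_smul_comp (hH : IsSelfAdjoint H) (M : 𝓗 →L[ℂ] 𝓗) {β : ℝ} (hβ : 0 < β)
    (ξ : ℝ) (φ : 𝓗) : 𝓕 (fun t : ℝ => Real.exp (-β * t ^ 2) • M (evol H t φ)) ξ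
      = M (𝓕 (fun t : ℝ => Real.exp (-β * t ^ 2) • evol H t φ) ξ) := by
  rw [Real.fourier_real_eq_integral_exp_smul, Real.fourier_real_eq_integral_exp_smul,
    ← M.integral_comp_comm (integrable_exp_smul (integrable_gaussian_smul_evol hH hβ φ) ξ)]
  refine integral_congr_ae (ae_of_all _ fun t => ?_)
  dsimp only
  rw [map_smul, M.map_smul_of_tower]

theorem lintegral_gaussian_translate {β : ℝ} (hβ : 0 < β) (x : ℝ) :
    ∫⁻ ξ : ℝ, ENNReal.ofReal (4 * Real.pi * Real.exp (-(2 * Real.pi * ξ + x) ^ 2 / (4 * β)))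
      = ENNReal.ofReal (4 * √(Real.pi * β)) := by
  have h1 : ∀ ξ : ℝ, Real.exp (-(2 * Real.pi * ξ + x) ^ 2 / (4 * β))
      = (fun v => Real.exp (-(1 / (4 * β)) * v ^ 2)) (2 * Real.pi * ξ + x) := fun ξ => by
    congr 1
    ring
  have hi : Integrable fun v : ℝ => Real.exp (-(1 / (4 * β)) * v ^ 2) :=
    integrable_exp_neg_mul_sq (by positivity)
  have hi2 : Integrable fun ξ : ℝ => (fun v => Real.exp (-(1 / (4 * β)) * v ^ 2)) (2 * Real.pi * ξ + x) :=
    (hi.comp_add_right x).comp_mul_left' (by positivity)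
  simp_rw [h1]
  rw [← ofReal_integral_eq_lintegral_ofReal (hi2.const_mul _) (ae_of_all _ fun ξ => by positivity)]
  congr 1
  rw [integral_const_mul, Measure.integral_comp_mul_left
    (fun y => (fun v => Real.exp (-(1 / (4 * β)) * v ^ 2)) (y + x)) (2 * Real.pi),
    integral_add_right_eq_self (fun v => Real.exp (-(1 / (4 * β)) * v ^ 2)) x, integral_gaussian,
    abs_of_pos (by positivity), smul_eq_mul,
    show Real.pi / (1 / (4 * β)) = 2 ^ 2 * (Real.pi * β) by field_simp; ring,
    Real.sqrt_mul (by positivity), Real.sqrt_sq (by norm_num)]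
  field_simp

/-- With v = (2πξ + x)², the factor |x - z|² is v + 4β ≤ 4β e^{v/(4β)}, which costs only half of the
decay e^{-v/(2β)} of the squared kernel. -/
theorem norm_sub_mul_gaussianKernel_sq_le {β : ℝ} (hβ : 0 < β) (ξ x : ℝ) :
    ‖((x : ℂ) - ((-(2 * Real.pi * ξ) : ℝ) + (2 * √β : ℝ) * Complex.I)) * gaussianKernel β ξ x‖ ^ 2
      ≤ 4 * Real.pi * Real.exp (-(2 * Real.pi * ξ + x) ^ 2 / (4 * β)) := by
  have h1 : ‖(x : ℂ) - ((-(2 * Real.pi * ξ) : ℝ) + (2 * √β : ℝ) * Complex.I)‖ ^ 2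
      = (2 * Real.pi * ξ + x) ^ 2 + 4 * β := by
    rw [Complex.sq_norm, Complex.normSq_apply]
    have : √β * √β = β := Real.mul_self_sqrt hβ.le
    simp only [Complex.sub_re, Complex.ofReal_re, Complex.add_re, Complex.mul_re, Complex.I_re,
      mul_zero, Complex.ofReal_im, Complex.I_im, mul_one, sub_self, add_zero, Complex.sub_im,
      Complex.add_im, Complex.mul_im, zero_add, zero_sub]
    linear_combination 4 * this
  rw [norm_mul, mul_pow, h1, Complex.norm_real, Real.norm_of_nonneg (gaussianKernel_nonneg _ _ _),
    gaussianKernel, mul_pow, Real.sq_sqrt (by positivity)]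
  set v := (2 * Real.pi * ξ + x) ^ 2
  have h2 : v + 4 * β ≤ 4 * β * Real.exp (v / (4 * β)) := by
    have := Real.add_one_le_exp (v / (4 * β))
    calc v + 4 * β = 4 * β * (v / (4 * β) + 1) := by field_simp
      _ ≤ _ := by gcongr
  calc (v + 4 * β) * (Real.pi / β * Real.exp (-v / (4 * β)) ^ 2)
      ≤ 4 * β * Real.exp (v / (4 * β)) * (Real.pi / β * Real.exp (-v / (4 * β)) ^ 2) := by gcongr
    _ = 4 * Real.pi * (Real.exp (v / (4 * β)) * Real.exp (-v / (4 * β))) * Real.exp (-v / (4 * β)) := by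
        field_simp
    _ = _ := by
        rw [← Real.exp_add]
        have : v / (4 * β) + -v / (4 * β) = 0 := by ring
        rw [this, Real.exp_zero, mul_one]

theorem hasVal_sub_I (hH : IsSelfAdjoint H) (u : H.domain) :
    (spectralCalculus hH).HasVal (fun x => (x : ℂ) - Complex.I) (u : 𝓗)
      (H u - Complex.I • (u : 𝓗)) := by
  convert (hasVal_self hH u).sub ((hasVal_one (u : 𝓗)).const_smul Complex.I) using 1
  funext x
  simp

/-- Here Mκ is Bχ with χ = k_ξ(H)u, and the resolvent bound is applied to χ = R(z)η with η = (H -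
z)k_ξ(H)u. -/
theorem enorm_sq_factor_fourier_le (hH : IsSelfAdjoint H) {a : ℝ} (hB : IsSmoothWithBound H B a)
    (hD : H.domain ≤ B.domain) {M : 𝓗 →L[ℂ] 𝓗}
    (hM : ∀ u : H.domain, B ⟨u, hD u.2⟩ = M (H u - Complex.I • (u : 𝓗))) {β : ℝ} (hβ : 0 < β)
    (ξ : ℝ) (u : H.domain) {κ : 𝓗}
    (hκ : (spectralCalculus hH).HasVal (fun x => (gaussianKernel β ξ x : ℂ))
      (H u - Complex.I • (u : 𝓗)) κ) :
    ‖M κ‖ₑ ^ 2 ≤ ENNReal.ofReal (a ^ 2 / (8 * √β)) *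
      ∫⁻ x, ENNReal.ofReal (4 * Real.pi * Real.exp (-(2 * Real.pi * ξ + x) ^ 2 / (4 * β)))
        ∂(spectralCalculus hH).μ (u : 𝓗) := by
  set C := spectralCalculus hH
  -- The real part is the centre of the Gaussian in x and the imaginary part its width.
  set z : ℂ := (-(2 * Real.pi * ξ) : ℝ) + (2 * √β : ℝ) * Complex.I with hzdef
  have hzim : z.im = 2 * √β := by simp [hzdef]
  have hsβ : 0 < √β := Real.sqrt_pos.mpr hβ
  have hz : z.im ≠ 0 := by rw [hzim]; positivity
  have hkm := measurable_ofReal_gaussianKernel β ξ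
  obtain ⟨χ, hχ⟩ : ∃ χ, C.HasVal (fun x => (gaussianKernel β ξ x : ℂ)) (u : 𝓗) χ := by
    refine C.exists_hasVal (MemLp.of_bound hkm.aestronglyMeasurable (√(Real.pi / β))
      (ae_of_all _ fun x => ?_))
    rw [Complex.norm_real, Real.norm_of_nonneg (gaussianKernel_nonneg _ _ _)]
    exact gaussianKernel_le hβ ξ x
  have hbd : ∀ x : ℝ, ‖((x : ℂ) - z) * gaussianKernel β ξ x‖ ^ 2
      ≤ 4 * Real.pi * Real.exp (-(2 * Real.pi * ξ + x) ^ 2 / (4 * β)) :=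
    norm_sub_mul_gaussianKernel_sq_le hβ ξ
  obtain ⟨η, hη⟩ : ∃ η, C.HasVal (fun x => ((x : ℂ) - z) * gaussianKernel β ξ x) (u : 𝓗) η := by
    refine C.exists_hasVal (MemLp.of_bound (by fun_prop) (√(4 * Real.pi))
      (ae_of_all _ fun x => Real.le_sqrt_of_sq_le ((hbd x).trans ?_)))
    refine mul_le_of_le_one_right (by positivity) (Real.exp_le_one_iff.mpr ?_)
    rw [neg_div]
    have : 0 ≤ (2 * Real.pi * ξ + x) ^ 2 / (4 * β) := by positivity
    linarith
  have hηχ : C.HasVal (fun x => ((x : ℂ) - z)⁻¹) η χ := by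
    refine hη.of_mul ?_ (by fun_prop)
    convert hχ using 1
    funext x
    exact inv_mul_cancel_left₀ (ofReal_sub_ne_zero hz x) _
  have h1 : C.HasVal (fun x => (x : ℂ) - Complex.I) χ κ :=
    (hasVal_sub_I hH u).commute (by fun_prop) hkm hχ hκ
  obtain ⟨hχD, hχe⟩ := apply_eq_of_hasVal hH (ψ := χ) (χ := κ + Complex.I • χ) (by
    convert h1.add ((hasVal_one χ).const_smul Complex.I) using 1
    funext x
    simp)
  have h2 : M κ = B ⟨χ, hD hχD⟩ := by
    rw [hM ⟨χ, hχD⟩, hχe, add_sub_cancel_right]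
  have h3 := norm_sq_le_of_isSmoothWithBound hH hB hz (hD hχD) hηχ
  have h4 : a ^ 2 / (4 * |z.im|) = a ^ 2 / (8 * √β) := by
    rw [hzim, abs_of_pos (by positivity)]
    ring_nf
  rw [h4, ← h2] at h3
  have h5 : ‖M κ‖ₑ ^ 2 ≤ ENNReal.ofReal (a ^ 2 / (8 * √β)) * ‖η‖ₑ ^ 2 := by
    rw [← ofReal_norm, ← ofReal_norm, ← ENNReal.ofReal_pow (norm_nonneg _),
      ← ENNReal.ofReal_pow (norm_nonneg _), ← ENNReal.ofReal_mul (by positivity)]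
    exact ENNReal.ofReal_le_ofReal h3
  refine h5.trans (mul_le_mul_right ?_ _)
  rw [hη.enorm_eq, ← lintegral_enorm_sq]
  refine lintegral_mono fun x => ?_
  rw [← ofReal_norm, ← ENNReal.ofReal_pow (norm_nonneg _)]
  exact ENNReal.ofReal_le_ofReal (hbd x)

end SpectralCalc

/-! ### The smoothing estimate in time -/

open MeasureTheory Filter Topology
open scoped ENNReal FourierTransform

namespace SpectralCalc

variable {𝓗 : Type*} [NormedAddCommGroup 𝓗] [InnerProductSpace ℂ 𝓗] [CompleteSpace 𝓗]
  {H B : 𝓗 →ₗ.[ℂ] 𝓗}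

open FunctionalCalculus

/-- On bounded spectrum the kernel decays like a Gaussian in ξ, from (2πξ + x)² ≥ 2π²ξ² - x². This
gives the integrability of the Fourier transform that Plancherel requires. -/
theorem gaussianKernel_le_of_abs_le {β : ℝ} (hβ : 0 < β) (ξ : ℝ) {x N : ℝ} (hx : |x| ≤ N) :
    gaussianKernel β ξ x ≤ √(Real.pi / β) * Real.exp (N ^ 2 / (4 * β)) *
      Real.exp (-(Real.pi ^ 2 / (2 * β)) * ξ ^ 2) := by
  rw [gaussianKernel, mul_assoc √_, ← Real.exp_add]
  have h1 : x ^ 2 ≤ N ^ 2 := sq_le_sq' (abs_le.mp hx).1 (abs_le.mp hx).2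
  have h2 : -(2 * Real.pi * ξ + x) ^ 2 ≤ N ^ 2 - 2 * Real.pi ^ 2 * ξ ^ 2 := by
    nlinarith [sq_nonneg (2 * Real.pi * ξ + 2 * x)]
  have h3 : N ^ 2 / (4 * β) + -(Real.pi ^ 2 / (2 * β)) * ξ ^ 2
      = (N ^ 2 - 2 * Real.pi ^ 2 * ξ ^ 2) / (4 * β) := by
    field_simp
    ring
  rw [h3]
  gcongr

theorem integrable_fourier_of_ae_abs_le (hH : IsSelfAdjoint H) (M : 𝓗 →L[ℂ] 𝓗) {β : ℝ} (hβ : 0 < β)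
    {φ : 𝓗} {N : ℝ} (hN : ∀ᵐ x ∂(spectralCalculus hH).μ φ, |x| ≤ N) :
    Integrable (𝓕 (fun t : ℝ => Real.exp (-β * t ^ 2) • M (evol H t φ))) := by
  have hg : Integrable fun t : ℝ => Real.exp (-β * t ^ 2) • M (evol H t φ) :=
    integrable_gaussian_smul hβ (M.continuous.comp (continuous_evol hH φ)) (K := ‖M‖ * ‖φ‖) fun t =>
      (M.le_opNorm _).trans_eq (by rw [norm_evol hH])
  have hc : Continuous (𝓕 (fun t : ℝ => Real.exp (-β * t ^ 2) • M (evol H t φ))) :=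
    VectorFourier.fourierIntegral_continuous Real.continuous_fourierChar (L := innerₗ ℝ)
      continuous_inner hg
  refine Integrable.mono' (g := fun ξ => ‖M‖ * (√(Real.pi / β) * Real.exp (N ^ 2 / (4 * β)) *
      Real.exp (-(Real.pi ^ 2 / (2 * β)) * ξ ^ 2) * ‖φ‖)) ?_ hc.aestronglyMeasurable
      (ae_of_all _ fun ξ => ?_)
  · exact (((integrable_exp_neg_mul_sq (by positivity)).const_mul _).mul_const _).const_mul _
  · rw [fourier_gaussian_smul_comp hH M hβ]
    refine (M.le_opNorm _).trans ?_
    gcongr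
    refine (fourier_gaussian_smul_evol hH hβ ξ φ).norm_le ?_ (by positivity)
    filter_upwards [hN] with x hx
    rw [Complex.norm_real, Real.norm_of_nonneg (gaussianKernel_nonneg _ _ _)]
    exact gaussianKernel_le_of_abs_le hβ ξ hx

theorem lintegral_lintegral_gaussian {β : ℝ} (hβ : 0 < β) (ν : Measure ℝ) [IsFiniteMeasure ν] :
    ∫⁻ ξ : ℝ, ∫⁻ x, ENNReal.ofReal (4 * Real.pi * Real.exp (-(2 * Real.pi * ξ + x) ^ 2 / (4 * β))) ∂ν
      = ENNReal.ofReal (4 * √(Real.pi * β)) * ν Set.univ := by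
  rw [lintegral_lintegral_swap (by simp only [Function.uncurry_def]; fun_prop)]
  simp_rw [lintegral_gaussian_translate hβ]
  rw [lintegral_const]

theorem integral_gaussian_smul_sq_le (hH : IsSelfAdjoint H) {a : ℝ} (hB : IsSmoothWithBound H B a)
    (hD : H.domain ≤ B.domain) {M : 𝓗 →L[ℂ] 𝓗}
    (hM : ∀ u : H.domain, B ⟨u, hD u.2⟩ = M (H u - Complex.I • (u : 𝓗))) {β : ℝ} (hβ : 0 < β)
    (u : H.domain) {N : ℝ}
    (hN : ∀ᵐ x ∂(spectralCalculus hH).μ (H u - Complex.I • (u : 𝓗)), |x| ≤ N) :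
    ∫ t : ℝ, ‖Real.exp (-β * t ^ 2) • M (evol H t (H u - Complex.I • (u : 𝓗)))‖ ^ 2
      ≤ a ^ 2 * ‖(u : 𝓗)‖ ^ 2 := by
  set φ := H u - Complex.I • (u : 𝓗)
  have hMc : Continuous fun t => M (evol H t φ) := M.continuous.comp (continuous_evol hH φ)
  have hg : Integrable fun t : ℝ => Real.exp (-β * t ^ 2) • M (evol H t φ) :=
    integrable_gaussian_smul hβ hMc (K := ‖M‖ * ‖φ‖) fun t =>
      (M.le_opNorm _).trans_eq (by rw [norm_evol hH])
  have hg' := integrable_fourier_of_ae_abs_le hH M hβ hN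
  have hgc : Continuous fun t : ℝ => Real.exp (-β * t ^ 2) • M (evol H t φ) :=
    Continuous.smul (f := fun t : ℝ => Real.exp (-β * t ^ 2)) (by fun_prop) hMc
  rw [← integral_norm_sq_fourier_eq hgc hg hg',
    integral_eq_lintegral_of_nonneg_ae (ae_of_all _ fun ξ => by positivity)
      (by exact hg'.1.norm.pow 2)]
  refine ENNReal.toReal_le_of_le_ofReal (by positivity) ?_
  calc ∫⁻ ξ, ENNReal.ofReal (‖𝓕 (fun t : ℝ => Real.exp (-β * t ^ 2) • M (evol H t φ)) ξ‖ ^ 2)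
      ≤ ∫⁻ ξ, ENNReal.ofReal (a ^ 2 / (8 * √β)) * ∫⁻ x, ENNReal.ofReal
          (4 * Real.pi * Real.exp (-(2 * Real.pi * ξ + x) ^ 2 / (4 * β)))
          ∂(spectralCalculus hH).μ (u : 𝓗) := by
        refine lintegral_mono fun ξ => ?_
        rw [fourier_gaussian_smul_comp hH M hβ, ENNReal.ofReal_pow (norm_nonneg _), ofReal_norm]
        exact enorm_sq_factor_fourier_le hH hB hD hM hβ ξ u (fourier_gaussian_smul_evol hH hβ ξ φ)
    _ = ENNReal.ofReal (a ^ 2 / (8 * √β)) *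
          (ENNReal.ofReal (4 * √(Real.pi * β)) * ‖(u : 𝓗)‖ₑ ^ 2) := by
        rw [lintegral_const_mul' _ _ ENNReal.ofReal_ne_top, lintegral_lintegral_gaussian hβ,
          measure_univ_eq]
    _ ≤ ENNReal.ofReal (a ^ 2 * ‖(u : 𝓗)‖ ^ 2) := by
        rw [← ofReal_norm, ← ENNReal.ofReal_pow (norm_nonneg _), ← ENNReal.ofReal_mul (by positivity),
          ← ENNReal.ofReal_mul (by positivity)]
        refine ENNReal.ofReal_le_ofReal ?_
        -- The powers of β cancel and leave the constant √π/2 ≤ 1.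
        have h1 : √Real.pi ≤ 2 := Real.sqrt_le_iff.mpr ⟨by norm_num, by linarith [Real.pi_lt_four]⟩
        have h2 : 0 < √β := Real.sqrt_pos.mpr hβ
        rw [Real.sqrt_mul (by positivity)]
        calc a ^ 2 / (8 * √β) * (4 * (√Real.pi * √β) * ‖(u : 𝓗)‖ ^ 2)
            = √Real.pi / 2 * (a ^ 2 * ‖(u : 𝓗)‖ ^ 2) := by field_simp; ring
          _ ≤ 1 * (a ^ 2 * ‖(u : 𝓗)‖ ^ 2) := by
              gcongr
              linarith
          _ = _ := one_mul _

theorem integral_smooth_le_of_ae_abs_le (hH : IsSelfAdjoint H) {a : ℝ}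
    (hB : IsSmoothWithBound H B a) (hD : H.domain ≤ B.domain) {M : 𝓗 →L[ℂ] 𝓗}
    (hM : ∀ u : H.domain, B ⟨u, hD u.2⟩ = M (H u - Complex.I • (u : 𝓗))) {T : ℝ} (hT : 0 < T)
    (u : H.domain) {N : ℝ}
    (hN : ∀ᵐ x ∂(spectralCalculus hH).μ (H u - Complex.I • (u : 𝓗)), |x| ≤ N) :
    ∫ t in (-T)..T, ‖M (evol H t (H u - Complex.I • (u : 𝓗)))‖ ^ 2 ≤ 2 * a ^ 2 * ‖(u : 𝓗)‖ ^ 2 := by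
  set φ := H u - Complex.I • (u : 𝓗)
  -- With this β, e^{-2βt²} ≥ 1 - 1/2 on [-T, T], so removing the damping costs a factor 2.
  set β : ℝ := 1 / (4 * T ^ 2) with hβdef
  have hβ : 0 < β := by positivity
  have hMc : Continuous fun t => M (evol H t φ) := M.continuous.comp (continuous_evol hH φ)
  have hMb : ∀ t, ‖M (evol H t φ)‖ ≤ ‖M‖ * ‖φ‖ := fun t =>
    (M.le_opNorm _).trans_eq (by rw [norm_evol hH])
  have h0 := integral_gaussian_smul_sq_le hH hB hD hM hβ u hN
  have hsq : ∀ t : ℝ, ‖Real.exp (-β * t ^ 2) • M (evol H t φ)‖ ^ 2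
      = Real.exp (-(2 * β) * t ^ 2) * ‖M (evol H t φ)‖ ^ 2 := fun t => by
    rw [norm_smul, mul_pow, Real.norm_of_nonneg (Real.exp_pos _).le, ← Real.exp_nat_mul]
    push_cast
    ring_nf
  have hi : Integrable fun t : ℝ => ‖Real.exp (-β * t ^ 2) • M (evol H t φ)‖ ^ 2 := by
    simp_rw [hsq]
    refine integrable_gaussian_smul (β := 2 * β) (by positivity) (g := fun t => ‖M (evol H t φ)‖ ^ 2)
      (hMc.norm.pow 2) (K := (‖M‖ * ‖φ‖) ^ 2) fun t => ?_
    rw [norm_pow, norm_norm]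
    gcongr
    exact hMb t
  have hTT : -T ≤ T := by linarith
  calc ∫ t in (-T)..T, ‖M (evol H t φ)‖ ^ 2
      ≤ ∫ t in (-T)..T, 2 * ‖Real.exp (-β * t ^ 2) • M (evol H t φ)‖ ^ 2 := by
        refine intervalIntegral.integral_mono_on hTT ((hMc.norm.pow 2).intervalIntegrable _ _)
          (hi.const_mul 2).intervalIntegrable fun t ht => ?_
        rw [hsq, ← mul_assoc]
        refine le_mul_of_one_le_left (by positivity) ?_
        have h1 : t ^ 2 ≤ T ^ 2 := sq_le_sq' ht.1 ht.2
        have h2 : 2 * β * t ^ 2 ≤ 1 / 2 := by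
          calc 2 * β * t ^ 2 ≤ 2 * β * T ^ 2 := by gcongr
            _ = 1 / 2 := by rw [hβdef]; field_simp; norm_num
        have h3 := Real.add_one_le_exp (-(2 * β) * t ^ 2)
        linarith
    _ = 2 * ∫ t in (-T)..T, ‖Real.exp (-β * t ^ 2) • M (evol H t φ)‖ ^ 2 :=
        intervalIntegral.integral_const_mul _ _
    _ ≤ 2 * ∫ t, ‖Real.exp (-β * t ^ 2) • M (evol H t φ)‖ ^ 2 := by
        rw [intervalIntegral.integral_of_le hTT]
        gcongr
        · exact ae_of_all _ fun t => by positivity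
        · exact Measure.restrict_le_self
    _ ≤ 2 * a ^ 2 * ‖(u : 𝓗)‖ ^ 2 := by linarith

/-- The bound for spectrally truncated vectors does not depend on the truncation. Cut off to |x| ≤
n, which does not increase ‖u‖, and let n tend to infinity by dominated convergence. -/
theorem integral_smooth_le (hH : IsSelfAdjoint H) {a : ℝ}
    (hB : IsSmoothWithBound H B a) (hD : H.domain ≤ B.domain) {M : 𝓗 →L[ℂ] 𝓗}
    (hM : ∀ u : H.domain, B ⟨u, hD u.2⟩ = M (H u - Complex.I • (u : 𝓗))) {T : ℝ} (hT : 0 < T)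
    (u : H.domain) :
    ∫ t in (-T)..T, ‖M (evol H t (H u - Complex.I • (u : 𝓗)))‖ ^ 2 ≤ 2 * a ^ 2 * ‖(u : 𝓗)‖ ^ 2 := by
  set C := spectralCalculus hH
  set φ := H u - Complex.I • (u : 𝓗) with hφ
  have hs : ∀ n : ℕ, MeasurableSet {x : ℝ | |x| ≤ n} := fun n =>
    measurableSet_le (by fun_prop) measurable_const
  have hind : ∀ n : ℕ, Measurable ({x : ℝ | |x| ≤ n}.indicator (1 : ℝ → ℂ)) := fun n =>
    measurable_one.indicator (hs n)
  have hle : ∀ (n : ℕ) (x : ℝ), ‖{x : ℝ | |x| ≤ n}.indicator (1 : ℝ → ℂ) x‖ ≤ 1 := fun n x =>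
    (norm_indicator_le_norm_self _ _).trans (by simp)
  have hP : ∀ (n : ℕ) ψ, C.HasVal ({x : ℝ | |x| ≤ n}.indicator 1) ψ (C.proj {x : ℝ | |x| ≤ n} ψ) :=
    fun n ψ => hasVal_proj (hs n) ψ
  have hdom : ∀ n : ℕ, ∃ h : C.proj {x : ℝ | |x| ≤ n} (u : 𝓗) ∈ H.domain,
      H ⟨_, h⟩ = C.proj {x : ℝ | |x| ≤ n} (H u) := fun n =>
    apply_eq_of_hasVal hH ((hasVal_self hH u).commute Complex.measurable_ofReal (hind n)
      (hP n _) (hP n _))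
  choose hdm hde using hdom
  have hφn : ∀ n : ℕ, H ⟨_, hdm n⟩ - Complex.I • C.proj {x : ℝ | |x| ≤ n} (u : 𝓗)
      = C.proj {x : ℝ | |x| ≤ n} φ := fun n => by rw [hde, hφ, map_sub, map_smul]
  have hproj : ∀ (n : ℕ) (ψ : 𝓗), ‖C.proj {x : ℝ | |x| ≤ n} ψ‖ ≤ ‖ψ‖ := fun n ψ =>
    ((hP n ψ).norm_le (ae_of_all _ (hle n)) zero_le_one).trans_eq (one_mul _)
  have hlim : Tendsto (fun n : ℕ => C.proj {x : ℝ | |x| ≤ n} φ) atTop (𝓝 φ) := by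
    refine (hasVal_one φ).tendsto (Eventually.of_forall fun n => hP n φ) (g := fun _ => 2)
      (memLp_const _) (Eventually.of_forall fun n x => ?_) fun x => ?_
    · refine (norm_sub_le _ _).trans ((add_le_add (hle n x) le_rfl).trans ?_)
      norm_num
    · refine tendsto_const_nhds.congr' ?_
      filter_upwards [eventually_ge_atTop ⌈|x|⌉₊] with n hn
      rw [Set.indicator_of_mem (by exact Nat.ceil_le.mp hn)]
  have hsupp : ∀ n : ℕ, ∀ᵐ x : ℝ ∂C.μ (C.proj {x : ℝ | |x| ≤ n} φ), |x| ≤ n := fun n => by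
    have h1 := (hP n φ).comp (hasVal_proj (C := C) (hs n).compl _) (measurable_one.indicator (hs n).compl)
    rw [← Set.inter_indicator_one, Set.compl_inter_self, Set.indicator_empty'] at h1
    have h2 := enorm_proj_sq (C := C) (hs n).compl (C.proj {x : ℝ | |x| ≤ n} φ)
    have h3 := h1.enorm_eq
    rw [eLpNorm_zero] at h3
    rw [h3, zero_pow two_ne_zero] at h2
    exact h2.symm
  have hbd : ∀ n : ℕ, ∫ t in (-T)..T, ‖M (evol H t (C.proj {x : ℝ | |x| ≤ n} φ))‖ ^ 2
      ≤ 2 * a ^ 2 * ‖(u : 𝓗)‖ ^ 2 := fun n => by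
    have h1 := integral_smooth_le_of_ae_abs_le hH hB hD hM hT ⟨_, hdm n⟩ (N := n)
      (by rw [hφn]; exact hsupp n)
    rw [hφn] at h1
    refine h1.trans ?_
    gcongr
    exact hproj n _
  refine le_of_tendsto (x := atTop) (intervalIntegral.tendsto_integral_filter_of_dominated_convergence
    (fun _ => (‖M‖ * ‖φ‖) ^ 2) (Eventually.of_forall fun n => ?_) (Eventually.of_forall fun n => ?_)
    intervalIntegrable_const ?_) (Eventually.of_forall hbd)
  · exact (((M.continuous.comp (continuous_evol hH _)).norm.pow 2)).aestronglyMeasurable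
  · refine ae_of_all _ fun t _ => ?_
    rw [norm_pow, norm_norm]
    gcongr
    refine (M.le_opNorm _).trans ?_
    rw [norm_evol hH]
    gcongr
    exact hproj n φ
  · refine ae_of_all _ fun t _ => ?_
    exact ((((M.comp (evol H t)).continuous.tendsto _).comp hlim).norm.pow 2)

end SpectralCalc

/-! ### The Christ–Kiselev argument and localization in time -/

open MeasureTheory Filter Topology
open scoped ENNReal

namespace SpectralCalc

section Bisection

/-- One step of the Christ–Kiselev argument: halving the mass of `β` improves the constant. -/
theorem norm_le_of_bisection {E : Type*} [NormedAddCommGroup E] {K : ℝ → ℝ → E} {α β : ℝ → ℝ}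
    {l r σ D A : ℝ} (hα : MonotoneOn α (Set.Icc l r)) (hβ : MonotoneOn β (Set.Icc l r))
    (hβc : ContinuousOn β (Set.Icc l r)) (hσ : 0 ≤ σ) (hD : 0 ≤ D) (hA : 0 ≤ A)
    (hsplit : ∀ a m b, l ≤ a → a ≤ m → m ≤ b → b ≤ r →
      ‖K a b‖ ≤ ‖K a m‖ + ‖K m b‖ + D * √(α m - α a) * (β b - β m) ^ σ)
    (hK : ∀ a b, l ≤ a → a ≤ b → b ≤ r → ‖K a b‖ ≤ A * √(α b - α a) * (β b - β a) ^ σ)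
    {a b : ℝ} (hla : l ≤ a) (hab : a ≤ b) (hbr : b ≤ r) :
    ‖K a b‖ ≤ (2 ^ (1 / 2 - σ) * A + D) * √(α b - α a) * (β b - β a) ^ σ := by
  have ha : a ∈ Set.Icc l r := ⟨hla, hab.trans hbr⟩
  have hb : b ∈ Set.Icc l r := ⟨hla.trans hab, hbr⟩
  have hβab := hβ ha hb hab
  -- Bisect the mass of β, not the interval: each half gains 2^{-σ}, while concavity of the square
  -- root loses only 2^{1/2} on the sum of the α factors.
  obtain ⟨m, hm, hmβ⟩ : (β a + β b) / 2 ∈ β '' Set.Icc a b :=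
    intermediate_value_Icc hab (hβc.mono (Set.Icc_subset_Icc hla hbr)) ⟨by linarith, by linarith⟩
  have hm' : m ∈ Set.Icc l r := ⟨hla.trans hm.1, hm.2.trans hbr⟩
  have h1 := hsplit a m b hla hm.1 hm.2 hbr
  have h2 := hK a m hla hm.1 hm'.2
  have h3 := hK m b hm'.1 hm.2 hbr
  have e1 : β m - β a = (β b - β a) / 2 := by rw [hmβ]; ring
  have e2 : β b - β m = (β b - β a) / 2 := by rw [hmβ]; ring
  have hx := sub_nonneg.mpr (hα ha hm' hm.1)
  have hy := sub_nonneg.mpr (hα hm' hb hm.2)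
  set x := α m - α a
  set y := α b - α m
  have hxy : α b - α a = x + y := by simp only [x, y]; ring
  have hg : 0 ≤ (β b - β a) ^ σ := Real.rpow_nonneg (sub_nonneg.mpr hβab) σ
  rw [e2, Real.div_rpow (sub_nonneg.mpr hβab) zero_le_two] at h1 h3
  rw [e1, Real.div_rpow (sub_nonneg.mpr hβab) zero_le_two] at h2
  rw [hxy]
  set g := (β b - β a) ^ σ
  have hs : √x + √y ≤ √2 * √(x + y) := by
    rw [← Real.sqrt_mul zero_le_two]
    refine Real.le_sqrt_of_sq_le ?_
    nlinarith [Real.sq_sqrt hx, Real.sq_sqrt hy, sq_nonneg (√x - √y)]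
  have hsx : √x ≤ √(x + y) := Real.sqrt_le_sqrt (by linarith)
  have h2σ : (1 : ℝ) ≤ 2 ^ σ := Real.one_le_rpow one_le_two hσ
  have hrσ : (2 : ℝ) ^ (1 / 2 - σ) = √2 / 2 ^ σ := by
    rw [Real.rpow_sub two_pos, Real.sqrt_eq_rpow]
  rw [hrσ]
  calc ‖K a b‖ ≤ A * √x * (g / 2 ^ σ) + A * √y * (g / 2 ^ σ) + D * √x * (g / 2 ^ σ) := by linarith
    _ = A * (√x + √y) * (g / 2 ^ σ) + D * √x * (g / 2 ^ σ) := by ring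
    _ ≤ A * (√2 * √(x + y)) * (g / 2 ^ σ) + D * √(x + y) * (g / 1) := by gcongr
    _ = _ := by ring

/-- The **Christ–Kiselev lemma** in the form of a bisection argument. -/
theorem norm_le_of_christKiselev {E : Type*} [NormedAddCommGroup E] {K : ℝ → ℝ → E} {α β : ℝ → ℝ}
    {l r σ D A : ℝ} (hα : MonotoneOn α (Set.Icc l r)) (hβ : MonotoneOn β (Set.Icc l r))
    (hβc : ContinuousOn β (Set.Icc l r)) (hσ : 1 / 2 < σ) (hD : 0 ≤ D) (hA : 0 ≤ A)
    (hsplit : ∀ a m b, l ≤ a → a ≤ m → m ≤ b → b ≤ r →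
      ‖K a b‖ ≤ ‖K a m‖ + ‖K m b‖ + D * √(α m - α a) * (β b - β m) ^ σ)
    (hK : ∀ a b, l ≤ a → a ≤ b → b ≤ r → ‖K a b‖ ≤ A * √(α b - α a) * (β b - β a) ^ σ)
    (hlr : l ≤ r) :
    ‖K l r‖ ≤ D * (1 - 2 ^ (1 / 2 - σ))⁻¹ * √(α r - α l) * (β r - β l) ^ σ := by
  set ρ : ℝ := 2 ^ (1 / 2 - σ) with hρ
  have hρ0 : 0 < ρ := by positivity
  have hρ1 : ρ < 1 := Real.rpow_lt_one_of_one_lt_of_neg one_lt_two (by linarith)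
  have hρ2 : 0 < 1 - ρ := by linarith
  -- D(1 - ρ)⁻¹ is the fixed point of A ↦ ρA + D, so only the contribution ρⁿA of the a priori
  -- constant remains to vanish.
  have key : ∀ n : ℕ, ∀ a b, l ≤ a → a ≤ b → b ≤ r →
      ‖K a b‖ ≤ (ρ ^ n * A + D * (1 - ρ)⁻¹) * √(α b - α a) * (β b - β a) ^ σ := by
    intro n
    induction n with
    | zero =>
      intro a b h1 h2 h3
      refine (hK a b h1 h2 h3).trans ?_
      have hg : 0 ≤ (β b - β a) ^ σ := Real.rpow_nonneg (sub_nonneg.mpr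
        (hβ ⟨h1, h2.trans h3⟩ ⟨h1.trans h2, h3⟩ h2)) σ
      have : 0 ≤ D * (1 - ρ)⁻¹ := by positivity
      gcongr
      linarith
    | succ n ih =>
      intro a b h1 h2 h3
      refine (norm_le_of_bisection hα hβ hβc (by linarith) hD (by positivity) hsplit ih h1 h2 h3).trans_eq ?_
      rw [← hρ]
      congr 2
      field_simp
      ring
  have hlim : Tendsto (fun n : ℕ => (ρ ^ n * A + D * (1 - ρ)⁻¹) * √(α r - α l) * (β r - β l) ^ σ)
      atTop (𝓝 ((0 * A + D * (1 - ρ)⁻¹) * √(α r - α l) * (β r - β l) ^ σ)) :=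
    (((((tendsto_pow_atTop_nhds_zero_of_lt_one hρ0.le hρ1).mul_const A).add_const _).mul_const
      _).mul_const _)
  rw [zero_mul, zero_add] at hlim
  exact ge_of_tendsto' hlim fun n => key n l r le_rfl hlr le_rfl

theorem abs_integral_mul_le_sqrt {f g : ℝ → ℝ} (hf : Continuous f) (hg : Continuous g) {a b : ℝ}
    (hab : a ≤ b) (hf0 : ∀ t, 0 ≤ f t) (hg0 : ∀ t, 0 ≤ g t) :
    ∫ t in a..b, f t * g t ≤ √(∫ t in a..b, f t ^ 2) * √(∫ t in a..b, g t ^ 2) := by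
  have hm : ∀ h : ℝ → ℝ, Continuous h →
      MemLp h (ENNReal.ofReal 2) (volume.restrict (Set.Ioc a b)) := by
    intro h hh
    obtain ⟨K, hK⟩ := (isCompact_Icc (a := a) (b := b)).exists_bound_of_continuousOn hh.continuousOn
    exact MemLp.of_bound hh.aestronglyMeasurable K ((ae_restrict_iff' measurableSet_Ioc).mpr
      (ae_of_all _ fun t ht => hK t (Set.Ioc_subset_Icc_self ht)))
  simp only [intervalIntegral.integral_of_le hab]
  have := integral_mul_le_Lp_mul_Lq_of_nonneg Real.HolderConjugate.two_two
    (ae_of_all (volume.restrict (Set.Ioc a b)) hf0) (ae_of_all _ hg0) (hm f hf) (hm g hg)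
  simpa [Real.sqrt_eq_rpow] using this

end Bisection

theorem timeNorm_nonneg {𝓗 𝓑 : Type*} [NormedAddCommGroup 𝓑] {S : Set (𝓗 × 𝓑)} (T q : ℝ) (hT : 0 ≤ T) (G : SimpleFunc ℝ S) : 0 ≤ timeNorm T q G :=
  Real.rpow_nonneg (intervalIntegral.integral_nonneg (by linarith)
    fun t _ => Real.rpow_nonneg (norm_nonneg _) _) _

/-- A simple function has finitely many values, and a value vanishing in 𝓑 vanishes in 𝓗. The
constant depends on G and only supplies the qualitative bound that starts the bisection. -/
theorem exists_norm_le_mul_norm_rpow {𝓗 𝓑 : Type*} [NormedAddCommGroup 𝓗]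
    [NormedAddCommGroup 𝓑] {S : Set (𝓗 × 𝓑)} (hS : ∀ x ∈ S, x.2 = 0 → x.1 = 0)
    (G : SimpleFunc ℝ S) (q : ℝ) :
    ∃ K : ℝ, 0 ≤ K ∧ ∀ t, ‖(G t).1.1‖ ≤ K * ‖(G t).1.2‖ ^ q := by
  obtain ⟨K, hK⟩ := (G.map fun x => ‖x.1.1‖ / ‖x.1.2‖ ^ q).exists_forall_norm_le
  refine ⟨K, (norm_nonneg _).trans (hK 0), fun t => ?_⟩
  by_cases h : (G t).1.2 = 0
  · rw [hS _ (G t).2 h, norm_zero]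
    exact mul_nonneg ((norm_nonneg _).trans (hK 0)) (Real.rpow_nonneg (norm_nonneg _) _)
  · rw [← div_le_iff₀ (Real.rpow_pos_of_pos (norm_pos_iff.mpr h) _)]
    exact (le_abs_self _).trans (hK t)

theorem intervalIntegrable_inner_simpleFunc {𝓗 𝓑 : Type*} [NormedAddCommGroup 𝓗]
    [InnerProductSpace ℂ 𝓗] {S : Set (𝓗 × 𝓑)} {E : ℝ → 𝓗} (hE : Continuous E) (G : SimpleFunc ℝ S)
    (a b : ℝ) : IntervalIntegrable (fun t => inner ℂ (E t) (G t).1.1) volume a b := by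
  obtain ⟨K, hK⟩ := (G.map fun x : S => x.1.1).exists_forall_norm_le
  refine IntervalIntegrable.mono_fun' (g := fun t => ‖E t‖ * K)
    (Continuous.intervalIntegrable (by fun_prop) _ _) ?_ (ae_of_all _ fun t => ?_)
  · exact hE.aestronglyMeasurable.inner (G.map fun x : S => x.1.1).aestronglyMeasurable
  · refine (norm_inner_le_norm _ _).trans ?_
    exact mul_le_mul_of_nonneg_left (hK t) (norm_nonneg _)

theorem intervalIntegrable_norm_rpow {𝓗 𝓑 : Type*} [NormedAddCommGroup 𝓑] {S : Set (𝓗 × 𝓑)}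
    (G : SimpleFunc ℝ S) (q a b : ℝ) :
    IntervalIntegrable (fun t => ‖(G t).1.2‖ ^ q) volume a b := by
  obtain ⟨K, hK⟩ := (G.map fun x : S => ‖x.1.2‖ ^ q).exists_forall_norm_le
  exact IntervalIntegrable.mono_fun' (intervalIntegrable_const (c := K))
    (G.map fun x : S => ‖x.1.2‖ ^ q).aestronglyMeasurable (ae_of_all _ hK)

theorem integral_inner_eq_of_Ioc_subset {T a b : ℝ} (hTa : -T ≤ a) (hab : a ≤ b) (hbT : b ≤ T)
    {F : Type*} [NormedAddCommGroup F] [NormedSpace ℝ F] (f : ℝ → F) :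
    ∫ t in (-T)..T, (Set.Ioc a b).indicator f t = ∫ t in a..b, f t := by
  rw [intervalIntegral.integral_of_le (by linarith), intervalIntegral.integral_of_le hab,
    setIntegral_indicator measurableSet_Ioc, Set.inter_eq_right.mpr (Set.Ioc_subset_Ioc hTa hbT)]

/-- An estimate for all simple functions localizes to subintervals. -/
theorem norm_integral_inner_le_of_pairing {𝓗 𝓑 : Type*} [NormedAddCommGroup 𝓗]
    [InnerProductSpace ℂ 𝓗] [NormedAddCommGroup 𝓑] {S : Set (𝓗 × 𝓑)} {T q s₁ : ℝ} {F : ℝ → 𝓗} (hq : q ≠ 0) (h0 : (0 : 𝓗 × 𝓑) ∈ S)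
    (h : ∀ G : SimpleFunc ℝ S, ‖pairing T F G‖ ≤ s₁ * timeNorm T q G) (G : SimpleFunc ℝ S) {a b : ℝ}
    (hTa : -T ≤ a) (hab : a ≤ b) (hbT : b ≤ T) :
    ‖∫ t in a..b, inner ℂ (F t) (G t).1.1‖ ≤ s₁ * (∫ t in a..b, ‖(G t).1.2‖ ^ q) ^ (1 / q) := by
  classical
  set G' : SimpleFunc ℝ S :=
    SimpleFunc.piecewise (Set.Ioc a b) measurableSet_Ioc G (SimpleFunc.const ℝ ⟨0, h0⟩) with hG'
  have h1 := h G'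
  have e1 : pairing T F G' = ∫ t in a..b, inner ℂ (F t) (G t).1.1 := by
    rw [pairing, ← integral_inner_eq_of_Ioc_subset hTa hab hbT]
    congr 1
    funext t
    by_cases ht : t ∈ Set.Ioc a b
    · rw [Set.indicator_of_mem ht, hG', SimpleFunc.piecewise_apply, if_pos ht]
    · rw [Set.indicator_of_notMem ht, hG', SimpleFunc.piecewise_apply, if_neg ht]
      simp
  have e2 : timeNorm T q G' = (∫ t in a..b, ‖(G t).1.2‖ ^ q) ^ (1 / q) := by
    rw [timeNorm, ← integral_inner_eq_of_Ioc_subset hTa hab hbT]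
    congr 2
    funext t
    by_cases ht : t ∈ Set.Ioc a b
    · rw [Set.indicator_of_mem ht, hG', SimpleFunc.piecewise_apply, if_pos ht]
    · rw [Set.indicator_of_notMem ht, hG', SimpleFunc.piecewise_apply, if_neg ht]
      simp [Real.zero_rpow hq]
  rwa [e1, e2] at h1

end SpectralCalc

/-! ### Duhamel's formula and the perturbative term -/

open MeasureTheory Filter Topology
open scoped ENNReal

namespace SpectralCalc

theorem norm_le_of_dense {𝓗 : Type*} [NormedAddCommGroup 𝓗] [InnerProductSpace ℂ 𝓗]
    {s : Set 𝓗} (hs : Dense s) {v : 𝓗} {C : ℝ} (hC : 0 ≤ C)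
    (h : ∀ g ∈ s, ‖inner ℂ v g‖ ≤ C * ‖g‖) : ‖v‖ ≤ C := by
  have hcl : IsClosed {g : 𝓗 | ‖inner ℂ v g‖ ≤ C * ‖g‖} :=
    isClosed_le (by fun_prop) (by fun_prop)
  have hv : ‖inner ℂ v v‖ ≤ C * ‖v‖ := hcl.closure_subset_iff.mpr h (hs v)
  rcases (norm_nonneg v).eq_or_lt with h0 | hp
  · rwa [← h0]
  · rw [inner_self_eq_norm_sq_to_K] at hv
    simp only [norm_pow, Complex.coe_algebraMap, Complex.norm_real, norm_norm] at hv
    nlinarith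

variable {𝓗 : Type*} [NormedAddCommGroup 𝓗] [InnerProductSpace ℂ 𝓗] [CompleteSpace 𝓗]
  {H₀ H Y Z : 𝓗 →ₗ.[ℂ] 𝓗}

theorem factor_evol {B : 𝓗 →ₗ.[ℂ] 𝓗} (hH : IsSelfAdjoint H) (hD : H.domain ≤ B.domain)
    {M : 𝓗 →L[ℂ] 𝓗} (hM : ∀ u : H.domain, B ⟨u, hD u.2⟩ = M (H u - Complex.I • (u : 𝓗)))
    (u : H.domain) (t : ℝ) (h : evol H t (u : 𝓗) ∈ H.domain) :
    B ⟨evol H t (u : 𝓗), hD h⟩ = M (evol H t (H u - Complex.I • (u : 𝓗))) := by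
  obtain ⟨h', he⟩ := evol_mem_domain hH t u
  have := hM ⟨_, h⟩
  rw [this, he, map_sub (evol H t), map_smul (evol H t)]

/-- Duhamel's formula for `e^{isH₀} e^{-isH} f`, tested against the domain of `H₀`. -/
theorem inner_interaction_sub (hH₀ : IsSelfAdjoint H₀) (hH : IsSelfAdjoint H)
    (h₀Y : H₀.domain ≤ Y.domain) (hZ : H.domain ≤ Z.domain)
    (hfac : ∀ (f : H.domain) (g : H₀.domain), inner ℂ (H f) (g : 𝓗) = inner ℂ (f : 𝓗) (H₀ g)
        + inner ℂ (Z ⟨f, hZ f.2⟩) (Y ⟨g, h₀Y g.2⟩))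
    {M : 𝓗 →L[ℂ] 𝓗} (hM : ∀ u : H₀.domain, Y ⟨u, h₀Y u.2⟩ = M (H₀ u - Complex.I • (u : 𝓗)))
    {F : ℝ → 𝓗} (hFc : Continuous F) (f : H.domain)
    (hF : ∀ s (h : evol H s (f : 𝓗) ∈ H.domain), Z ⟨evol H s (f : 𝓗), hZ h⟩ = F s)
    (g : H₀.domain) (a m : ℝ) :
    inner ℂ (evol H₀ (-m) (evol H m (f : 𝓗)) - evol H₀ (-a) (evol H a (f : 𝓗))) (g : 𝓗)
      = ∫ s in a..m, Complex.I *
          inner ℂ (F s) (M (evol H₀ s (H₀ g - Complex.I • (g : 𝓗)))) := by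
  rw [inner_sub_left, inner_evol hH₀, inner_evol hH₀]
  refine (intervalIntegral.integral_eq_sub_of_hasDerivAt
    (f := fun s => inner ℂ (evol H s (f : 𝓗)) (evol H₀ s (g : 𝓗))) (fun s _ => ?_) ?_).symm
  · obtain ⟨hf, hfe⟩ := evol_mem_domain hH s f
    obtain ⟨hg, hge⟩ := evol_mem_domain hH₀ s g
    refine ((hasDerivAt_evol hH f s).inner ℂ (hasDerivAt_evol hH₀ g s)).congr_deriv ?_
    -- The inner product is conjugate linear on the left, so the derivative is i(⟨Hf, g⟩ - ⟨f, H₀g⟩)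
    -- at the evolved vectors, which the factorization reduces to i⟨Zf, Yg⟩.
    have h1 := hfac ⟨_, hf⟩ ⟨_, hg⟩
    simp only [hF s hf, factor_evol hH₀ h₀Y hM g s hg, hfe, hge] at h1
    rw [inner_smul_left, inner_smul_right, h1]
    simp
    ring
  · have := continuous_evol hH₀ (H₀ g - Complex.I • (g : 𝓗))
    exact Continuous.intervalIntegrable (by fun_prop) _ _

theorem norm_interaction_sub_le (hH₀ : IsSelfAdjoint H₀) (hH : IsSelfAdjoint H)
    (h₀Y : H₀.domain ≤ Y.domain) (hZ : H.domain ≤ Z.domain)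
    (hfac : ∀ (f : H.domain) (g : H₀.domain), inner ℂ (H f) (g : 𝓗) = inner ℂ (f : 𝓗) (H₀ g)
        + inner ℂ (Z ⟨f, hZ f.2⟩) (Y ⟨g, h₀Y g.2⟩))
    {s₂ : ℝ} (hs₂ : 0 ≤ s₂) (hY : IsSmoothWithBound H₀ Y s₂)
    {F : ℝ → 𝓗} (hFc : Continuous F) (f : H.domain)
    (hF : ∀ s (h : evol H s (f : 𝓗) ∈ H.domain), Z ⟨evol H s (f : 𝓗), hZ h⟩ = F s)
    {T a m : ℝ} (hT : 0 < T) (ha : -T ≤ a) (ham : a ≤ m) (hm : m ≤ T) :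
    ‖evol H₀ (-m) (evol H m (f : 𝓗)) - evol H₀ (-a) (evol H a (f : 𝓗))‖
      ≤ √2 * s₂ * √(∫ s in a..m, ‖F s‖ ^ 2) := by
  obtain ⟨M, hM⟩ := exists_bounded_factor hH₀ hY.2.1 h₀Y
  refine norm_le_of_dense hH₀.dense_domain (by positivity) fun g hg => ?_
  have hc := continuous_evol hH₀ (H₀ ⟨g, hg⟩ - Complex.I • g)
  have h1 := inner_interaction_sub hH₀ hH h₀Y hZ hfac hM hFc f hF ⟨g, hg⟩ a m
  have h2 := integral_smooth_le hH₀ hY h₀Y hM hT ⟨g, hg⟩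
  have h3 : ∫ t in a..m, ‖M (evol H₀ t (H₀ ⟨g, hg⟩ - Complex.I • g))‖ ^ 2 ≤ 2 * s₂ ^ 2 * ‖g‖ ^ 2 := by
    refine le_trans ?_ h2
    exact intervalIntegral.integral_mono_interval ha ham hm (ae_of_all _ fun t => by positivity)
      (Continuous.intervalIntegrable (by fun_prop) _ _)
  simp only at h1
  rw [h1]
  calc ‖∫ s in a..m, Complex.I * inner ℂ (F s) (M (evol H₀ s (H₀ ⟨g, hg⟩ - Complex.I • g)))‖
      ≤ ∫ s in a..m, ‖F s‖ * ‖M (evol H₀ s (H₀ ⟨g, hg⟩ - Complex.I • g))‖ := by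
        refine intervalIntegral.norm_integral_le_of_norm_le ham (ae_of_all _ fun t _ => ?_)
          (Continuous.intervalIntegrable (by fun_prop) _ _)
        rw [norm_mul, Complex.norm_I, one_mul]
        exact norm_inner_le_norm _ _
    _ ≤ √(∫ s in a..m, ‖F s‖ ^ 2) *
          √(∫ s in a..m, ‖M (evol H₀ s (H₀ ⟨g, hg⟩ - Complex.I • g))‖ ^ 2) :=
        abs_integral_mul_le_sqrt hFc.norm (by fun_prop) ham (fun _ => norm_nonneg _)
          fun _ => norm_nonneg _
    _ ≤ √(∫ s in a..m, ‖F s‖ ^ 2) * √(2 * s₂ ^ 2 * ‖g‖ ^ 2) := by gcongr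
    _ = _ := by
      rw [Real.sqrt_mul (by positivity), Real.sqrt_mul zero_le_two, Real.sqrt_sq hs₂,
        Real.sqrt_sq (norm_nonneg _)]
      ring

/-- The pairing K(a, b) with the deviation from the free evolution started at a is additive up to a
free evolution of c(m) - c(a) on [m, b]. The free estimate bounds that term by a quantity on [a, m]
times one on [m, b], the form needed for Christ–Kiselev. -/
theorem norm_integral_inner_sub_le {𝓑 : Type*} [NormedAddCommGroup 𝓑] {S : Set (𝓗 × 𝓑)}
    (h0 : (0 : 𝓗 × 𝓑) ∈ S) (hS : ∀ x ∈ S, x.2 = 0 → x.1 = 0) (hH₀ : IsSelfAdjoint H₀)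
    {T q s₁ D : ℝ} (hT : 0 < T) (hq1 : 1 ≤ q) (hq : q < 2) (hs₁ : 0 ≤ s₁) (hD : 0 ≤ D)
    (hS1 : ∀ (ψ : 𝓗) (G : SimpleFunc ℝ S),
      ‖pairing T (fun t => evol H₀ t ψ) G‖ ≤ s₁ * ‖ψ‖ * timeNorm T q G)
    {e c F : ℝ → 𝓗} (he : Continuous e) (hF : Continuous F) (hec : ∀ t, e t = evol H₀ t (c t))
    (hc : ∀ a m, -T ≤ a → a ≤ m → m ≤ T → ‖c m - c a‖ ≤ D * √(∫ s in a..m, ‖F s‖ ^ 2))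
    (G : SimpleFunc ℝ S) :
    ‖∫ t in (-T)..T, inner ℂ (e t - evol H₀ t (c (-T))) (G t).1.1‖
      ≤ s₁ * D * (1 - 2 ^ (1 / 2 - 1 / q))⁻¹ * √(∫ s in (-T)..T, ‖F s‖ ^ 2) * timeNorm T q G := by
  have hq0 : 0 < q := by linarith
  have hFi : ∀ a b, IntervalIntegrable (fun s => ‖F s‖ ^ 2) volume a b := fun a b =>
    Continuous.intervalIntegrable (by fun_prop) _ _
  have hGi := intervalIntegrable_norm_rpow G q
  have hEi : ∀ x a b, IntervalIntegrable
      (fun t => inner ℂ (e t - evol H₀ t x) (G t).1.1) volume a b := fun x a b =>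
    intervalIntegrable_inner_simpleFunc (he.sub (continuous_evol hH₀ x)) G a b
  set α : ℝ → ℝ := fun t => ∫ s in (-T)..t, ‖F s‖ ^ 2 with hα
  set β : ℝ → ℝ := fun t => ∫ s in (-T)..t, ‖(G s).1.2‖ ^ q with hβ
  have hαs : ∀ a b, α b - α a = ∫ s in a..b, ‖F s‖ ^ 2 := fun a b =>
    intervalIntegral.integral_interval_sub_left (hFi _ _) (hFi _ _)
  have hβs : ∀ a b, β b - β a = ∫ s in a..b, ‖(G s).1.2‖ ^ q := fun a b =>
    intervalIntegral.integral_interval_sub_left (hGi _ _) (hGi _ _)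
  have hαm : Monotone α := fun a b hab => by
    rw [← sub_nonneg, hαs]
    exact intervalIntegral.integral_nonneg hab fun _ _ => by positivity
  have hβm : Monotone β := fun a b hab => by
    rw [← sub_nonneg, hβs]
    exact intervalIntegral.integral_nonneg hab fun _ _ => by positivity
  have hβc : Continuous β := intervalIntegral.continuous_primitive hGi _
  obtain ⟨N, hN, hGN⟩ := exists_norm_le_mul_norm_rpow hS G q
  have hσ : 1 / 2 < 1 / q := one_div_lt_one_div_of_lt hq0 hq
  have hσ1 : 0 < 1 / q := by positivity
  have key := norm_le_of_christKiselev
    (K := fun a b => ∫ t in a..b, inner ℂ (e t - evol H₀ t (c a)) (G t).1.1)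
    (α := α) (β := β) (l := -T) (r := T) (σ := 1 / q) (D := s₁ * D)
    -- The a priori constant, from pointwise bounds on G; it is 0 by the division convention when G
    -- has no mass.
    (A := D * N * (β T - β (-T)) / (β T - β (-T)) ^ (1 / q))
    (hαm.monotoneOn _) (hβm.monotoneOn _) hβc.continuousOn hσ (by positivity) ?_ ?_ ?_ (by linarith)
  · rw [hαs, hβs] at key
    exact key
  · have : 0 ≤ β T - β (-T) := sub_nonneg.mpr (hβm (by linarith))
    positivity
  · intro a m b ha ham hmb hb
    have e1 : ∫ t in a..b, inner ℂ (e t - evol H₀ t (c a)) (G t).1.1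
        = (∫ t in a..m, inner ℂ (e t - evol H₀ t (c a)) (G t).1.1)
          + ((∫ t in m..b, inner ℂ (e t - evol H₀ t (c m)) (G t).1.1)
          + ∫ t in m..b, inner ℂ (evol H₀ t (c m - c a)) (G t).1.1) := by
      rw [← intervalIntegral.integral_add_adjacent_intervals (hEi _ a m) (hEi _ m b),
        ← intervalIntegral.integral_add (hEi _ _ _)
          (intervalIntegrable_inner_simpleFunc (continuous_evol hH₀ _) G _ _)]
      congr 2
      funext t
      rw [← inner_add_left, map_sub]
      congr 1
      abel
    have e2 := norm_integral_inner_le_of_pairing hq0.ne' h0 (s₁ := s₁ * ‖c m - c a‖)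
      (fun G => hS1 (c m - c a) G) G (ha.trans ham) hmb hb
    rw [e1]
    refine (norm_add_le _ _).trans ?_
    rw [add_assoc]
    gcongr
    refine (norm_add_le _ _).trans ?_
    gcongr
    refine e2.trans ?_
    rw [hαs, hβs]
    refine mul_le_mul_of_nonneg_right ?_ (Real.rpow_nonneg (intervalIntegral.integral_nonneg hmb
      fun _ _ => by positivity) _)
    rw [mul_assoc]
    exact mul_le_mul_of_nonneg_left (hc a m ha ham (hmb.trans hb)) hs₁
  · intro a b ha hab hb
    have e1 : ‖∫ t in a..b, inner ℂ (e t - evol H₀ t (c a)) (G t).1.1‖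
        ≤ ∫ t in a..b, D * √(α b - α a) * N * ‖(G t).1.2‖ ^ q := by
      refine intervalIntegral.norm_integral_le_of_norm_le hab (ae_of_all _ fun t ht => ?_)
        ((hGi _ _).const_mul _)
      have h1 : ‖e t - evol H₀ t (c a)‖ ≤ D * √(α b - α a) := by
        rw [hec, ← map_sub, norm_evol hH₀]
        refine (hc a t ha ht.1.le (ht.2.trans hb)).trans ?_
        rw [← hαs]
        have := hαm ht.2
        gcongr
      calc _ ≤ ‖e t - evol H₀ t (c a)‖ * ‖(G t).1.1‖ := norm_inner_le_norm _ _
        _ ≤ (D * √(α b - α a)) * (N * ‖(G t).1.2‖ ^ q) := by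
          gcongr
          exact hGN t
        _ = _ := by ring
    refine e1.trans ?_
    rw [intervalIntegral.integral_const_mul, ← hβs]
    have hx : 0 ≤ β b - β a := sub_nonneg.mpr (hβm hab)
    have hxB : β b - β a ≤ β T - β (-T) := sub_le_sub (hβm hb) (hβm ha)
    set x := β b - β a
    set B := β T - β (-T)
    -- Since x/B ≤ 1 and 1/q ≤ 1, x/B ≤ (x/B)^{1/q}. This trades the full power of the mass for the
    -- power 1/q.
    have hxx : x ≤ B / B ^ (1 / q) * x ^ (1 / q) := by
      rcases (hx.trans hxB).eq_or_lt with hB | hB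
      · rw [← hB] at hxB ⊢
        simpa using hxB
      · have := Real.self_le_rpow_of_le_one (div_nonneg hx hB.le) ((div_le_one hB).mpr hxB)
          ((div_le_one hq0).mpr hq1)
        rw [Real.div_rpow hx hB.le, div_le_iff₀ hB] at this
        exact this.trans_eq (by ring)
    calc D * √(α b - α a) * N * x ≤ D * √(α b - α a) * N * (B / B ^ (1 / q) * x ^ (1 / q)) := by
          gcongr
      _ = _ := by ring

end SpectralCalc

/-! ### Assembling the estimate -/

open MeasureTheory Filter Topology
open scoped ENNReal

namespace SpectralCalc

/-- The pairing depends continuously on the parameter `x`. -/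
theorem continuous_pairing {X 𝓗 𝓑 : Type*} [NormedAddCommGroup 𝓗] [InnerProductSpace ℂ 𝓗]
    [NormedAddCommGroup X] [NormedSpace ℂ X] {S : Set (𝓗 × 𝓑)} {T K : ℝ} {A : ℝ → X →L[ℂ] 𝓗}
    (hA : ∀ x, Continuous fun t => A t x) (hK : ∀ t x, ‖A t x‖ ≤ K * ‖x‖) (G : SimpleFunc ℝ S) :
    Continuous fun x => pairing T (fun t => A t x) G := by
  obtain ⟨N, hN⟩ := (G.map fun x : S => x.1.1).exists_forall_norm_le
  refine continuous_iff_continuousAt.mpr fun x₀ => ?_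
  refine intervalIntegral.continuousAt_of_dominated_interval (bound := fun _ => |K| * (‖x₀‖ + 1) * N)
    (Eventually.of_forall fun x =>
      (intervalIntegrable_inner_simpleFunc (hA x) G _ _).def'.aestronglyMeasurable)
    ?_ intervalIntegrable_const (ae_of_all _ fun t _ => by fun_prop)
  filter_upwards [Metric.ball_mem_nhds x₀ one_pos] with x hx
  have hx1 : ‖x‖ ≤ ‖x₀‖ + 1 := by
    have := norm_le_norm_add_norm_sub x₀ x
    rw [mem_ball_iff_norm'] at hx
    linarith
  refine ae_of_all _ fun t _ => (norm_inner_le_norm _ _).trans ?_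
  have h1 : ‖A t x‖ ≤ |K| * (‖x₀‖ + 1) := (hK t x).trans
    (mul_le_mul (le_abs_self K) hx1 (norm_nonneg _) (abs_nonneg _))
  exact mul_le_mul h1 (hN t) (norm_nonneg _) (by positivity)

variable {𝓗 : Type*} [NormedAddCommGroup 𝓗] [InnerProductSpace ℂ 𝓗] [CompleteSpace 𝓗]
  {H₀ H Y Z : 𝓗 →ₗ.[ℂ] 𝓗}

/-- Both sides are continuous in ψ, so ψ may be taken in D(H), where Duhamel and the smoothing
estimates apply. The constant 2 is the product of the two factors √2 lost in the smoothing estimates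
for Y and for Z b(H). -/
theorem norm_pairing_evol_le {𝓑 : Type*} [NormedAddCommGroup 𝓑] {S : Set (𝓗 × 𝓑)}
    (h0 : (0 : 𝓗 × 𝓑) ∈ S) (hS : ∀ x ∈ S, x.2 = 0 → x.1 = 0)
    (hH₀ : IsSelfAdjoint H₀) (hH : IsSelfAdjoint H) (hfac : IsFactoredPerturbation H₀ H Y Z)
    {b : ℝ → ℂ} (hb : Measurable b) {K : ℝ} (hbK : ∀ x, ‖b x‖ ≤ K)
    {T q s₁ s₂ s₃ : ℝ} (hT : 0 < T) (hq1 : 1 ≤ q) (hq : q < 2)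
    (hs₁ : 0 ≤ s₁) (hs₂ : 0 ≤ s₂) (hs₃ : 0 ≤ s₃)
    (hS1 : ∀ (ψ : 𝓗) (G : SimpleFunc ℝ S),
      ‖pairing T (fun t => evol H₀ t ψ) G‖ ≤ s₁ * ‖ψ‖ * timeNorm T q G)
    (hS2 : IsSmoothWithBound H₀ Y s₂)
    (hS3 : IsSmoothWithBound H (mulBounded Z (borelCalc H b)) s₃) (ψ : 𝓗) (G : SimpleFunc ℝ S) :
    ‖pairing T (fun t => evol H t (borelCalc H b ψ)) G‖
      ≤ (s₁ * K + 2 * (1 - 2 ^ (1 / 2 - 1 / q))⁻¹ * s₁ * s₂ * s₃) * ‖ψ‖ * timeNorm T q G := by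
  have hA : ∀ x, Continuous fun t => (evol H t ∘L borelCalc H b) x := fun x =>
    continuous_evol hH _
  have hcont : Continuous fun ψ => pairing T (fun t => evol H t (borelCalc H b ψ)) G :=
    continuous_pairing (A := fun t => evol H t ∘L borelCalc H b) hA
      (fun t x => (norm_evol hH t _).trans_le (norm_borelCalc_le hH hb hbK x)) G
  have hcl : IsClosed {ψ : 𝓗 | ‖pairing T (fun t => evol H t (borelCalc H b ψ)) G‖
      ≤ (s₁ * K + 2 * (1 - 2 ^ (1 / 2 - 1 / q))⁻¹ * s₁ * s₂ * s₃) * ‖ψ‖ * timeNorm T q G} :=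
    isClosed_le hcont.norm (by fun_prop)
  refine hcl.closure_subset_iff.mpr (fun u hu => ?_) (hH.dense_domain ψ)
  obtain ⟨h₀Y, -, -, hZ, hfac⟩ := hfac
  have hfD : borelCalc H b u ∈ H.domain := (borelCalc_mem_domain hH hb hbK ⟨u, hu⟩).1
  have hD : H.domain ≤ (mulBounded Z (borelCalc H b)).domain := fun v hv =>
    hZ (borelCalc_mem_domain hH hb hbK ⟨v, hv⟩).1
  obtain ⟨M, hM⟩ := exists_bounded_factor hH hS3.2.1 hD
  set φ := H ⟨u, hu⟩ - Complex.I • u with hφ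
  have hFint := integral_smooth_le hH hS3 hD hM hT ⟨u, hu⟩
  have hφc := continuous_evol hH φ
  have hFc : Continuous fun t => M (evol H t φ) := by fun_prop
  set f := borelCalc H b u with hf
  -- Because b(H) commutes with the evolution, Z e^{-isH} b(H)u = (Z b(H)) e^{-isH} u, to which the
  -- smoothness of Z b(H) applies.
  have hF : ∀ s (h : evol H s f ∈ H.domain), Z ⟨evol H s f, hZ h⟩ = M (evol H s φ) := by
    intro s h
    obtain ⟨h', -⟩ := evol_mem_domain hH s ⟨u, hu⟩
    rw [hφ, ← factor_evol hH hD hM ⟨u, hu⟩ s h']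
    change _ = Z ⟨borelCalc H b (evol H s u), _⟩
    congr 2
    exact (borelCalc_evol hH hb hbK s u).symm
  have he := continuous_evol hH f
  have hec : ∀ t, evol H t f = evol H₀ t (evol H₀ (-t) (evol H t f)) := fun t => by
    rw [← evol_add hH₀, add_neg_cancel, evol_zero hH₀]
  have key := norm_integral_inner_sub_le (D := √2 * s₂) (e := fun t => evol H t f)
    (c := fun t => evol H₀ (-t) (evol H t f)) h0 hS hH₀ hT hq1 hq hs₁ (by positivity) hS1 he hFc hec
    (fun a m ha ham hm => norm_interaction_sub_le hH₀ hH h₀Y hZ hfac hs₂ hS2 hFc ⟨f, hfD⟩ hF hT ha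
      ham hm) G
  set c₀ := evol H₀ (- -T) (evol H (-T) f) with hc₀
  have hc₀n : ‖c₀‖ ≤ K * ‖u‖ := by
    rw [hc₀, norm_evol hH₀, norm_evol hH]
    exact norm_borelCalc_le hH hb hbK u
  have hN := timeNorm_nonneg T q hT.le G
  have hd : Continuous fun t => evol H t f - evol H₀ t c₀ := he.sub (continuous_evol hH₀ _)
  have e1 : pairing T (fun t => evol H t f) G
      = pairing T (fun t => evol H₀ t c₀) G
        + ∫ t in (-T)..T, inner ℂ (evol H t f - evol H₀ t c₀) (G t).1.1 := by
    rw [pairing, pairing, ← intervalIntegral.integral_add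
      (intervalIntegrable_inner_simpleFunc (continuous_evol hH₀ _) G _ _)
      (intervalIntegrable_inner_simpleFunc hd G _ _)]
    congr 1
    funext t
    rw [← inner_add_left, add_sub_cancel]
  have h2 : √(∫ t in (-T)..T, ‖M (evol H t φ)‖ ^ 2) ≤ √2 * (s₃ * ‖u‖) := by
    refine (Real.sqrt_le_sqrt hFint).trans_eq ?_
    rw [mul_assoc, Real.sqrt_mul zero_le_two, ← mul_pow, Real.sqrt_sq (by positivity)]
  have hρ : (2 : ℝ) ^ (1 / 2 - 1 / q) < 1 := by
    refine Real.rpow_lt_one_of_one_lt_of_neg one_lt_two ?_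
    have := one_div_lt_one_div_of_lt (by linarith) hq
    linarith
  have hρ' : 0 ≤ (1 - (2 : ℝ) ^ (1 / 2 - 1 / q))⁻¹ := inv_nonneg.mpr (by linarith)
  change ‖pairing T (fun t => evol H t f) G‖ ≤ _
  rw [e1]
  refine (norm_add_le _ _).trans ?_
  calc _ ≤ s₁ * (K * ‖u‖) * timeNorm T q G + s₁ * (√2 * s₂) * (1 - 2 ^ (1 / 2 - 1 / q))⁻¹
          * (√2 * (s₃ * ‖u‖)) * timeNorm T q G := by
        refine add_le_add ((hS1 c₀ G).trans ?_) (key.trans ?_)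
        · gcongr
        · gcongr
    _ = (s₁ * K + (√2 * √2) * (1 - 2 ^ (1 / 2 - 1 / q))⁻¹ * s₁ * s₂ * s₃) * ‖u‖ * timeNorm T q G := by
        ring
    _ = _ := by rw [Real.mul_self_sqrt zero_le_two]

end SpectralCalc

theorem mainTheorem9
    {𝓗 : Type*} [NormedAddCommGroup 𝓗] [InnerProductSpace ℂ 𝓗] [CompleteSpace 𝓗]
    {𝓑 : Type*} [NormedAddCommGroup 𝓑] [NormedSpace ℂ 𝓑] [CompleteSpace 𝓑]
    -- the Banach couple `(𝓗, 𝓑)`, embedded in a Hausdorff topological vector space `V`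
    {V : Type*} [AddCommGroup V] [Module ℂ V] [TopologicalSpace V] [IsTopologicalAddGroup V]
    [ContinuousSMul ℂ V] [T2Space V]
    (i : 𝓗 →L[ℂ] V) (hi : Function.Injective i) (j : 𝓑 →L[ℂ] V) (hj : Function.Injective j)
    -- the operators
    (H₀ H Y Z : 𝓗 →ₗ.[ℂ] 𝓗) (hH₀ : IsSelfAdjoint H₀) (hH : IsSelfAdjoint H)
    (hYd : Dense (Y.domain : Set 𝓗)) (hYc : Y.IsClosed)
    (hZd : Dense (Z.domain : Set 𝓗)) (hZc : Z.IsClosed)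
    (hfac : SpectralCalc.IsFactoredPerturbation H₀ H Y Z)
    -- the bounded Borel function
    (b : ℝ → ℂ) (hb : Measurable b) (hbb : BddAbove (Set.range fun x => ‖b x‖))
    (T : ℝ) (hT : 0 < T) (p s₁ s₂ s₃ : ℝ) (hp : 2 < p)
    (hs₁ : 0 < s₁) (hs₂ : 0 < s₂) (hs₃ : 0 < s₃)
    -- free Strichartz estimates
    (hS1 : ∀ (ψ : 𝓗) (G : MeasureTheory.SimpleFunc ℝ (SpectralCalc.interSpace i j H₀.domain)),
      ‖SpectralCalc.pairing T (fun t => SpectralCalc.evol H₀ t ψ) G‖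
        ≤ s₁ * ‖ψ‖ * SpectralCalc.timeNorm T (p / (p - 1)) G)
    (hS2 : SpectralCalc.IsSmoothWithBound H₀ Y s₂)
    (hS3 : SpectralCalc.IsSmoothWithBound H
      (SpectralCalc.mulBounded Z (SpectralCalc.borelCalc H b)) s₃)
    (ψ : 𝓗) (G : MeasureTheory.SimpleFunc ℝ (SpectralCalc.interSpace i j H₀.domain)) :
    ‖SpectralCalc.pairing T (fun t => SpectralCalc.evol H t (SpectralCalc.borelCalc H b ψ)) G‖
      ≤ (s₁ * (⨆ x, ‖b x‖) + 2 * SpectralCalc.christKiselevConst p * s₁ * s₂ * s₃)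
          * ‖ψ‖ * SpectralCalc.timeNorm T (p / (p - 1)) G := by
  obtain ⟨hp₀, hp₁⟩ : 0 < p ∧ 0 < p - 1 := ⟨by linarith, by linarith⟩
  have hq1 : 1 ≤ p / (p - 1) := by rw [le_div_iff₀ hp₁]; linarith
  have hq2 : p / (p - 1) < 2 := by rw [div_lt_iff₀ hp₁]; linarith
  refine (SpectralCalc.norm_pairing_evol_le (by simp [SpectralCalc.interSpace])
    (fun x hx hx2 => hi (by rw [hx.2, hx2, map_zero, map_zero])) hH₀ hH hfac hb
    (fun x => le_ciSup hbb x) hT hq1 hq2 hs₁.le hs₂.le hs₃.le hS1 hS2 hS3 ψ G).trans ?_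
  have hN := SpectralCalc.timeNorm_nonneg T (p / (p - 1)) hT.le G
  have hσ : (1 / 2 - 1 / (p / (p - 1)) : ℝ) = 1 / p - 1 / 2 := by
    field_simp
    ring
  have hρ : (2 : ℝ) ^ (1 / p - 1 / 2) < 1 := by
    refine Real.rpow_lt_one_of_one_lt_of_neg one_lt_two ?_
    have := one_div_lt_one_div_of_lt two_pos hp
    linarith
  -- The bisection argument gives the constant without the factor 2^{2/p} ≥ 1.
  have hC : (1 - (2 : ℝ) ^ (1 / p - 1 / 2))⁻¹ ≤ SpectralCalc.christKiselevConst p :=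
    le_mul_of_one_le_left (inv_nonneg.mpr (by linarith))
      (Real.one_le_rpow one_le_two (by positivity))
  rw [hσ]
  gcongr
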